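/- Setting. Let $M=M_1\times\dots\times M_d\subseteq\mathbb R^d$ and let $D:M\times M\to\mathbb R$ be a distance measure. $D$ is (right-sided) $\mu$-defective if $|D(a,q)-D(b,q)|\le\mu D(b,a)$ for all $a,b,q\in M$. Three families are considered. (A) $D$ is symmetric; $D(x,y)=0$ iff $x=y$; $D$ is decomposable, i.e. $D(x,y)=g(\sum_i f_i(x_i,y_i))$ with $g$ monotone on $[0,\infty)$, $f_i\ge 0$ and $f_i(u,u)=0$; along every axis-parallel line $D$ is monotonic ($0\le D(a,b)<D(a,c)$ and $0\le D(b,c)<D(a,c)$ for $a<b<c$) and satisfies the reverse triangle inequality $D(a,b)+D(b,c)\le D(a,c)$ for $a\le b\le c$; $D(x,y)\le\Delta\ell$ whenever all sides of the axis-parallel box with opposite corners $x,y$ have $D$-length at most $\ell$; and $D$ is $\mu$-defective. (B), (C) The $M_i$ are intervals, $\phi_i:M_i\to\mathbb R$ is strictly convex and differentiable, $D_\phi(x,y)=\sum_i\bigl(\phi_i(x_i)-\phi_i(y_i)-\phi_i'(y_i)(x_i-y_i)\bigr)$ and $D_{s\phi}(x,y)=\frac12(D_\phi(x,y)+D_\phi(y,x))$.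 In (B), $D=\sqrt{D_{s\phi}}$ is $\mu$-defective; in (C), $D=\sqrt{D_\phi}$ is right-sided $\mu$-defective. Balls are left-balls: $B(m,r)=\{x: D(m,x)<r\}$. For a finite point set $Q$, $m\in Q$ and $\tau>0$, the pair $B_{\rm in}=B(m,r_1)$, $B_{\rm out}=B(m,r_2)$ is a $\tau$-ring separator of $Q$ with balance constant $c$ (allowing repeated points) if $|Q|/c<|Q\cap B_{\rm in}|<(1-1/c)|Q|$, $|Q|/c<|Q\cap B_{\rm out}|<(1-1/c)|Q|$, $r_2\ge(1+\tau)r_1$, and at most $\tau|Q|$ points of $Q$ lie in the ring $B_{\rm out}\setminus B_{\rm in}$. A $\tau$-ring tree for $P$ is a binary tree obtained by recursively splitting a set $Q$ by such a separator into $Q\cap B_{\rm out}$ and $Q\setminus B_{\rm in}$ (points in the ring are repeated in both children) until single points are left; an inner node stores $m,r_1,r_2$. Algorithms are programs of a randomized real RAM, where arithmetic operations, memory accesses, comparisons, evaluation of $D$ at two input points and drawing a uniform random integer have unit cost; storage bounds hold for the working memory and for the integers in it. $\log$ is the natural logarithm. Claim. There is an absolute constant $K>0$ such that, with $$c=(K\Delta(\mu+1))^d\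 \text{ in case (A)},\qquad c=K\,d^{d/2}(\mu+1)^d\ \text{ in case (B)},\qquad c=K\,d^{d}(\mu+1)^{2d}\ \text{ in case (C)},$$ the following holds in each of the three cases. There are a constant $C>0$ and programs, which depend only on $d$ and $\mu$ (and on $\Delta$ in case (A)), that achieve the following for every $D$ of the family and every set $P$ of $n$ points of $M$. 1. Given $c'$ with $1\le c'\le n$, a ball $\{x: D(m,x)\le r\}$ with $m\in P$ that contains at least $n/c'$ points of $P$ is computed in expected time at most $K n c'$ and with storage at most $Kn$; with probability at least $1-1/e$, $r$ is at most $\mu+1$ times the smallest (infimal) radius of a closed left-ball with centre in $M$ containing at least $n/c'$ points of $P$. 2. Given $t$ with $1<t<n$, a $\frac1t$-ring separator of $P$ with balance constant $c$ is computed in expected time at most $Cn$ and with storage at most $Cn$. 3. If $n\ge2$, a $\frac1{\log n}$-ring tree for $P$ with balance constant $c$, of depth at most $c\log n$ and with at most $Cn$ nodes, is computed with storage at most $Cn$ and in expected time at most $C\cdot c\,n\log n$. Thus the depth is $O(d^{d/2}(\mu+1)^d\log n)$ for $\sqrt{D_{s\phi}}$ and $O(d^{d}(\mu+1)^{2d}\log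 n)$ for $\sqrt{D_\phi}$, with absolute constants. -/

import Mathlib

/-! ### Distance measures -/

/-- A distance measure on a product domain `M = M₁ × ⋯ × M_d ⊆ ℝ^d`. Only the values of `dist` on
pairs of points of the domain matter. -/
structure DistanceMeasure (d : ℕ) where
  dom : Fin d → Set ℝ
  dist : (Fin d → ℝ) → (Fin d → ℝ) → ℝ

namespace DistanceMeasure

variable {d : ℕ}

/-- The set `M = M₁ × ⋯ × M_d`. -/
def carrier (X : DistanceMeasure d) : Set (Fin d → ℝ) := {x | ∀ i, x i ∈ X.dom i}

/-- The restriction of the distance to the line through `x` parallel to the `i`-th axis. -/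
def line (X : DistanceMeasure d) (x : Fin d → ℝ) (i : Fin d) (u v : ℝ) : ℝ :=
  X.dist (Function.update x i u) (Function.update x i v)

/-- `D(x,y) = 0` iff `x = y`. -/
def IsReflexive (X : DistanceMeasure d) : Prop :=
  ∀ x ∈ X.carrier, ∀ y ∈ X.carrier, (X.dist x y = 0 ↔ x = y)

def IsSymmetric (X : DistanceMeasure d) : Prop :=
  ∀ x ∈ X.carrier, ∀ y ∈ X.carrier, X.dist x y = X.dist y x

/-- Monotonicity, along every axis-parallel line. -/
def IsMonotonic (X : DistanceMeasure d) : Prop :=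
  ∀ x ∈ X.carrier, ∀ i, ∀ a ∈ X.dom i, ∀ b ∈ X.dom i, ∀ c ∈ X.dom i, a < b → b < c →
    (0 ≤ X.line x i a b ∧ X.line x i a b < X.line x i a c) ∧
    (0 ≤ X.line x i b c ∧ X.line x i b c < X.line x i a c)

/-- The reverse triangle inequality, along every axis-parallel line. -/
def IsReverseTriangle (X : DistanceMeasure d) : Prop :=
  ∀ x ∈ X.carrier, ∀ i, ∀ a ∈ X.dom i, ∀ b ∈ X.dom i, ∀ c ∈ X.dom i, a ≤ b → b ≤ c →
    X.line x i a b + X.line x i b c ≤ X.line x i a c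

/-- `D(x,y) = g (∑ i, f i (x i) (y i))` with `g` monotone on `[0,∞)` and `f i ≥ 0` vanishing on the
diagonal. -/
def IsDecomposable (X : DistanceMeasure d) : Prop :=
  ∃ (g : ℝ → ℝ) (f : Fin d → ℝ → ℝ → ℝ), MonotoneOn g (Set.Ici 0) ∧
    (∀ i, ∀ u ∈ X.dom i, f i u u = 0) ∧
    (∀ i, ∀ u ∈ X.dom i, ∀ v ∈ X.dom i, 0 ≤ f i u v) ∧
    ∀ x ∈ X.carrier, ∀ y ∈ X.carrier, X.dist x y = g (∑ i, f i (x i) (y i))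

/-- A box whose sides have length at most `ℓ` has diameter at most `Δ ℓ`. -/
def BoxDiameterLE (X : DistanceMeasure d) (Δ : ℝ) : Prop :=
  ∀ x ∈ X.carrier, ∀ y ∈ X.carrier, ∀ ℓ : ℝ,
    (∀ i, X.line x i (x i) (y i) ≤ ℓ) → X.dist x y ≤ Δ * ℓ

/-- (Right-sided) `μ`-defectiveness; for a symmetric distance the side is irrelevant. The
inequality is not strict, as a strict one would fail for `a = b`. -/
def IsDefective (X : DistanceMeasure d) (μ : ℝ) : Prop :=
  ∀ a ∈ X.carrier, ∀ b ∈ X.carrier, ∀ q ∈ X.carrier,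
    |X.dist a q - X.dist b q| ≤ μ * X.dist b a

end DistanceMeasure

/-! ### Decomposable Bregman divergences -/

/-- The generators `φ₁, …, φ_d` of a decomposable Bregman divergence: strictly convex and
differentiable on the intervals `M₁, …, M_d`. -/
def IsBregmanGenerator {d : ℕ} (M : Fin d → Set ℝ) (φ : Fin d → ℝ → ℝ) : Prop :=
  ∀ i, StrictConvexOn ℝ (M i) (φ i) ∧ DifferentiableOn ℝ (φ i) (M i)

/-- `D_φ(x,y) = ∑ i, φᵢ(xᵢ) - φᵢ(yᵢ) - φᵢ'(yᵢ) (xᵢ - yᵢ)`. -/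
noncomputable def bregmanDiv {d : ℕ} (M : Fin d → Set ℝ) (φ : Fin d → ℝ → ℝ)
    (x y : Fin d → ℝ) : ℝ :=
  ∑ i, (φ i (x i) - φ i (y i) - derivWithin (φ i) (M i) (y i) * (x i - y i))

/-- `D_{sφ}(x,y) = (D_φ(x,y) + D_φ(y,x)) / 2`. -/
noncomputable def symBregmanDiv {d : ℕ} (M : Fin d → Set ℝ) (φ : Fin d → ℝ → ℝ)
    (x y : Fin d → ℝ) : ℝ :=
  (bregmanDiv M φ x y + bregmanDiv M φ y x) / 2

/-! ### The three families of distance measures -/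

/-- Symmetric, reflexive, monotonic, decomposable, `μ`-defective distance measures with the reverse
triangle inequality in which a box of side length `ℓ` has diameter at most `Δ ℓ`. -/
def GeneralSymmetric (d : ℕ) (Δ μ : ℝ) : Set (DistanceMeasure d) :=
  {X | X.IsReflexive ∧ X.IsSymmetric ∧ X.IsMonotonic ∧ X.IsReverseTriangle ∧
    X.IsDecomposable ∧ X.BoxDiameterLE Δ ∧ X.IsDefective μ}

/-- The `μ`-defective distance measures `√D_{sφ}`. -/
def SqrtSymBregman (d : ℕ) (μ : ℝ) : Set (DistanceMeasure d) :=
  {X | (∃ φ, IsBregmanGenerator X.dom φ ∧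
      X.dist = fun x y => Real.sqrt (symBregmanDiv X.dom φ x y)) ∧ X.IsDefective μ}

/-- The (right-sided) `μ`-defective distance measures `√D_φ`. -/
def SqrtBregman (d : ℕ) (μ : ℝ) : Set (DistanceMeasure d) :=
  {X | (∃ φ, IsBregmanGenerator X.dom φ ∧
      X.dist = fun x y => Real.sqrt (bregmanDiv X.dom φ x y)) ∧ X.IsDefective μ}

/-! ### Ring separators and ring trees

The points are `p 0, …, p (n-1)`, sets of points are sets of indices, and `δ i j = D(p i, p j)`. -/

open Classical in
/-- The points of `Q` in the open (left-)ball `B(p m, r) = {x | D(p m, x) < r}`. -/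
noncomputable def pointsInBall {n : ℕ} (δ : Fin n → Fin n → ℝ) (Q : Finset (Fin n)) (m : Fin n)
    (r : ℝ) : Finset (Fin n) :=
  Q.filter fun j => δ m j < r

/-- The ring with centre `p m` and radii `r₁, r₂` is a `τ`-ring separator of `Q` with balance
constant `c`, where instead of an empty ring at most `τ |Q|` points in the ring are allowed (these
points are repeated on both sides). -/
structure IsRingSeparator {n : ℕ} (δ : Fin n → Fin n → ℝ) (c τ : ℝ) (Q : Finset (Fin n))
    (m : Fin n) (r₁ r₂ : ℝ) : Prop where
  center_mem : m ∈ Q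
  inner_lower : (Q.card : ℝ) / c < ((pointsInBall δ Q m r₁).card : ℝ)
  inner_upper : ((pointsInBall δ Q m r₁).card : ℝ) < (1 - 1 / c) * Q.card
  outer_lower : (Q.card : ℝ) / c < ((pointsInBall δ Q m r₂).card : ℝ)
  outer_upper : ((pointsInBall δ Q m r₂).card : ℝ) < (1 - 1 / c) * Q.card
  thickness : (1 + τ) * r₁ ≤ r₂
  few_repeated : ((pointsInBall δ Q m r₂ \ pointsInBall δ Q m r₁).card : ℝ) ≤ τ * Q.card

/-- Binary trees whose leaves hold a point and whose inner nodes hold a ring. -/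
inductive RingTree (n : ℕ) : Type
  | leaf (j : Fin n) : RingTree n
  | node (m : Fin n) (r₁ r₂ : ℝ) (inner outer : RingTree n) : RingTree n

namespace RingTree

variable {n : ℕ}

def depth : RingTree n → ℕ
  | leaf _ => 0
  | node _ _ _ l r => max l.depth r.depth + 1

/-- The number of nodes; a node occupies a bounded number of memory cells. -/
def size : RingTree n → ℕ
  | leaf _ => 1
  | node _ _ _ l r => l.size + r.size + 1

/-- `T` is a `τ`-ring tree for `Q`: an inner node splits its set by a `τ`-ring separator into the
points in the outer ball and the points outside the inner ball (so the points in the ring are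
repeated in both children), until single points are left. -/
def IsRingTreeFor (δ : Fin n → Fin n → ℝ) (c τ : ℝ) : RingTree n → Finset (Fin n) → Prop
  | leaf j, Q => Q = {j}
  | node m r₁ r₂ l r, Q => IsRingSeparator δ c τ Q m r₁ r₂ ∧
      l.IsRingTreeFor δ c τ (pointsInBall δ Q m r₂) ∧
      r.IsRingTreeFor δ c τ (Q \ pointsInBall δ Q m r₁)

end RingTree

/-! ### Randomized real random access machines

There is an integer memory and a real memory, both with unit cost operations and indirect
addressing. A step may also evaluate the distance of two input points, or draw a uniformly
distributed integer. -/

namespace RealRAM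

structure State where
  /-- integer memory -/
  N : ℕ → ℕ
  /-- real memory -/
  R : ℕ → ℝ

inductive Test
  | natLT (i j : ℕ)
  | realLT (i j : ℕ)

inductive Cmd
  | skip
  | natConst (i k : ℕ)
  | natAdd (i j k : ℕ)
  | natSub (i j k : ℕ)
  | natLoad (i j : ℕ)
  | natStore (i j : ℕ)
  | natRand (i j : ℕ)
  | realOfNat (i j : ℕ)
  | realAdd (i j k : ℕ)
  | realSub (i j k : ℕ)
  | realMul (i j k : ℕ)
  | realDiv (i j k : ℕ)
  | realLoad (i j : ℕ)
  | realStore (i j : ℕ)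
  | distance (i j k : ℕ)
  | seq (a b : Cmd)
  | cond (t : Test) (a b : Cmd)
  | loop (t : Test) (a : Cmd)

def State.setN (s : State) (i v : ℕ) : State := { s with N := Function.update s.N i v }

noncomputable def State.setR (s : State) (i : ℕ) (v : ℝ) : State :=
  { s with R := Function.update s.R i v }

def Test.holds (s : State) : Test → Prop
  | natLT i j => s.N i < s.N j
  | realLT i j => s.R i < s.R j

/-- A stack of commands that remain to be executed, and the memory. -/
abbrev Config := List Cmd × State

open Classical in
/-- One step, with distance oracle `E`: the first command of the stack is executed. -/
noncomputable def step (E : ℕ → ℕ → ℝ) : Config → PMF Config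
  | ([], s) => PMF.pure ([], s)
  | (Cmd.skip :: w, s) => PMF.pure (w, s)
  | (Cmd.natConst i k :: w, s) => PMF.pure (w, s.setN i k)
  | (Cmd.natAdd i j k :: w, s) => PMF.pure (w, s.setN i (s.N j + s.N k))
  | (Cmd.natSub i j k :: w, s) => PMF.pure (w, s.setN i (s.N j - s.N k))
  | (Cmd.natLoad i j :: w, s) => PMF.pure (w, s.setN i (s.N (s.N j)))
  | (Cmd.natStore i j :: w, s) => PMF.pure (w, s.setN (s.N i) (s.N j))
  | (Cmd.natRand i j :: w, s) =>
      (PMF.uniformOfFintype (Fin (s.N j + 1))).map fun v => (w, s.setN i v)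
  | (Cmd.realOfNat i j :: w, s) => PMF.pure (w, s.setR i (s.N j))
  | (Cmd.realAdd i j k :: w, s) => PMF.pure (w, s.setR i (s.R j + s.R k))
  | (Cmd.realSub i j k :: w, s) => PMF.pure (w, s.setR i (s.R j - s.R k))
  | (Cmd.realMul i j k :: w, s) => PMF.pure (w, s.setR i (s.R j * s.R k))
  | (Cmd.realDiv i j k :: w, s) => PMF.pure (w, s.setR i (s.R j / s.R k))
  | (Cmd.realLoad i j :: w, s) => PMF.pure (w, s.setR i (s.R (s.N j)))
  | (Cmd.realStore i j :: w, s) => PMF.pure (w, s.setR (s.N i) (s.R j))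
  | (Cmd.distance i j k :: w, s) => PMF.pure (w, s.setR i (E (s.N j) (s.N k)))
  | (Cmd.seq a b :: w, s) => PMF.pure (a :: b :: w, s)
  | (Cmd.cond t a b :: w, s) => PMF.pure (if t.holds s then a :: w else b :: w, s)
  | (Cmd.loop t a :: w, s) => PMF.pure (if t.holds s then a :: Cmd.loop t a :: w else w, s)

/-- The distribution of the configuration after `k` steps. -/
noncomputable def run (E : ℕ → ℕ → ℝ) (P : Cmd) (s : State) : ℕ → PMF Config
  | 0 => PMF.pure ([P], s)
  | k + 1 => (run E P s k).bind (step E)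

/-- The expected number of steps until the machine halts, as `∑ k, ℙ(running after k steps)`. -/
noncomputable def expectedTime (E : ℕ → ℕ → ℝ) (P : Cmd) (s : State) : ENNReal :=
  ∑' k, (run E P s k).toOuterMeasure {κ | κ.1 ≠ []}

/-- Whenever the machine halts, the memory satisfies `post`. -/
def HaltsOnlyWith (E : ℕ → ℕ → ℝ) (P : Cmd) (s : State) (post : State → Prop) : Prop :=
  ∀ k, ∀ κ ∈ (run E P s k).support, κ.1 = [] → post κ.2

/-- All integers that ever appear in the memory are at most `B`. As the addresses in load and store
commands are such integers, this also bounds the memory that is used (besides the fixed number of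
cells that the program addresses directly). -/
def MemoryBounded (E : ℕ → ℕ → ℝ) (P : Cmd) (s : State) (B : ℝ) : Prop :=
  ∀ k, ∀ κ ∈ (run E P s k).support, ∀ i, (κ.2.N i : ℝ) ≤ B

/-- The machine halts with a memory that does not satisfy `good` with probability at most `ε`. -/
def FailsWithProbLE (E : ℕ → ℕ → ℝ) (P : Cmd) (s : State) (good : State → Prop) (ε : ℝ) : Prop :=
  ∀ k, (run E P s k).toOuterMeasure {κ | κ.1 = [] ∧ ¬ good κ.2} ≤ ENNReal.ofReal ε

/-- The initial memory: `n` in the integer memory and `t` in the real memory, all else `0`. -/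
noncomputable def initial (n : ℕ) (t : ℝ) : State where
  N := Function.update (fun _ => 0) 0 n
  R := Function.update (fun _ => 0) 0 t

/-- The distance oracle for `n` points with distances `δ`. -/
noncomputable def oracle {n : ℕ} (δ : Fin n → Fin n → ℝ) (a b : ℕ) : ℝ :=
  if h : a < n ∧ b < n then δ ⟨a, h.1⟩ ⟨b, h.2⟩ else 0

/-- The memory holds the tree `T` with its root at address `a`. -/
def Stores {n : ℕ} (s : State) : ℕ → RingTree n → Prop
  | a, .leaf j => s.N a = 0 ∧ s.N (a + 1) = j
  | a, .node m r₁ r₂ l r => s.N a = 1 ∧ s.N (a + 1) = m ∧ s.R a = r₁ ∧ s.R (a + 1) = r₂ ∧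
      Stores s (s.N (a + 2)) l ∧ Stores s (s.N (a + 3)) r

end RealRAM

/-! ### What is claimed for a family of distance measures -/

/-- A point set of `n` points in the domain of `X`. -/
def IsPointSet {d n : ℕ} (X : DistanceMeasure d) (p : Fin n → Fin d → ℝ) : Prop :=
  Function.Injective p ∧ ∀ j, p j ∈ X.carrier

/-- The distances between the points of a point set. -/
def pairDist {d n : ℕ} (X : DistanceMeasure d) (p : Fin n → Fin d → ℝ) (i j : Fin n) : ℝ :=
  X.dist (p i) (p j)

open Classical in
/-- The number of points of the point set in the closed (left-)ball `{y | D(x, y) ≤ r}`. -/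
noncomputable def closedBallCount {d n : ℕ} (X : DistanceMeasure d) (p : Fin n → Fin d → ℝ)
    (x : Fin d → ℝ) (r : ℝ) : ℕ :=
  (Finset.univ.filter fun j => X.dist x (p j) ≤ r).card

/-- The smallest radius of a ball, with centre anywhere in the domain, that contains at least
`n / c` of the points. -/
noncomputable def optRadius {d n : ℕ} (X : DistanceMeasure d) (p : Fin n → Fin d → ℝ)
    (c : ℝ) : ℝ :=
  sInf {r | ∃ x ∈ X.carrier, (n : ℝ) / c ≤ (closedBallCount X p x r : ℝ)}

/-- A fixed program finds, for every distance measure of the family, every point set of `n` points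
and every `c` with `1 ≤ c ≤ n`, a ball (with centre `N[0]` and radius `R[0]`) that contains at least
`n / c` points, in expected time at most `C n c`; with probability at least `1 - 1/e` its radius is
at most `μ + 1` times the smallest possible one. -/
def ComputesApproxBalls {d : ℕ} (F : Set (DistanceMeasure d)) (μ C : ℝ) : Prop :=
  ∃ P : RealRAM.Cmd, ∀ X ∈ F, ∀ (n : ℕ) (p : Fin n → Fin d → ℝ), IsPointSet X p →
    ∀ c : ℝ, 1 ≤ c → c ≤ n →
      RealRAM.expectedTime (RealRAM.oracle (pairDist X p)) P (RealRAM.initial n c)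
        ≤ ENNReal.ofReal (C * (n * c)) ∧
      RealRAM.MemoryBounded (RealRAM.oracle (pairDist X p)) P (RealRAM.initial n c) (C * n) ∧
      (RealRAM.HaltsOnlyWith (RealRAM.oracle (pairDist X p)) P (RealRAM.initial n c) fun s =>
        ∃ m : Fin n, s.N 0 = m ∧
          (n : ℝ) / c ≤ (closedBallCount X p (p m) (s.R 0) : ℝ)) ∧
      RealRAM.FailsWithProbLE (RealRAM.oracle (pairDist X p)) P (RealRAM.initial n c)
        (fun s => s.R 0 ≤ (μ + 1) * optRadius X p c) (Real.exp (-1))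

/-- A fixed program finds, for every distance measure of the family, every point set of `n` points
and every `t` with `1 < t < n`, a `1/t`-ring separator with balance constant `c` (with centre
`N[0]` and radii `R[0], R[1]`) in expected time at most `C n`. -/
def ComputesRingSeparators {d : ℕ} (F : Set (DistanceMeasure d)) (c C : ℝ) : Prop :=
  ∃ P : RealRAM.Cmd, ∀ X ∈ F, ∀ (n : ℕ) (p : Fin n → Fin d → ℝ), IsPointSet X p →
    ∀ t : ℝ, 1 < t → t < n →
      RealRAM.expectedTime (RealRAM.oracle (pairDist X p)) P (RealRAM.initial n t)
        ≤ ENNReal.ofReal (C * n) ∧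
      RealRAM.MemoryBounded (RealRAM.oracle (pairDist X p)) P (RealRAM.initial n t) (C * n) ∧
      RealRAM.HaltsOnlyWith (RealRAM.oracle (pairDist X p)) P (RealRAM.initial n t) fun s =>
        ∃ m : Fin n, s.N 0 = m ∧
          IsRingSeparator (pairDist X p) c (1 / t) Finset.univ m (s.R 0) (s.R 1)

/-- A fixed program builds, for every distance measure of the family and every point set of
`n ≥ 2` points, a `1/log n`-ring tree with balance constant `c` (with its root at address `N[0]`)
of depth at most `c log n` and size at most `C n`, in expected time at most `C c n log n` and
memory `C n`. -/
def ComputesRingTrees {d : ℕ} (F : Set (DistanceMeasure d)) (c C : ℝ) : Prop :=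
  ∃ P : RealRAM.Cmd, ∀ X ∈ F, ∀ (n : ℕ) (p : Fin n → Fin d → ℝ), IsPointSet X p → 2 ≤ n →
      RealRAM.expectedTime (RealRAM.oracle (pairDist X p)) P (RealRAM.initial n 0)
        ≤ ENNReal.ofReal (C * (c * n * Real.log n)) ∧
      RealRAM.MemoryBounded (RealRAM.oracle (pairDist X p)) P (RealRAM.initial n 0) (C * n) ∧
      RealRAM.HaltsOnlyWith (RealRAM.oracle (pairDist X p)) P (RealRAM.initial n 0) fun s =>
        ∃ T : RingTree n, RealRAM.Stores s (s.N 0) T ∧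
          T.IsRingTreeFor (pairDist X p) c (1 / Real.log n) Finset.univ ∧
          (T.depth : ℝ) ≤ c * Real.log n ∧ (T.size : ℝ) ≤ C * n

/-! The claim rests on a geometric fact about random rings, on covering numbers of balls, and on a
cost calculus for the machine.

Random rings. Let `k` points be given, and let `R` be the infimum of the radii of balls that hold at
least `κ` of them. By defectiveness, points in a common ball are close to each other: some `κ`
points have mutual distances at most `(μ+1)R` (`exists_subset_dist_le`). Each of them is the centre
of a ball that is nearly as good as the optimal one, so a random input point is a good centre with
probability at least `κ/k`. With `κ = n/c` this already settles the approximate balls: about `c`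
independent centres all fail with probability at most `1/e`. For ring separators, let `κ = k/(36N)`,
where `N` balls of radius `R` cover any ball of radius `9(μ+1)R`. Each of the `N` balls holds fewer
than `κ` points, hence the large ball holds fewer than `k/36` (`card_ball_lt_mul`). Take `m`, `j` in
the cluster, put `r = D(m,j)`, and let the outer radius run through `k` equidistant values in `[r,
9r)`. The rings are thin, so a point lies in few of them, and by double counting only a small
fraction of the rings is too crowded (`le_card_goodRing`). A random triple of centre, point and
radius therefore succeeds with a probability that is at least `1/(20736 N²)` (`le_goodTriples`),
independently of `k`, and rejection sampling finds a separator in linear expected time.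

Coverings. A reverse triangle inequality along the axes cuts a ball into cells such that all points
of a cell are near its corner closest to the centre (`exists_cover_of_cellIndex`). For general
distances the cells fill a box. For Bregman divergences the cell indices lie in a simplex, and
`card_simplexCells_le` counts them by a constant to the power `d` times the power of the radius
ratio; the constant to the power `d` is then absorbed by `d^(d/2)` or `d^d` at the price of an
absolute factor (`exists_pow_le_mul_rpow`).

Trees. Along a separator, `s ↦ s^(1+cτ)` does not increase when summed over the two children,
because `(1+τ) e^(-τ) ≤ 1` (`leafBound_split`). For `τ = 1/log n` its value at `n` is `n e^c`, so
the tree has linear size. The quantity `c log s` drops by at least one from parent to child, which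
bounds the depth and, together with the size, the time.

Machine. The transformer `ert` is defined by recursion on programs. It yields a potential that
decreases in expectation with every step (`step_confPot_le`). Cost weight `1` gives expected times,
weight `0` gives failure probabilities, and the value `∞` excludes forbidden states. Loops need only
an invariant with a potential (`ert_loop_le`). Pieces of code that end for every random outcome are
treated with the simpler calculus `wp`, whose results are transferred by `ert_add_le_of_wp`. -/

open scoped ENNReal

namespace RealRAM

/-! ### Expected cost and postexpectation -/

open Classical in
/-- The expectation of `f` in the final state plus `τ` times the expected number of steps; it is
infinite if an integer above `B` is written. -/
noncomputable def ert (E : ℕ → ℕ → ℝ) (B : ℕ) (τ : ℝ≥0∞) :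
    Cmd → (State → ℝ≥0∞) → State → ℝ≥0∞
  | .skip, f, s => τ + f s
  -- Constants and sums are the only integers that can exceed everything already in memory, so only
  -- these two commands are checked against `B`.
  | .natConst i k, f, s => τ + if k ≤ B then f (s.setN i k) else ⊤
  | .natAdd i j k, f, s => τ + if s.N j + s.N k ≤ B then f (s.setN i (s.N j + s.N k)) else ⊤
  | .natSub i j k, f, s => τ + f (s.setN i (s.N j - s.N k))
  | .natLoad i j, f, s => τ + f (s.setN i (s.N (s.N j)))
  | .natStore i j, f, s => τ + f (s.setN (s.N i) (s.N j))
  | .natRand i j, f, s =>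
      τ + ((s.N j + 1 : ℕ) : ℝ≥0∞)⁻¹ * ∑ v ∈ Finset.range (s.N j + 1), f (s.setN i v)
  | .realOfNat i j, f, s => τ + f (s.setR i (s.N j))
  | .realAdd i j k, f, s => τ + f (s.setR i (s.R j + s.R k))
  | .realSub i j k, f, s => τ + f (s.setR i (s.R j - s.R k))
  | .realMul i j k, f, s => τ + f (s.setR i (s.R j * s.R k))
  | .realDiv i j k, f, s => τ + f (s.setR i (s.R j / s.R k))
  | .realLoad i j, f, s => τ + f (s.setR i (s.R (s.N j)))
  | .realStore i j, f, s => τ + f (s.setR (s.N i) (s.R j))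
  | .distance i j k, f, s => τ + f (s.setR i (E (s.N j) (s.N k)))
  | .seq a b, f, s => τ + ert E B τ a (ert E B τ b f) s
  | .cond t a b, f, s => τ + if t.holds s then ert E B τ a f s else ert E B τ b f s
  -- The infimum of all pre-fixed points, hence the least one; an upper bound for a loop needs a
  -- single invariant `I`.
  | .loop t a, f, s =>
      ⨅ (I : State → ℝ≥0∞) (_ : ∀ s, τ + (if t.holds s then ert E B τ a I s else f s) ≤ I s), I s

variable {E : ℕ → ℕ → ℝ} {B : ℕ} {τ : ℝ≥0∞}

theorem ert_mono (P : Cmd) {f g : State → ℝ≥0∞} (h : ∀ s, f s ≤ g s) (s : State) :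
    ert E B τ P f s ≤ ert E B τ P g s := by
  induction P generalizing f g s with
  | seq a b iha ihb => exact add_le_add_right (iha (ihb h) s) _
  | cond t a b iha ihb =>
    simp only [ert]; split_ifs
    · exact add_le_add_right (iha h s) _
    · exact add_le_add_right (ihb h s) _
  | loop t a iha =>
    simp only [ert]
    refine le_iInf₂ fun I hI => iInf₂_le_of_le I (fun s => le_trans ?_ (hI s)) le_rfl
    split_ifs
    · rfl
    · exact add_le_add_right (h s) _
  | natConst i k => simp only [ert]; split_ifs <;> gcongr; exact h _
  | natAdd i j k => simp only [ert]; split_ifs <;> gcongr; exact h _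
  | natRand i j => simp only [ert]; gcongr; exact h _
  | _ => exact add_le_add_right (h _) _

open Classical in
-- By monotonicity, the infimum of the pre-fixed points is itself pre-fixed. This half of
-- Knaster–Tarski is what soundness needs: unrolling a loop once does not raise the potential.
theorem ert_loop_unfold (t : Test) (a : Cmd) (f : State → ℝ≥0∞) (s : State) :
    τ + (if t.holds s then ert E B τ a (ert E B τ (.loop t a) f) s else f s)
      ≤ ert E B τ (.loop t a) f s := by
  conv_rhs => rw [ert]
  refine le_iInf₂ fun I hI => le_trans ?_ (hI s)
  split_ifs
  · refine add_le_add_right (ert_mono _ (fun s' => ?_) _) _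
    rw [ert]
    exact iInf₂_le I hI
  · rfl

open Classical in
/-- Loop rule with ghost variables `g : G`, an invariant and a potential. -/
theorem ert_loop_le {G : Type*} (Inv : G → State → Prop) (pot : G → ℝ≥0∞) {t : Test} {a : Cmd}
    {f : State → ℝ≥0∞}
    (hexit : ∀ g s, Inv g s → ¬ t.holds s → τ + f s ≤ pot g)
    (hbody : ∀ g s, Inv g s → t.holds s → ∀ I : State → ℝ≥0∞,
      (∀ g' s', Inv g' s' → I s' ≤ pot g') → τ + ert E B τ a I s ≤ pot g)
    {g : G} {s : State} (h : Inv g s) : ert E B τ (.loop t a) f s ≤ pot g := by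
  rw [ert]
  refine iInf₂_le_of_le (fun s => ⨅ g, ⨅ (_ : Inv g s), pot g) (fun s => ?_) (iInf₂_le g h)
  refine le_iInf₂ fun g hg => ?_
  split_ifs with ht
  · exact hbody g s hg ht _ fun g' s' h' => iInf₂_le g' h'
  · exact hexit g s hg ht

/-- The potential of a stack of commands. -/
noncomputable def ertStack (E : ℕ → ℕ → ℝ) (B : ℕ) (τ : ℝ≥0∞) (f : State → ℝ≥0∞) :
    List Cmd → State → ℝ≥0∞
  | [], s => f s
  | a :: w, s => ert E B τ a (ertStack E B τ f w) s

open Classical in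
/-- The potential of a configuration; infinite if an integer in the memory exceeds `B`. -/
noncomputable def confPot (E : ℕ → ℕ → ℝ) (B : ℕ) (τ : ℝ≥0∞) (f : State → ℝ≥0∞) (κ : Config) :
    ℝ≥0∞ :=
  if ∀ i, κ.2.N i ≤ B then ertStack E B τ f κ.1 κ.2 else ⊤

theorem setN_le {s : State} (hs : ∀ i, s.N i ≤ B) {i v : ℕ} (hv : v ≤ B) :
    ∀ j, (s.setN i v).N j ≤ B := by
  intro j
  simp only [State.setN, Function.update_apply]
  split_ifs
  · exact hv
  · exact hs j

theorem tsum_pure_mul {α : Type*} (a : α) (g : α → ℝ≥0∞) :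
    ∑' x, PMF.pure a x * g x = g a := by
  classical
  rw [tsum_eq_single a]
  · simp
  · intro b hb; simp [PMF.pure_apply, hb]

theorem tsum_map_mul {α β : Type*} (p : PMF α) (h : α → β) (g : β → ℝ≥0∞) :
    ∑' x, p.map h x * g x = ∑' a, p a * g (h a) := by
  classical
  simp only [PMF.map_apply, ← ENNReal.tsum_mul_right]
  rw [ENNReal.tsum_comm]
  refine tsum_congr fun a => ?_
  rw [tsum_eq_single (h a)]
  · simp
  · intro b hb; simp [hb]

theorem tsum_bind_mul {α β : Type*} (p : PMF α) (h : α → PMF β) (g : β → ℝ≥0∞) :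
    ∑' x, p.bind h x * g x = ∑' a, p a * ∑' x, h a x * g x := by
  simp only [PMF.bind_apply, ← ENNReal.tsum_mul_right, ← ENNReal.tsum_mul_left]
  rw [ENNReal.tsum_comm]
  simp only [mul_assoc]

theorem tsum_uniform_mul (n : ℕ) (g : ℕ → ℝ≥0∞) :
    ∑' v : Fin (n + 1), PMF.uniformOfFintype (Fin (n + 1)) v * g v
      = ((n + 1 : ℕ) : ℝ≥0∞)⁻¹ * ∑ v ∈ Finset.range (n + 1), g v := by
  rw [tsum_fintype, Finset.mul_sum, Finset.sum_range]
  refine Finset.sum_congr rfl fun v _ => ?_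
  simp [PMF.uniformOfFintype_apply]

open Classical in
/-- The potential decreases, in expectation, by `τ` in each step. -/
theorem step_confPot_le (f : State → ℝ≥0∞) (κ : Config) :
    (if κ.1 ≠ [] then τ else 0) + ∑' κ', step E κ κ' * confPot E B τ f κ'
      ≤ confPot E B τ f κ := by
  obtain ⟨w, s⟩ := κ
  by_cases hs : ∀ i, s.N i ≤ B
  swap
  · have : confPot E B τ f (w, s) = ⊤ := by rw [confPot, if_neg hs]
    rw [this]; exact le_top
  have eq0 : ∀ w, confPot E B τ f (w, s) = ertStack E B τ f w s := by
    intro w; rw [confPot, if_pos hs]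
  have eqN : ∀ w i v, v ≤ B → confPot E B τ f (w, s.setN i v) = ertStack E B τ f w (s.setN i v) := by
    intro w i v hv; rw [confPot, if_pos (setN_le hs hv)]
  have eqR : ∀ w i v, confPot E B τ f (w, s.setR i v) = ertStack E B τ f w (s.setR i v) := by
    intro w i v; rw [confPot, if_pos]; exact hs
  rcases w with _ | ⟨a, w⟩
  · simp [step]
  rw [eq0, ertStack]
  rcases a with _ | _ | _ | _ | _ | _ | _ | _ | _ | _ | _ | _ | _ | _ | _ | _ | _ | _
  case natConst i k =>
    simp only [step, tsum_pure_mul, ert]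
    split_ifs with h1 h2 <;> first | simp at h1; done | simp [*]
  case natAdd i j k =>
    simp only [step, tsum_pure_mul, ert]
    split_ifs with h1 h2 <;> first | simp at h1; done | simp [*]
  case natSub i j k =>
    simp only [step, tsum_pure_mul, ert]
    rw [eqN _ _ _ ((Nat.sub_le _ _).trans (hs j))]; simp
  case natRand i j =>
    simp only [step, tsum_map_mul, ert]
    -- The uniform distribution on `Fin` enters `step` through a monadic coercion to a distribution
    -- on `ℕ`; expectations under it are plain averages.
    have hb : ∀ g : ℕ → ℝ≥0∞, ∑' a, (do
        let a ← PMF.uniformOfFintype (Fin (s.N j + 1))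
        pure (a : ℕ) : PMF ℕ) a * g a
        = ((s.N j + 1 : ℕ) : ℝ≥0∞)⁻¹ * ∑ v ∈ Finset.range (s.N j + 1), g v := by
      intro g
      rw [← tsum_uniform_mul]
      refine (tsum_bind_mul _ _ g).trans (tsum_congr fun v => ?_)
      exact congrArg _ (tsum_pure_mul _ g)
    rw [hb (fun v => confPot E B τ f (w, s.setN i v)),
      Finset.sum_congr rfl fun v hv => eqN w i v
        ((Nat.lt_succ_iff.1 (Finset.mem_range.1 hv)).trans (hs j))]
    simp
  case cond t a b =>
    simp only [step, tsum_pure_mul, ert]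
    split_ifs <;> simp_all [ertStack]
  case loop t a =>
    refine le_trans ?_ (ert_loop_unfold t a _ s)
    simp only [step, tsum_pure_mul]
    split_ifs <;> simp_all [ertStack]
  all_goals simp [step, ert, eq0, eqN, eqR, hs, ertStack]

open Classical in
theorem tsum_ite_mul (p : PMF Config) (S : Set Config) (τ : ℝ≥0∞) :
    ∑' κ, p κ * (if κ ∈ S then τ else 0) = τ * p.toOuterMeasure S := by
  rw [PMF.toOuterMeasure_apply, ← ENNReal.tsum_mul_left]
  refine tsum_congr fun κ => ?_
  by_cases h : κ ∈ S <;> simp [h, mul_comm]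

open Classical in
-- Telescoping of the one-step decrease. Expected time, memory bounds, correctness and failure
-- probabilities are all read off from this inequality.
theorem run_confPot_le (f : State → ℝ≥0∞) (P : Cmd) (s : State) (k : ℕ) :
    τ * ∑ i ∈ Finset.range k, (run E P s i).toOuterMeasure {κ | κ.1 ≠ []}
      + ∑' κ, run E P s k κ * confPot E B τ f κ ≤ confPot E B τ f ([P], s) := by
  induction k with
  | zero => simp [run]
  | succ k ih =>
    refine le_trans ?_ ih
    rw [Finset.sum_range_succ, mul_add, add_assoc]
    gcongr
    rw [run, tsum_bind_mul, ← tsum_ite_mul, ← ENNReal.tsum_add]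
    refine ENNReal.tsum_le_tsum fun κ => ?_
    rw [← mul_add]
    gcongr
    refine le_trans (le_of_eq ?_) (step_confPot_le f κ)
    congr 1
    by_cases h : κ.1 = [] <;> simp [h]

theorem confPot_initial {f : State → ℝ≥0∞} {P : Cmd} {s : State} (hs : ∀ i, s.N i ≤ B) :
    confPot E B τ f ([P], s) = ert E B τ P f s := by
  rw [confPot, if_pos hs]
  rfl

theorem expectedTime_le {P : Cmd} {s : State} (hs : ∀ i, s.N i ≤ B) (f : State → ℝ≥0∞) :
    expectedTime E P s ≤ ert E B 1 P f s := by
  refine ENNReal.tsum_le_of_sum_range_le fun k => ?_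
  rw [← confPot_initial hs]
  refine le_trans ?_ (run_confPot_le f P s k)
  rw [one_mul]
  exact le_self_add

/-- A finite expectation in `ℝ≥0∞` rules out the value `∞` at every outcome of positive probability.
This is why violations can be encoded by `∞`. -/
theorem confPot_ne_top {f : State → ℝ≥0∞} {P : Cmd} {s : State} (hs : ∀ i, s.N i ≤ B)
    (h : ert E B τ P f s ≠ ⊤) {k : ℕ} {κ : Config} (hκ : κ ∈ (run E P s k).support) :
    confPot E B τ f κ ≠ ⊤ := by
  intro htop
  have h1 := run_confPot_le (E := E) (B := B) (τ := τ) f P s k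
  rw [confPot_initial hs] at h1
  refine h (top_le_iff.1 (le_trans ?_ h1))
  refine le_trans ?_ (le_add_left (ENNReal.le_tsum κ))
  rw [htop, ENNReal.mul_top ((PMF.mem_support_iff _ _).1 hκ)]

theorem memoryBounded_of_ert {f : State → ℝ≥0∞} {P : Cmd} {s : State} (hs : ∀ i, s.N i ≤ B)
    (h : ert E B τ P f s ≠ ⊤) {b : ℝ} (hb : (B : ℝ) ≤ b) : MemoryBounded E P s b := by
  intro k κ hκ i
  have h1 := confPot_ne_top hs h hκ
  by_contra hlt
  refine h1 ?_
  rw [confPot, if_neg]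
  intro hall
  exact hlt (le_trans (by exact_mod_cast hall i) hb)

open Classical in
/-- The postexpectation `0` on the states with `post`, and `∞` on the others. -/
noncomputable def guarantee (post : State → Prop) (s : State) : ℝ≥0∞ := if post s then 0 else ⊤

theorem guarantee_le {post : State → Prop} {s : State} (h : post s) (x : ℝ≥0∞) :
    guarantee post s ≤ x := by
  rw [guarantee, if_pos h]
  exact zero_le

theorem haltsOnlyWith_of_ert {P : Cmd} {s : State} (hs : ∀ i, s.N i ≤ B) {post : State → Prop}
    (h : ert E B τ P (guarantee post) s ≠ ⊤) : HaltsOnlyWith E P s post := by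
  rintro k ⟨w, s'⟩ hκ hw
  have h1 := confPot_ne_top hs h hκ
  simp only at hw
  subst hw
  by_contra hpost
  refine h1 ?_
  rw [confPot]
  split_ifs
  · simp only [ertStack]; rw [guarantee, if_neg hpost]
  · rfl

open Classical in
-- Markov's inequality with cost weight `0`: since `f ≥ 1` on bad states, its expectation dominates
-- the probability of halting in one.
theorem failsWithProbLE_of_ert {P : Cmd} {s : State} (hs : ∀ i, s.N i ≤ B) {good : State → Prop}
    {f : State → ℝ≥0∞} (hf : ∀ s, ¬ good s → 1 ≤ f s) {ε : ℝ}
    (h : ert E B 0 P f s ≤ ENNReal.ofReal ε) : FailsWithProbLE E P s good ε := by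
  intro k
  refine le_trans ?_ h
  rw [← confPot_initial hs]
  refine le_trans ?_ (run_confPot_le f P s k)
  rw [zero_mul, zero_add, ← one_mul (PMF.toOuterMeasure _ _), ← tsum_ite_mul]
  refine ENNReal.tsum_le_tsum fun κ => ?_
  gcongr
  split_ifs with hκ
  · obtain ⟨w, s'⟩ := κ
    obtain ⟨hw, hg⟩ := hκ
    simp only at hw hg
    subst hw
    rw [confPot]
    split_ifs
    · exact hf _ hg
    · exact le_top
  · exact zero_le

/-! ### Surely terminating programs -/

/-- Every run of the program ends, after `k` steps and in a state `s'` with `Q k s'`. -/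
def wp (E : ℕ → ℕ → ℝ) (B : ℕ) : Cmd → (ℕ → State → Prop) → State → Prop
  | .skip, Q, s => Q 1 s
  | .natConst i k, Q, s => k ≤ B ∧ Q 1 (s.setN i k)
  | .natAdd i j k, Q, s => s.N j + s.N k ≤ B ∧ Q 1 (s.setN i (s.N j + s.N k))
  | .natSub i j k, Q, s => Q 1 (s.setN i (s.N j - s.N k))
  | .natLoad i j, Q, s => Q 1 (s.setN i (s.N (s.N j)))
  | .natStore i j, Q, s => Q 1 (s.setN (s.N i) (s.N j))
  | .natRand i j, Q, s => ∀ v ≤ s.N j, Q 1 (s.setN i v)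
  | .realOfNat i j, Q, s => Q 1 (s.setR i (s.N j))
  | .realAdd i j k, Q, s => Q 1 (s.setR i (s.R j + s.R k))
  | .realSub i j k, Q, s => Q 1 (s.setR i (s.R j - s.R k))
  | .realMul i j k, Q, s => Q 1 (s.setR i (s.R j * s.R k))
  | .realDiv i j k, Q, s => Q 1 (s.setR i (s.R j / s.R k))
  | .realLoad i j, Q, s => Q 1 (s.setR i (s.R (s.N j)))
  | .realStore i j, Q, s => Q 1 (s.setR (s.N i) (s.R j))
  | .distance i j k, Q, s => Q 1 (s.setR i (E (s.N j) (s.N k)))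
  | .seq a b, Q, s => wp E B a (fun k s' => wp E B b (fun k' s'' => Q (1 + k + k') s'') s') s
  | .cond t a b, Q, s =>
      (t.holds s → wp E B a (fun k s' => Q (1 + k) s') s) ∧
      (¬ t.holds s → wp E B b (fun k s' => Q (1 + k) s') s)
  -- Impredicative form of the least relation closed under the two rules, so that termination is
  -- built in. The index of `I` counts the steps made since the loop was entered.
  | .loop t a, Q, s => ∀ I : ℕ → State → Prop,
      (∀ k s, ¬ t.holds s → Q (k + 1) s → I k s) →
      (∀ k s, t.holds s → wp E B a (fun k' s' => I (k + 1 + k') s') s → I k s) → I 0 s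

theorem wp_mono (P : Cmd) {Q Q' : ℕ → State → Prop} (h : ∀ k s, Q k s → Q' k s) (s : State)
    (hw : wp E B P Q s) : wp E B P Q' s := by
  induction P generalizing Q Q' s with
  | seq a b iha ihb => exact iha (fun k s' => ihb (fun k' s'' => h _ _) s') s hw
  | cond t a b iha ihb =>
    exact ⟨fun ht => iha (fun k s' => h _ _) s (hw.1 ht),
      fun ht => ihb (fun k s' => h _ _) s (hw.2 ht)⟩
  | loop t a iha => exact fun I h1 h2 => hw I (fun k s ht hq => h1 k s ht (h _ _ hq)) h2
  | natConst i k => exact ⟨hw.1, h _ _ hw.2⟩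
  | natAdd i j k => exact ⟨hw.1, h _ _ hw.2⟩
  | natRand i j => exact fun v hv => h _ _ (hw v hv)
  | _ => exact h _ _ hw

theorem avg_le {n : ℕ} {g : ℕ → ℝ≥0∞} {F : ℝ≥0∞} (h : ∀ v ≤ n, g v ≤ F) :
    ((n + 1 : ℕ) : ℝ≥0∞)⁻¹ * ∑ v ∈ Finset.range (n + 1), g v ≤ F := by
  have h1 : ∑ v ∈ Finset.range (n + 1), g v ≤ ((n + 1 : ℕ) : ℝ≥0∞) * F := by
    refine (Finset.sum_le_card_nsmul _ _ F fun v hv => ?_).trans_eq (by simp)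
    exact h v (Nat.lt_succ_iff.1 (Finset.mem_range.1 hv))
  calc _ ≤ ((n + 1 : ℕ) : ℝ≥0∞)⁻¹ * (((n + 1 : ℕ) : ℝ≥0∞) * F) := by gcongr
    _ = F := by
      rw [← mul_assoc, ENNReal.inv_mul_cancel (by simp) (ENNReal.natCast_ne_top _), one_mul]

open Classical in
-- Induction on the program. The slack `x` carries the cost of the surrounding commands through the
-- induction; it is part of the statement because costs in `ℝ≥0∞` cannot be freely subtracted.
theorem ert_add_le_of_wp (P : Cmd) {Q : ℕ → State → Prop} {f : State → ℝ≥0∞} {F x : ℝ≥0∞}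
    (s : State) (hw : wp E B P Q s) (h : ∀ k s', Q k s' → τ * k + f s' + x ≤ F) :
    ert E B τ P f s + x ≤ F := by
  induction P generalizing Q f F x s with
  | seq a b iha ihb =>
    rw [ert, add_right_comm, add_comm _ (ert E B τ a _ s)]
    refine iha s hw fun k s' hw' => ?_
    rw [add_right_comm, add_comm]
    refine ihb s' hw' fun k' s'' hq => ?_
    refine le_trans (le_of_eq ?_) (h _ _ hq)
    push_cast; ring
  | cond t a b iha ihb =>
    rw [ert, add_right_comm]
    have aux : ∀ k s', Q (1 + k) s' → τ * k + f s' + (τ + x) ≤ F := fun k s' hq => by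
      refine le_trans (le_of_eq ?_) (h _ _ hq)
      push_cast; ring
    split_ifs with ht
    · rw [add_comm]; exact iha s (hw.1 ht) aux
    · rw [add_comm]; exact ihb s (hw.2 ht) aux
  | loop t a iha =>
    -- The relation plugged in for `I` says: after `k` steps in this loop, the remaining cost and
    -- any slack `y` fit into `F`, provided that they do at every admissible end.
    have key := hw (fun k s => ∀ y, (∀ k' s', Q (k + k') s' → τ * k' + f s' + y ≤ F) →
      ert E B τ (.loop t a) f s + y ≤ F) ?_ ?_
    · exact key x fun k' s' hq => h _ _ (by simpa using hq)
    · intro k s ht hq y hy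
      refine le_trans ?_ (by simpa using hy 1 s hq)
      gcongr
      rw [ert]
      -- When the test fails, the body is irrelevant, and the crude pre-fixed point that is infinite
      -- wherever the loop is entered gives the exact value.
      refine iInf₂_le_of_le (fun s' => if t.holds s' then ⊤ else τ + f s') (fun s' => ?_) ?_
      · by_cases h' : t.holds s' <;> simp [h']
      · simp [ht]
    · intro k s ht hwa y hy
      -- The other half of the fixed-point equation: unrolling once does not lower the value either.
      have h1 : ert E B τ (.loop t a) f s
          ≤ τ + ert E B τ a (ert E B τ (.loop t a) f) s := by
        conv_lhs => rw [ert]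
        refine iInf₂_le_of_le (fun s' => τ + if t.holds s' then
          ert E B τ a (ert E B τ (.loop t a) f) s' else f s') (fun s' => ?_) ?_
        · by_cases h' : t.holds s'
          · simp only [h', if_true]
            exact add_le_add_right (ert_mono _ (fun s'' => ert_loop_unfold t a f s'') _) _
          · simp [h']
        · simp [ht]
      refine le_trans (add_le_add_left h1 y) ?_
      rw [add_right_comm, add_comm]
      refine iha s hwa fun k' s' hI => ?_
      rw [add_right_comm, add_comm]
      refine hI _ fun k'' s'' hq => ?_
      refine le_trans (le_of_eq ?_) (hy (1 + k' + k'') s'' (by convert hq using 1; ring))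
      push_cast; ring
  | natConst i k =>
    rw [ert, if_pos hw.1]; simpa using h _ _ hw.2
  | natAdd i j k =>
    rw [ert, if_pos hw.1]; simpa using h _ _ hw.2
  | natRand i j =>
    -- Infinite values are split off first, so that `F - (τ + x)` can be used as a bound for each
    -- summand of the average.
    by_cases hx : x = ⊤
    · have := h _ _ (hw 0 (Nat.zero_le _)); simp [hx] at this ⊢; exact this
    by_cases hτ : τ = ⊤
    · have := h _ _ (hw 0 (Nat.zero_le _)); simp [hτ] at this
      subst this; exact le_top
    have hle : τ + x ≤ F := by
      refine le_trans ?_ (h _ _ (hw 0 (Nat.zero_le _)))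
      simp only [Nat.cast_one, mul_one]; gcongr; exact le_self_add
    have := avg_le (n := s.N j) (g := fun v => f (s.setN i v)) (F := F - (τ + x)) fun v hv => by
      refine ENNReal.le_sub_of_add_le_right (by simp [hx, hτ]) ?_
      refine le_trans (le_of_eq ?_) (h _ _ (hw v hv))
      push_cast; ring
    rw [ert, add_right_comm]
    calc _ ≤ τ + x + (F - (τ + x)) := by gcongr
      _ = F := add_tsub_cancel_of_le hle
  | _ => simpa [ert] using h _ _ hw

theorem ert_le_of_wp {P : Cmd} {Q : ℕ → State → Prop} {f : State → ℝ≥0∞} {F : ℝ≥0∞}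
    {s : State} (hw : wp E B P Q s) (h : ∀ k s', Q k s' → τ * k + f s' ≤ F) :
    ert E B τ P f s ≤ F := by
  simpa using ert_add_le_of_wp (x := 0) P s hw (by simpa using h)

/-- Loops with a counter `i = 0, …, n`. -/
theorem wp_loop {t : Test} {a : Cmd} {Q : ℕ → State → Prop} (Inv : ℕ → State → Prop) (n c : ℕ)
    {s : State} (hinit : Inv 0 s)
    (hstep : ∀ i < n, ∀ s, Inv i s → t.holds s ∧ wp E B a (fun k s' => k ≤ c ∧ Inv (i + 1) s') s)
    (hend : ∀ s, Inv n s → ¬ t.holds s ∧ ∀ k ≤ n * (c + 1) + 1, Q k s) :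
    wp E B (.loop t a) Q s := by
  intro I h1 h2
  -- Backward induction: `j` is the number of iterations that are left. Each costs at most `c` for
  -- the body and one step for the test.
  have key : ∀ j ≤ n, ∀ k s, Inv (n - j) s → k ≤ (n - j) * (c + 1) → I k s := by
    intro j
    induction j with
    | zero =>
      intro _ k s hs hk
      exact h1 k s (hend s hs).1 ((hend s hs).2 _ (by simpa using hk))
    | succ j ih =>
      intro hj k s hs hk
      obtain ⟨ht, hw⟩ := hstep (n - (j + 1)) (by omega) s hs
      refine h2 k s ht (wp_mono _ (fun k' s' hk' => ?_) s hw)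
      have e : n - (j + 1) + 1 = n - j := by omega
      refine ih (by omega) _ _ (by rw [← e]; exact hk'.2) ?_
      rw [← e, Nat.add_mul]
      have := hk'.1
      omega
  exact key n le_rfl 0 s (by simpa using hinit) (Nat.zero_le _)

end RealRAM

namespace RealRAM

/-! ### Straight-line code and arrays

Integer cells below `64` are registers. The cells `8 k + 64, …, 8 k + 67` hold the node `k` of a
tree, the cells `8 k + 68` a stack, and the cells `8 k + 69` an array. -/

@[simp] theorem setN_N (s : State) (i v j : ℕ) :
    (s.setN i v).N j = if j = i then v else s.N j := by
  simp [State.setN, Function.update_apply]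

@[simp] theorem setN_R (s : State) (i v : ℕ) : (s.setN i v).R = s.R := rfl

@[simp] theorem setR_N (s : State) (i : ℕ) (v : ℝ) : (s.setR i v).N = s.N := rfl

@[simp] theorem setR_R (s : State) (i : ℕ) (v : ℝ) (j : ℕ) :
    (s.setR i v).R j = if j = i then v else s.R j := by
  simp [State.setR, Function.update_apply]

/-- A sequence of commands. -/
def block : List Cmd → Cmd
  | [] => .skip
  | a :: w => .seq a (block w)

/-- Clearing and adding, since the machine has no move command; source and target must therefore
differ. -/
def copyN (i j : ℕ) : Cmd := .seq (.natConst i 0) (.natAdd i i j)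

def copyR (i j : ℕ) : Cmd := .seq (.realSub i i i) (.realAdd i i j)

def inc (i : ℕ) : Cmd := .seq (.natConst 60 1) (.natAdd i i 60)

/-- Computes the address of the cell with index `N[i]` of the array with offset `off`. -/
def addr (off i : ℕ) : Cmd :=
  -- Three doublings replace the multiplication by `8`.
  block [.natAdd 61 i i, .natAdd 61 61 61, .natAdd 61 61 61, .natConst 60 off, .natAdd 61 61 60]

def load (off x i : ℕ) : Cmd := .seq (addr off i) (.natLoad x 61)

def store (off i x : ℕ) : Cmd := .seq (addr off i) (.natStore 61 x)

/-- Executes `a` if the outcome of the test is `b`. -/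
def guarded (b : Bool) (t : Test) (a : Cmd) : Cmd :=
  .cond t (if b then a else .skip) (if b then .skip else a)

/-- Runs `act` for all elements `N[11]` of the array, with `R[10]` their distance from `N[5]`. -/
def each (act : Cmd) : Cmd :=
  .seq (.natConst 10 0) (.loop (.natLT 10 6)
    (block [load 69 11 10, .distance 10 5 11, act, inc 10]))

variable {E : ℕ → ℕ → ℝ} {B : ℕ}

theorem wp_seq {a b : Cmd} {Q : ℕ → State → Prop} {s : State} :
    wp E B (.seq a b) Q s
      = wp E B a (fun k s' => wp E B b (fun k' s'' => Q (1 + k + k') s'') s') s := rfl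

/-- Agreement outside of a set of registers. -/
def Agree (A A' : ℕ → Prop) (s s' : State) : Prop :=
  (∀ a, ¬ A a → s'.N a = s.N a) ∧ ∀ a, ¬ A' a → s'.R a = s.R a

theorem Agree.trans {A A' A₁ A₁' A₂ A₂' : ℕ → Prop} {s s' s'' : State} (h : Agree A A' s s')
    (h' : Agree A₁ A₁' s' s'') (h1 : ∀ a, A a → A₂ a) (h2 : ∀ a, A₁ a → A₂ a)
    (h3 : ∀ a, A' a → A₂' a) (h4 : ∀ a, A₁' a → A₂' a) : Agree A₂ A₂' s s'' :=
  ⟨fun a ha => (h'.1 a fun h => ha (h2 a h)).trans (h.1 a fun h => ha (h1 a h)),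
    fun a ha => (h'.2 a fun h => ha (h4 a h)).trans (h.2 a fun h => ha (h3 a h))⟩

theorem wp_addr {off i : ℕ} {Q : ℕ → State → Prop} {s : State} (hi : i < 60)
    (hB : 8 * s.N i + off ≤ B)
    (h : ∀ s', Agree (fun a => a = 60 ∨ a = 61) (fun _ => False) s s' →
      s'.N 61 = 8 * s.N i + off → Q 11 s') : wp E B (addr off i) Q s := by
  have h1 : i ≠ 60 := by omega
  have h2 : i ≠ 61 := by omega
  simp [addr, block, wp]
  refine ⟨by omega, by omega, by omega, by omega, by omega, h _ ⟨?_, fun _ _ => rfl⟩ ?_⟩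
  · intro a ha
    simp [not_or.1 ha]
  · simp; ring

theorem wp_load {off x i : ℕ} {Q : ℕ → State → Prop} {s : State} (hi : i < 60)
    (hB : 8 * s.N i + off ≤ B) (hoff : 64 ≤ off)
    (h : ∀ s', Agree (fun a => a = x ∨ a = 60 ∨ a = 61) (fun _ => False) s s' →
      s'.N x = s.N (8 * s.N i + off) → Q 13 s') : wp E B (load off x i) Q s := by
  rw [load, wp_seq]
  refine wp_addr hi hB fun s' hs h61 => h _ ⟨?_, hs.2⟩ ?_
  · intro a ha
    simp only [not_or] at ha
    simp [ha, hs.1 a (by simp [ha])]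
  · simp [h61]
    exact hs.1 _ (by omega)

theorem wp_store {off x i : ℕ} {Q : ℕ → State → Prop} {s : State} (hi : i < 60) (hx : x < 60)
    (hB : 8 * s.N i + off ≤ B)
    (h : ∀ s', Agree (fun a => a = 8 * s.N i + off ∨ a = 60 ∨ a = 61) (fun _ => False) s s' →
      s'.N (8 * s.N i + off) = s.N x → Q 13 s') : wp E B (store off i x) Q s := by
  rw [store, wp_seq]
  refine wp_addr hi hB fun s' hs h61 => h _ ⟨?_, hs.2⟩ ?_
  · intro a ha
    simp only [not_or] at ha
    simp [h61, ha, hs.1 a (by simp [ha])]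
  · simp [h61]
    exact hs.1 _ (by omega)

theorem wp_inc {i : ℕ} {Q : ℕ → State → Prop} {s : State} (hi : i < 60) (hB : s.N i + 1 ≤ B)
    (h : ∀ s', Agree (fun a => a = i ∨ a = 60) (fun _ => False) s s' → s'.N i = s.N i + 1 →
      Q 3 s') : wp E B (inc i) Q s := by
  have h1 : i ≠ 60 := by omega
  simp [inc, wp, h1]
  refine ⟨by omega, by omega, h _ ⟨fun a ha => ?_, fun _ _ => rfl⟩ (by simp)⟩
  simp [not_or.1 ha]

theorem wp_copyN {i j : ℕ} {Q : ℕ → State → Prop} {s : State} (hij : j ≠ i) (hB : s.N j ≤ B)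
    (h : ∀ s', Agree (fun a => a = i) (fun _ => False) s s' → s'.N i = s.N j → Q 3 s') :
    wp E B (copyN i j) Q s := by
  simp [copyN, wp, hij]
  refine ⟨by omega, h _ ⟨fun a ha => ?_, fun _ _ => rfl⟩ (by simp)⟩
  simp [ha]

theorem wp_copyR {i j : ℕ} {Q : ℕ → State → Prop} {s : State} (hij : j ≠ i)
    (h : ∀ s', Agree (fun _ => False) (fun a => a = i) s s' → s'.R i = s.R j → Q 3 s') :
    wp E B (copyR i j) Q s := by
  simp [copyR, wp, hij]
  refine h _ ⟨fun _ _ => rfl, fun a ha => ?_⟩ (by simp)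
  simp [ha]

/-- The tests of the machine are strict comparisons. With `b = false` the action runs when the test
fails, which expresses `≤`. -/
theorem wp_guarded {b : Bool} {t : Test} {a : Cmd} {Q : ℕ → State → Prop} {s : State} {p : Bool}
    (hp : t.holds s ↔ p = b) (h1 : p = true → wp E B a (fun k s' => Q (1 + k) s') s)
    (h2 : p = false → Q 2 s) : wp E B (guarded b t a) Q s := by
  rw [guarded, wp, hp]
  cases b <;> cases p <;> simp_all [wp]

variable {n : ℕ}

/-- The array with offset `off` holds the list `l` from index `base` on. -/
def Arr (off base : ℕ) (l : List (Fin n)) (s : State) : Prop :=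
  ∀ i (h : i < l.length), s.N (8 * (base + i) + off) = (l[i] : ℕ)

/-- The registers that are used by `each`. -/
def EachReg (a : ℕ) : Prop := a = 10 ∨ a = 11 ∨ a = 60 ∨ a = 61

theorem oracle_apply (δ : Fin n → Fin n → ℝ) (i j : Fin n) : oracle δ i j = δ i j := by
  simp [oracle]

/-- `Inv i` describes the state before element `i`. By `hins` it ignores the registers of the
traversal itself, so only `act` has to be examined. -/
theorem wp_each {δ : Fin n → Fin n → ℝ} {act : Cmd} {Q : ℕ → State → Prop} {s : State}
    (l : List (Fin n)) (m : Fin n) (c : ℕ) (Inv : ℕ → State → Prop)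
    (hB : 8 * l.length + 69 ≤ B)
    (hInv : ∀ i s, Inv i s → s.N 6 = l.length ∧ s.N 5 = m ∧
      ∀ h : i < l.length, s.N (8 * i + 69) = (l[i] : ℕ))
    (hins : ∀ i s s', Inv i s → Agree EachReg (fun a => a = 10) s s' → Inv i s')
    (hact : ∀ i (h : i < l.length) s, Inv i s → s.N 10 = i → s.N 11 = (l[i] : ℕ) →
      s.R 10 = δ m l[i] →
      wp (oracle δ) B act (fun k s' => k ≤ c ∧ s'.N 10 = i ∧ Inv (i + 1) s') s)
    (hinit : Inv 0 s) (hend : ∀ s', Inv l.length s' → ∀ k ≤ (c + 30) * (l.length + 1), Q k s') :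
    wp (oracle δ) B (each act) Q s := by
  rw [each, wp_seq]
  refine ⟨Nat.zero_le _, ?_⟩
  refine wp_loop (fun i s => Inv i s ∧ s.N 10 = i) l.length (c + 29) ?_ ?_ ?_
  · refine ⟨hins _ _ _ hinit ⟨fun a ha => ?_, fun _ _ => rfl⟩, by simp⟩
    simp only [EachReg, not_or] at ha
    simp [ha]
  · rintro i hi s ⟨hs, h10⟩
    obtain ⟨h6, h5, hl⟩ := hInv i s hs
    refine ⟨by simp [Test.holds, h10, h6, hi], ?_⟩
    rw [block, wp_seq]
    refine wp_load (by norm_num) (by omega) (by norm_num) fun s1 hs1 h11 => ?_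
    rw [block, wp_seq, wp, block, wp_seq]
    rw [h10, hl hi] at h11
    have e5 : s1.N 5 = m := by rw [hs1.1 5 (by norm_num), h5]
    have e10 : s1.N 10 = i := by rw [hs1.1 10 (by norm_num), h10]
    refine wp_mono _ ?_ _ (hact i hi _ (hins i s _ hs ⟨?_, ?_⟩) (by simpa using e10)
      (by simpa using h11) (by simp [e5, h11, oracle_apply]))
    · rintro k s2 ⟨hk, h10', hs2⟩
      rw [block, wp_seq]
      refine wp_inc (by norm_num) (by omega) fun s3 hs3 h10'' => ?_
      simp only [block, wp]
      refine ⟨by omega, hins _ _ _ hs2 ⟨fun a ha => hs3.1 a ?_, fun a ha => hs3.2 a not_false⟩,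
        by omega⟩
      simp only [EachReg] at ha; tauto
    · intro a ha
      simp only [EachReg, not_or] at ha
      simp only [setR_N]
      exact hs1.1 a (by tauto)
    · intro a ha
      simp [ha]
      exact hs1.2 a not_false
  · rintro s ⟨hs, h10⟩
    obtain ⟨h6, -, -⟩ := hInv _ s hs
    refine ⟨by simp [Test.holds, h10, h6], fun k hk => hend s hs _ ?_⟩
    have : (c + 30) * (l.length + 1) = l.length * (c + 29 + 1) + (c + 30) := by ring
    omega

/-- Counts the elements of the array that are selected by the test. -/
def count (b : Bool) (t : Test) : Cmd := .seq (.natConst 12 0) (each (guarded b t (inc 12)))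

theorem countP_take_succ {α : Type*} (p : α → Bool) (l : List α) (i : ℕ) (h : i < l.length) :
    (l.take (i + 1)).countP p = (l.take i).countP p + if p l[i] then 1 else 0 := by
  rw [List.take_succ_eq_append_getElem h, List.countP_append]
  simp [List.countP_cons]

theorem wp_count {δ : Fin n → Fin n → ℝ} {b : Bool} {t : Test} {Q : ℕ → State → Prop} {s : State}
    (l : List (Fin n)) (m : Fin n) (v : ℝ) (sel : Fin n → Bool)
    (ht : ∀ (y : Fin n) (s' : State), s'.R 5 = v → s'.R 10 = δ m y → (t.holds s' ↔ sel y = b))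
    (hB : 8 * l.length + 69 ≤ B) (h5 : s.N 5 = m) (h6 : s.N 6 = l.length) (hl : Arr 69 0 l s)
    (hv : s.R 5 = v)
    (h : ∀ s', Agree (fun a => a = 12 ∨ EachReg a) (fun a => a = 10) s s' →
      s'.N 12 = l.countP sel → ∀ k ≤ 50 * (l.length + 1), Q k s') :
    wp (oracle δ) B (count b t) Q s := by
  rw [count, wp_seq]
  refine ⟨Nat.zero_le _, ?_⟩
  refine wp_each l m 10 (fun i s' => s'.N 12 = (l.take i).countP sel ∧
    Agree (fun a => a = 12 ∨ EachReg a) (fun a => a = 10) s s') hB ?_ ?_ ?_ ?_ ?_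
  · rintro i s' ⟨-, hs'⟩
    refine ⟨by rw [hs'.1 6 (by norm_num [EachReg]), h6],
      by rw [hs'.1 5 (by norm_num [EachReg]), h5], fun hi => ?_⟩
    rw [hs'.1 _ (by simp only [EachReg]; omega), ← hl i hi, zero_add]
  · rintro i s1 s2 ⟨h1, h2⟩ h3
    refine ⟨by rw [h3.1 12 (by norm_num [EachReg]), h1],
      h2.trans h3 (fun _ => id) (fun _ => Or.inr) (fun _ => id) (fun _ => id)⟩
  · rintro i hi s1 ⟨h1, h2⟩ h10 h11 hR
    have hle : (l.take i).countP sel ≤ l.length :=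
      List.countP_le_length.trans (by simp)
    refine wp_guarded (ht l[i] s1 (by rw [h2.2 5 (by norm_num), hv]) hR) (fun hsel => ?_)
      (fun hsel => ?_)
    · refine wp_inc (by norm_num) (by omega) fun s2 hs2 h12 => ⟨by norm_num, ?_, ?_, ?_⟩
      · rw [hs2.1 10 (by norm_num), h10]
      · rw [countP_take_succ _ _ _ hi, h12, h1]; simp [hsel]
      · exact h2.trans hs2 (fun _ => id) (by simp only [EachReg]; tauto) (fun _ => id)
          (fun _ h => h.elim)
    · refine ⟨by norm_num, h10, ?_, h2⟩
      rw [countP_take_succ _ _ _ hi, h1]; simp [hsel]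
  · refine ⟨by simp, fun a ha => ?_, fun _ _ => rfl⟩
    simp only [not_or] at ha
    simp [ha]
  · rintro s' ⟨h1, h2⟩ k hk
    refine h s' h2 (by simpa using h1) _ ?_
    omega

/-- Fills the array with `0, …, N[1] - 1`. -/
def fill : Cmd :=
  block [copyN 6 1, .natConst 10 0, .loop (.natLT 10 6) (.seq (store 69 10 10) (inc 10))]

theorem wp_fill {Q : ℕ → State → Prop} {s : State} (hB : 8 * n + 69 ≤ B) (h1 : s.N 1 = n)
    (h : ∀ s', Arr 69 0 (List.finRange n) s' → s'.N 6 = n →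
      (∀ a, (∀ j, a ≠ 8 * j + 69) → a ≠ 6 → a ≠ 10 → a ≠ 60 → a ≠ 61 → s'.N a = s.N a) →
      (∀ a, s'.R a = s.R a) → ∀ k ≤ 30 * (n + 1), Q k s') :
    wp E B fill Q s := by
  rw [fill, block, wp_seq]
  refine wp_copyN (by norm_num) (by omega) fun s1 hs1 h6 => ?_
  rw [block, wp_seq]
  refine ⟨Nat.zero_le _, ?_⟩
  simp only [block]
  rw [wp_seq]
  refine wp_loop (fun i s' => s'.N 10 = i ∧ s'.N 6 = n ∧ (∀ j < i, s'.N (8 * j + 69) = j) ∧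
    (∀ a, (∀ j, a ≠ 8 * j + 69) → a ≠ 6 → a ≠ 10 → a ≠ 60 → a ≠ 61 → s'.N a = s.N a) ∧
    ∀ a, s'.R a = s.R a) n 17 ?_ ?_ ?_
  · refine ⟨by simp, by simp [h6, h1], by simp, fun a ha h6 h10 h60 h61 => ?_,
      fun a => hs1.2 a not_false⟩
    simp [h10, hs1.1 a h6]
  · rintro i hi s2 ⟨h10, h6, hj, hN, hR⟩
    refine ⟨by simp [Test.holds, h10, h6, hi], ?_⟩
    rw [wp_seq]
    refine wp_store (by norm_num) (by norm_num) (by omega) fun s3 hs3 hst => ?_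
    have e10 : s3.N 10 = i := by rw [hs3.1 10 (by omega), h10]
    rw [h10] at hs3 hst
    refine wp_inc (by norm_num) (by omega) fun s4 hs4 h10' => ⟨by norm_num, by omega, ?_, ?_, ?_, ?_⟩
    · rw [hs4.1 6 (by norm_num), hs3.1 6 (by omega), h6]
    · intro j hji
      rw [hs4.1 _ (by omega)]
      rcases Nat.lt_succ_iff_lt_or_eq.1 hji with h | rfl
      · rw [hs3.1 _ (by omega), hj j h]
      · exact hst
    · intro a ha h6 h10 h60 h61
      have := ha i
      rw [hs4.1 a (by tauto), hs3.1 a (by tauto), hN a ha h6 h10 h60 h61]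
    · intro a
      rw [hs4.2 a not_false, hs3.2 a not_false, hR]
  · rintro s2 ⟨h10, h6, hj, hN, hR⟩
    refine ⟨by simp [Test.holds, h10, h6], fun k hk => ?_⟩
    simp only [wp]
    refine h s2 (fun i hi => ?_) h6 hN hR _ ?_
    · rw [zero_add, hj i (by simpa using hi)]; simp
    · omega

end RealRAM

namespace RealRAM

/-! ### Selection by random pivots -/

variable {B n : ℕ}

/-- Keeps the elements of the array for which the test holds. -/
def filterArr (t : Test) : Cmd :=
  block [.natConst 12 0, each (guarded true t (.seq (store 69 12 11) (inc 12))), copyN 6 12]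

theorem filter_take_succ {α : Type*} (p : α → Bool) (l : List α) (i : ℕ) (h : i < l.length) :
    (l.take (i + 1)).filter p = (l.take i).filter p ++ if p l[i] then [l[i]] else [] := by
  rw [List.take_succ_eq_append_getElem h, List.filter_append]
  by_cases hp : p l[i] <;> simp [hp]

/-- The array is filtered in place. The write position never overtakes the read position, so the
entries from index `i` on are still intact when element `i` is read; this is the third clause of the
invariant. -/
theorem wp_filterArr {δ : Fin n → Fin n → ℝ} {t : Test} {Q : ℕ → State → Prop} {s : State}
    (l : List (Fin n)) (m : Fin n) (v : ℝ) (sel : Fin n → Bool)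
    (ht : ∀ (y : Fin n) (s' : State), s'.R 5 = v → s'.R 10 = δ m y →
      (t.holds s' ↔ sel y = true))
    (hB : 8 * l.length + 69 ≤ B) (h5 : s.N 5 = m) (h6 : s.N 6 = l.length) (hl : Arr 69 0 l s)
    (hv : s.R 5 = v)
    (h : ∀ s', (∀ a < 64, a ≠ 6 → a ≠ 12 → ¬ EachReg a → s'.N a = s.N a) →
      (∀ a, a ≠ 10 → s'.R a = s.R a) → s'.N 6 = (l.filter sel).length →
      Arr 69 0 (l.filter sel) s' → ∀ k ≤ 60 * (l.length + 1), Q k s') :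
    wp (oracle δ) B (filterArr t) Q s := by
  rw [filterArr, block, wp_seq]
  refine ⟨Nat.zero_le _, ?_⟩
  simp only [block]
  rw [wp_seq]
  have hlen : ∀ i, ((l.take i).filter sel).length ≤ i := fun i =>
    (List.length_filter_le _ _).trans (by simp)
  have hlen' : ∀ i, ((l.take i).filter sel).length ≤ l.length := fun i =>
    (List.length_filter_le _ _).trans (by simp)
  refine wp_each l m 20 (fun i s' => s'.N 12 = ((l.take i).filter sel).length ∧
    Arr 69 0 ((l.take i).filter sel) s' ∧
    (∀ j, i ≤ j → ∀ h : j < l.length, s'.N (8 * j + 69) = (l[j] : ℕ)) ∧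
    (∀ a < 64, a ≠ 12 → ¬ EachReg a → s'.N a = s.N a) ∧
    ∀ a, a ≠ 10 → s'.R a = s.R a) hB ?_ ?_ ?_ ?_ ?_
  · rintro i s' ⟨-, -, h3, h4, -⟩
    exact ⟨by rw [h4 6 (by norm_num) (by norm_num) (by norm_num [EachReg]), h6],
      by rw [h4 5 (by norm_num) (by norm_num) (by norm_num [EachReg]), h5], h3 i le_rfl⟩
  · rintro i s1 s2 ⟨h1, h2, h3, h4, h5⟩ h
    refine ⟨by rw [h.1 12 (by norm_num [EachReg]), h1], fun j hj => ?_, fun j hj hj' => ?_,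
      fun a ha h12 hE => ?_, fun a ha => ?_⟩
    · rw [h.1 _ (by simp only [EachReg]; omega), h2 j hj]
    · rw [h.1 _ (by simp only [EachReg]; omega), h3 j hj hj']
    · rw [h.1 _ hE, h4 a ha h12 hE]
    · rw [h.2 _ ha, h5 a ha]
  · rintro i hi s1 ⟨h1, h2, h3, h4, h5'⟩ h10 h11 hR
    have hle := hlen i
    have hle' := hlen' i
    refine wp_guarded (ht l[i] s1 (by rw [h5' 5 (by norm_num), hv]) hR) (fun hsel => ?_)
      (fun hsel => ?_)
    · rw [wp_seq]
      have e : (l.take (i + 1)).filter sel = (l.take i).filter sel ++ [l[i]] := by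
        rw [filter_take_succ _ _ _ hi]; simp [hsel]
      refine wp_store (by norm_num) (by norm_num) (by omega) fun s2 hs2 hst => ?_
      rw [h1] at hs2 hst
      have e12 : s2.N 12 = ((l.take i).filter sel).length := by rw [hs2.1 12 (by omega), h1]
      refine wp_inc (by norm_num) (by omega) fun s3 hs3 h12 => ⟨by norm_num, ?_, ?_, ?_, ?_, ?_, ?_⟩
      · rw [hs3.1 10 (by norm_num), hs2.1 10 (by omega), h10]
      · rw [e, h12, e12]; simp
      · intro j hj
        rw [hs3.1 _ (by omega)]
        simp only [e] at hj ⊢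
        rw [List.length_append, List.length_singleton] at hj
        rw [zero_add]
        rcases Nat.lt_succ_iff_lt_or_eq.1 hj with hj | rfl
        · rw [List.getElem_append_left hj, hs2.1 _ (by omega), ← h2 j hj, zero_add]
        · simp [hst, h11]
      · intro j hj hj'
        rw [hs3.1 _ (by omega), hs2.1 _ (by omega), h3 j (by omega) hj']
      · intro a ha h12 hE
        have hE' := hE
        simp only [EachReg, not_or] at hE'
        rw [hs3.1 _ (by omega), hs2.1 _ (by omega), h4 a ha h12 hE]
      · intro a ha
        rw [hs3.2 _ not_false, hs2.2 _ not_false, h5' a ha]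
    · have e : (l.take (i + 1)).filter sel = (l.take i).filter sel := by
        rw [filter_take_succ _ _ _ hi]; simp [hsel]
      refine ⟨by norm_num, h10, by rw [e, h1], by rw [e]; exact h2,
        fun j hj => h3 j (by omega), h4, h5'⟩
  · refine ⟨by simp, fun j hj => by simp at hj, fun j _ hj => ?_, fun a ha h12 hE => ?_,
      fun _ _ => rfl⟩
    · simp; rw [← hl j hj, zero_add]
    · simp [h12]
  · rintro s' ⟨h1, h2, h3, h4, h5'⟩ k hk
    rw [List.take_length] at h1 h2
    have hle : (l.filter sel).length ≤ l.length := List.length_filter_le _ _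
    rw [wp_seq]
    refine wp_copyN (by norm_num) (by omega) fun s2 hs2 h6' => ?_
    simp only [wp]
    refine h s2 (fun a ha ha6 ha12 hE => ?_) (fun a ha => ?_) (by rw [h6', h1]) (fun j hj => ?_) _ ?_
    · rw [hs2.1 a ha6, h4 a ha ha12 hE]
    · rw [hs2.2 a not_false, h5' a ha]
    · rw [hs2.1 _ (by omega), h2 j hj]
    · omega

theorem avg_le_mul {N : ℕ} {g y : ℕ → ℝ≥0∞} {τ F Y : ℝ≥0∞} (h : ∀ v ≤ N, g v ≤ τ * y v + F)
    (hY : ((N + 1 : ℕ) : ℝ≥0∞)⁻¹ * ∑ v ∈ Finset.range (N + 1), y v ≤ Y) :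
    ((N + 1 : ℕ) : ℝ≥0∞)⁻¹ * ∑ v ∈ Finset.range (N + 1), g v ≤ τ * Y + F := by
  calc _ ≤ ((N + 1 : ℕ) : ℝ≥0∞)⁻¹ * ∑ v ∈ Finset.range (N + 1), (τ * y v + F) := by
        gcongr with v hv
        exact h v (Nat.lt_succ_iff.1 (Finset.mem_range.1 hv))
    _ = τ * (((N + 1 : ℕ) : ℝ≥0∞)⁻¹ * ∑ v ∈ Finset.range (N + 1), y v) + F := by
        rw [Finset.sum_add_distrib, mul_add, ← Finset.mul_sum, mul_left_comm]
        congr 1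
        rw [Finset.sum_const, Finset.card_range, nsmul_eq_mul, ← mul_assoc,
          ENNReal.inv_mul_cancel (by simp) (ENNReal.natCast_ne_top _), one_mul]
    _ ≤ _ := by gcongr

theorem avg_natCast_le {N Y : ℕ} {y : ℕ → ℕ}
    (h : ∑ v ∈ Finset.range (N + 1), y v ≤ (N + 1) * Y) :
    ((N + 1 : ℕ) : ℝ≥0∞)⁻¹ * ∑ v ∈ Finset.range (N + 1), (y v : ℝ≥0∞) ≤ Y := by
  rw [← Nat.cast_sum]
  calc _ ≤ ((N + 1 : ℕ) : ℝ≥0∞)⁻¹ * (((N + 1) * Y : ℕ) : ℝ≥0∞) := by gcongr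
    _ = Y := by
      rw [Nat.cast_mul, ← mul_assoc,
        ENNReal.inv_mul_cancel (by simp) (ENNReal.natCast_ne_top _), one_mul]

open Classical in
/-- The number of points in a closed ball. -/
noncomputable def closedCount (δ : Fin n → Fin n → ℝ) (m : Fin n) (r : ℝ) : ℕ :=
  (Finset.univ.filter fun q => δ m q ≤ r).card

open Classical in
/-- The points that remain after the pivot `x` has been examined. -/
noncomputable def pivotStep (δ : Fin n → Fin n → ℝ) (c : ℝ) (m : Fin n) (l : List (Fin n))
    (x : Fin n) : List (Fin n) :=
  if (closedCount δ m (δ m x) : ℝ) * c < n then l.filter fun q => δ m x < δ m q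
  else l.filter fun q => δ m q < δ m x

theorem sum_range_getD {α M : Type*} [AddCommMonoid M] (d : α) (l : List α) (g : α → M) :
    ∑ v ∈ Finset.range l.length, g (l.getD v d) = (l.map g).sum := by
  induction l with
  | nil => simp
  | cons a l ih =>
    rw [List.length_cons, Finset.sum_range_succ', List.map_cons, List.sum_cons, add_comm]
    simpa using congrArg (g a + ·) ih

theorem countP_eq_sum_map {α : Type*} (p : α → Bool) (l : List α) :
    l.countP p = (l.map fun q => if p q then 1 else 0).sum := by
  induction l with
  | nil => simp
  | cons a l ih => rw [List.countP_cons, ih, List.map_cons, List.sum_cons, add_comm]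

/-- In expectation, a random pivot leaves at most three quarters of the points. -/
theorem sum_pivotStep_le (δ : Fin n → Fin n → ℝ) (c : ℝ) (m : Fin n) (l : List (Fin n))
    (hl : l.Nodup) :
    4 * (l.map fun x => (pivotStep δ c m l x).length).sum ≤ 3 * l.length ^ 2 := by
  classical
  set S := l.toFinset with hS
  set ok : Fin n → Prop := fun x => (closedCount δ m (δ m x) : ℝ) * c < n with hok
  set X : Fin n → Fin n → ℕ := fun x q => if ok x then (if δ m x < δ m q then 1 else 0)
    else (if δ m q < δ m x then 1 else 0) with hX
  have h1 : (l.map fun x => (pivotStep δ c m l x).length).sum = ∑ x ∈ S, ∑ q ∈ S, X x q := by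
    rw [hS, List.sum_toFinset _ hl]
    congr 1
    refine List.map_congr_left fun x _ => ?_
    rw [List.sum_toFinset _ hl]
    simp only [pivotStep, hX, hok]
    split_ifs with h
    · rw [← List.countP_eq_length_filter, countP_eq_sum_map]
      simp
    · rw [← List.countP_eq_length_filter, countP_eq_sum_map]
      simp
  -- Symmetrization: if `ok` agrees on `x` and `q`, then both pivots compare strictly in the same
  -- direction, and at most one of the two points survives the other. Only pairs on which `ok`
  -- differs can contribute two.
  have h2 : ∑ x ∈ S, ∑ q ∈ S, X x q + ∑ x ∈ S, ∑ q ∈ S, X x q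
      ≤ ∑ x ∈ S, ∑ q ∈ S, (1 + if ok x ↔ ok q then 0 else 1) := by
    conv_lhs => enter [2]; rw [Finset.sum_comm]
    rw [← Finset.sum_add_distrib]
    refine Finset.sum_le_sum fun x _ => ?_
    rw [← Finset.sum_add_distrib]
    refine Finset.sum_le_sum fun q _ => ?_
    simp only [hX]
    by_cases h1 : ok x <;> by_cases h2 : ok q <;> simp [h1, h2] <;> split_ifs <;>
      first | omega | (exfalso; linarith)
  have h3 : ∑ x ∈ S, ∑ q ∈ S, (1 + if ok x ↔ ok q then 0 else 1)
      = S.card ^ 2 + 2 * ((S.filter ok).card * (S.filter fun x => ¬ ok x).card) := by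
    have e : ∀ x ∈ S, ∑ q ∈ S, (1 + if ok x ↔ ok q then 0 else 1) = S.card +
        ((if ok x then (S.filter fun x => ¬ ok x).card else 0) +
        if ¬ ok x then (S.filter ok).card else 0) := by
      intro x _
      rw [Finset.sum_add_distrib]
      by_cases h : ok x
      · simp only [h, true_iff, not_true_eq_false, if_true, if_false, add_zero]
        rw [Finset.card_filter, Finset.sum_const, smul_eq_mul, mul_one]
        simp only [ite_not]
      · simp only [h, false_iff, not_false_eq_true, if_true, if_false, zero_add]
        rw [Finset.card_filter, Finset.sum_const, smul_eq_mul, mul_one]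
        congr 1
        exact Finset.sum_congr rfl fun q _ => by by_cases hq : ok q <;> simp [hq] <;> simpa [hok] using hq
    rw [Finset.sum_congr rfl e, Finset.sum_add_distrib, Finset.sum_add_distrib,
      ← Finset.sum_filter, ← Finset.sum_filter]
    simp only [Finset.sum_const, smul_eq_mul]
    ring
  have h4 : (S.filter ok).card + (S.filter fun x => ¬ ok x).card = S.card :=
    Finset.card_filter_add_card_filter_not (s := S) (p := ok)
  have h5 : S.card = l.length := List.toFinset_card_of_nodup hl
  rw [h1, ← h5, ← h4]
  rw [h3, ← h4] at h2
  -- With `a` pivots that are `ok` and `b` that are not, twice the sum is at most `(a+b)² + 2ab`,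
  -- and `2ab ≤ (a+b)²/2`.
  nlinarith [sq_nonneg (((S.filter ok).card : ℤ) - (S.filter fun x => ¬ ok x).card),
    two_mul_le_add_sq (S.filter ok).card (S.filter fun x => ¬ ok x).card]

end RealRAM

/-! ### Selection of the smallest suitable radius for a centre: one pivot step -/

namespace RealRAM

variable {B n : ℕ}

/-- The ball with centre `N[3]` and radius `R[2]` contains at least `n / c` points. -/
def BallOK (δ : Fin n → Fin n → ℝ) (c : ℝ) (s : State) : Prop :=
  ∃ b : Fin n, s.N 3 = b ∧ (n : ℝ) ≤ closedCount δ b (s.R 2) * c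

/-- The invariant of the selection of the smallest suitable radius for the centre `m`; `l` lists the
points that may still be at that distance. -/
structure SelectCore (δ : Fin n → Fin n → ℝ) (c : ℝ) (m : Fin n) (r x : ℝ) (l : List (Fin n))
    (s : State) : Prop where
  n_eq : s.N 1 = n
  zero : s.N 15 = 0
  c_eq : s.R 1 = c
  rounds : s.R 3 = x
  n_real : s.R 4 = n
  center : s.N 5 = m
  nodup : l.Nodup
  low : ∃ Low : Finset (Fin n), s.N 4 = Low.card ∧ (∀ q ∈ l, ∀ p ∈ Low, δ m p < δ m q) ∧
    ∀ q ∈ l, ∀ p, p ∉ Low → p ∉ l → δ m q < δ m p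
  ok : BallOK δ c s
  best_le : s.R 2 ≤ r
  opt : ∀ q, (n : ℝ) ≤ closedCount δ m (δ m q) * c → s.R 2 ≤ δ m q ∨ q ∈ l

/-- `SelectCore`, and the list `l` is stored in the array. -/
def SelectInv (δ : Fin n → Fin n → ℝ) (c : ℝ) (m : Fin n) (r x : ℝ) (l : List (Fin n))
    (s : State) : Prop :=
  SelectCore δ c m r x l s ∧ s.N 6 = l.length ∧ Arr 69 0 l s

theorem SelectCore.congr {δ : Fin n → Fin n → ℝ} {c r x : ℝ} {m : Fin n} {l : List (Fin n)}
    {s s' : State} (h : SelectCore δ c m r x l s)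
    (hN : ∀ a, a = 1 ∨ a = 3 ∨ a = 4 ∨ a = 5 ∨ a = 15 → s'.N a = s.N a)
    (hR : ∀ a, a = 1 ∨ a = 2 ∨ a = 3 ∨ a = 4 → s'.R a = s.R a) : SelectCore δ c m r x l s' := by
  obtain ⟨h1, h2, h3, h4, h5, h6, h7, h8, h9, h10, h11⟩ := h
  refine ⟨?_, ?_, ?_, ?_, ?_, ?_, h7, ?_, ?_, ?_, ?_⟩
  · rw [hN 1 (by norm_num), h1]
  · rw [hN 15 (by norm_num), h2]
  · rw [hR 1 (by norm_num), h3]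
  · rw [hR 3 (by norm_num), h4]
  · rw [hR 4 (by norm_num), h5]
  · rw [hN 5 (by norm_num), h6]
  · rw [hN 4 (by norm_num)]; exact h8
  · rw [BallOK, hN 3 (by norm_num), hR 2 (by norm_num)]; exact h9
  · rw [hR 2 (by norm_num)]; exact h10
  · rw [hR 2 (by norm_num)]; exact h11

/-- Filtering only touches scratch registers and the array. The part of the invariant that does not
mention the array may thus be proved for the shorter list beforehand. -/
theorem wp_filterArr_select {δ : Fin n → Fin n → ℝ} {c r x : ℝ} {m : Fin n} {l : List (Fin n)}
    {s : State} {t : Test} {v : ℝ} {sel : Fin n → Bool}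
    (ht : ∀ (y : Fin n) (s' : State), s'.R 5 = v → s'.R 10 = δ m y →
      (t.holds s' ↔ sel y = true)) (hB : 8 * l.length + 69 ≤ B)
    (hs : SelectCore δ c m r x (l.filter sel) s) (h6 : s.N 6 = l.length) (hl : Arr 69 0 l s)
    (hv : s.R 5 = v) :
    wp (oracle δ) B (filterArr t) (fun k s' => k ≤ 60 * (l.length + 1) ∧
      SelectInv δ c m r x (l.filter sel) s') s := by
  refine wp_filterArr l m v sel ht hB hs.center h6 hl hv fun s' h1 h2 h3 h4 k hk => ⟨hk, ?_, h3, h4⟩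
  exact hs.congr (fun a ha => h1 a (by omega) (by omega) (by omega) (by unfold EachReg; omega))
    (fun a ha => h2 a (by omega))

/-- Examines the pivot with index `N[9]`. -/
def pivotTail : Cmd :=
  block [load 69 11 9, .distance 5 5 11, count false (.realLT 5 10), .natAdd 14 4 12,
    .realOfNat 6 14, .realMul 6 6 1,
    .cond (.realLT 6 4) (.seq (copyN 4 14) (filterArr (.realLT 5 10)))
      (.seq (.cond (.realLT 5 2) (.seq (copyR 2 5) (copyN 3 5)) .skip) (filterArr (.realLT 10 5)))]

/-- The discarded near points all count and the discarded far points do not. Knowing the number of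
the former, a scan of the remaining list determines the size of the whole ball. -/
theorem closedCount_eq {δ : Fin n → Fin n → ℝ} {m : Fin n} {l : List (Fin n)} {v : ℝ}
    {Low : Finset (Fin n)} (hl : l.Nodup) (h1 : ∀ p ∈ Low, δ m p < v)
    (h2 : ∀ p, p ∉ Low → p ∉ l → v < δ m p) (h3 : ∀ p ∈ l, p ∉ Low) :
    closedCount δ m v = Low.card + l.countP fun q => δ m q ≤ v := by
  classical
  rw [closedCount, List.countP_eq_length_filter,
    ← List.toFinset_card_of_nodup (hl.filter _), ← Finset.card_union_of_disjoint]
  · congr 1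
    ext q
    simp only [Finset.mem_filter, Finset.mem_univ, true_and, Finset.mem_union, List.mem_toFinset,
      List.mem_filter, decide_eq_true_eq]
    constructor
    · intro hq
      by_contra hcon
      push Not at hcon
      by_cases hql : q ∈ l
      · exact absurd hq (not_le.2 (hcon.2 hql))
      · exact absurd hq (not_le.2 (h2 q hcon.1 hql))
    · rintro (hq | hq)
      · exact (h1 q hq).le
      · exact hq.2
  · rw [Finset.disjoint_left]
    intro q hq hq'
    simp only [List.mem_toFinset, List.mem_filter] at hq'
    exact h3 q hq'.1 hq

theorem wp_pivotTail {δ : Fin n → Fin n → ℝ} {c r x : ℝ} {m : Fin n} {l : List (Fin n)}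
    {s : State} (hc : 0 < c) (hB : 8 * n + 100 ≤ B) (v : ℕ)
    (hv : v < l.length) (hs : SelectInv δ c m r x l s) (h9 : s.N 9 = v) :
    wp (oracle δ) B pivotTail (fun k s' => k ≤ 200 * (l.length + 1) ∧
      SelectInv δ c m r x (pivotStep δ c m l l[v]) s') s := by
  classical
  obtain ⟨hs, h6, harr⟩ := hs
  have hln : l.length ≤ n := by simpa using hs.nodup.length_le_card
  obtain ⟨Low, hL, hlow, hhigh⟩ := hs.low
  have hmem : l[v] ∈ l := List.getElem_mem hv
  have hcc : closedCount δ m (δ m l[v]) = Low.card + l.countP fun q => δ m q ≤ δ m l[v] :=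
    closedCount_eq hs.nodup (hlow _ hmem) (hhigh _ hmem)
      fun p hp hpL => lt_irrefl _ (hlow p hp p hpL)
  have hccn : closedCount δ m (δ m l[v]) ≤ n := by
    exact (Finset.card_filter_le _ _).trans_eq (by simp)
  have h5 := hs.center
  rw [pivotTail, block, wp_seq]
  refine wp_load (by norm_num) (by omega) (by norm_num) fun s1 hs1 h11 => ?_
  rw [h9, ← zero_add v, harr v hv] at h11
  simp only [block]
  rw [wp_seq, wp, wp_seq]
  have e5 : s1.N 5 = m := by rw [hs1.1 5 (by norm_num), h5]
  refine wp_count l m (δ m l[v]) (fun q => δ m q ≤ δ m l[v]) ?_ (by omega) (by simpa using e5) ?_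
    ?_ ?_ fun s2 hs2 h12 k hk => ?_
  · intro y s' hv' hw'
    simp [Test.holds, hv', hw']
  · simp [hs1.1 6, h6]
  · intro i hi
    simp only [setR_N]
    rw [hs1.1 _ (by omega), harr i hi]
  · simp [e5, h11, oracle_apply]
  have f : ∀ a, a ≠ 11 → a ≠ 60 → a ≠ 61 → a ≠ 12 → a ≠ 10 → s2.N a = s.N a := by
    intro a h11 h60 h61 h12 h10
    rw [hs2.1 a (by simp only [EachReg]; tauto), setR_N, hs1.1 a (by tauto)]
  have g : ∀ a, a ≠ 10 → a ≠ 5 → s2.R a = s.R a := by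
    intro a h10 h5
    rw [hs2.2 a h10, setR_R, if_neg h5, hs1.2 a not_false]
  have g5 : s2.R 5 = δ m l[v] := by
    rw [hs2.2 5 (by norm_num), setR_R]; simp [e5, h11, oracle_apply]
  have f4 : s2.N 4 = Low.card := by rw [f 4] <;> first | exact hL | norm_num
  rw [wp_seq]
  refine ⟨by omega, ?_⟩
  rw [f4, h12, ← hcc]
  beta_reduce
  rw [wp_seq, wp, wp_seq, wp, wp_seq]
  simp only [setN_N, setR_R, setN_R, if_true, OfNat.one_ne_ofNat, if_false]
  rw [g 1 (by norm_num) (by norm_num), hs.c_eq]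
  set s3 := ((s2.setN 14 (closedCount δ m (δ m l[v]))).setR 6
    (closedCount δ m (δ m l[v]))).setR 6 ((closedCount δ m (δ m l[v]) : ℝ) * c) with hs3
  have f3 : ∀ a, a ≠ 11 → a ≠ 60 → a ≠ 61 → a ≠ 12 → a ≠ 10 → a ≠ 14 → s3.N a = s.N a := by
    intro a _ _ _ _ _ h14
    simp only [hs3, setR_N, setN_N, if_neg h14]
    apply f <;> assumption
  have g3 : ∀ a, a ≠ 10 → a ≠ 5 → a ≠ 6 → s3.R a = s.R a := by
    intro a _ _ h6
    simp only [hs3, setR_R, setN_R, if_neg h6]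
    apply g <;> assumption
  have g35 : s3.R 5 = δ m l[v] := by simp [hs3, g5]
  have g36 : s3.R 6 = closedCount δ m (δ m l[v]) * c := by simp [hs3]
  have f314 : s3.N 14 = closedCount δ m (δ m l[v]) := by simp [hs3]
  clear_value s3
  have hcore : SelectCore δ c m r x l s3 := hs.congr (fun a ha => by apply f3 <;> omega)
    (fun a ha => by apply g3 <;> omega)
  have h36 : s3.N 6 = l.length := by rw [f3 6, h6] <;> norm_num
  have harr3 : Arr 69 0 l s3 := fun i hi => by rw [f3, harr i hi] <;> omega
  have hthr : (Test.realLT 6 4).holds s3 ↔ (closedCount δ m (δ m l[v]) : ℝ) * c < n := by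
    rw [Test.holds, g36, hcore.n_real]
  clear hs1 hs2 e5 h11 h12 f g f4 f3 g3 hs3 g36 g5
  -- Counts grow with the radius. If the pivot is too close, so is everything up to it, and
  -- discarding these points loses no suitable radius.
  have hcard : ∀ q, δ m q ≤ δ m l[v] →
      (closedCount δ m (δ m q) : ℝ) * c ≤ closedCount δ m (δ m l[v]) * c := by
    intro q hq
    have : closedCount δ m (δ m q) ≤ closedCount δ m (δ m l[v]) := by
      refine Finset.card_le_card fun p hp => ?_
      simp only [Finset.mem_filter, Finset.mem_univ, true_and] at hp ⊢
      linarith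
    gcongr
  refine ⟨fun ht => ?_, fun ht => ?_⟩
  · rw [hthr] at ht
    have e : pivotStep δ c m l l[v] = l.filter fun q => δ m l[v] < δ m q := by
      rw [pivotStep, if_pos ht]
    rw [e, wp_seq]
    refine wp_copyN (by norm_num) (by omega) fun s4 hs4 h4 => ?_
    refine wp_mono _ ?_ _ (wp_filterArr_select (v := δ m l[v]) ?_ (by omega) (r := r) (x := x)
      (c := c) (l := l) (δ := δ) (m := m) (sel := fun q => δ m l[v] < δ m q)
      ⟨?_, ?_, ?_, ?_, ?_, ?_, hs.nodup.filter _, ?_, ?_, ?_, ?_⟩ ?_ ?_ ?_)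
    · rintro k' s5 ⟨hk', hs5⟩
      refine ⟨?_, hs5⟩
      omega
    · intro y s' hv' hw'
      simp [Test.holds, hv', hw']
    · rw [hs4.1 1 (by norm_num), hcore.n_eq]
    · rw [hs4.1 15 (by norm_num), hcore.zero]
    · rw [hs4.2 1 not_false, hcore.c_eq]
    · rw [hs4.2 3 not_false, hcore.rounds]
    · rw [hs4.2 4 not_false, hcore.n_real]
    · rw [hs4.1 5 (by norm_num), hcore.center]
    · refine ⟨Finset.univ.filter fun q => δ m q ≤ δ m l[v], ?_, ?_, ?_⟩
      · rw [h4, f314]; rfl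
      · intro q hq p hp
        simp only [Finset.mem_filter, Finset.mem_univ, true_and, List.mem_filter,
          decide_eq_true_eq] at hq hp
        linarith
      · intro q hq p hp hp'
        simp only [Finset.mem_filter, Finset.mem_univ, true_and, List.mem_filter,
          decide_eq_true_eq, not_and] at hq hp hp'
        have hpl : p ∉ l := fun hpl => hp' hpl (by linarith)
        exact hhigh q hq.1 p (fun hpL => hp (hlow _ hmem p hpL).le) hpl
    · rw [BallOK, hs4.1 3 (by norm_num), hs4.2 2 not_false]; exact hcore.ok
    · rw [hs4.2 2 not_false]; exact hcore.best_le
    · intro q hq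
      rw [hs4.2 2 not_false]
      refine (hcore.opt q hq).imp id fun hql => ?_
      simp only [List.mem_filter, hql, true_and, decide_eq_true_eq]
      by_contra hlt
      linarith [hcard q (not_lt.1 hlt)]
    · rw [hs4.1 6 (by norm_num), h36]
    · intro i hi
      rw [hs4.1 _ (by omega), harr3 i hi]
    · rw [hs4.2 _ not_false, g35]
  · rw [hthr, not_lt] at ht
    have e : pivotStep δ c m l l[v] = l.filter fun q => δ m q < δ m l[v] := by
      rw [pivotStep, if_neg (not_lt.2 ht)]
    rw [e, wp_seq]
    -- Whether or not the record improves, the continuation is the same; it only needs that the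
    -- record is valid, not worse than before, and at most the radius of the pivot.
    have key : ∀ s4 k4, k4 ≤ 10 → (∀ a, a ≠ 3 → s4.N a = s3.N a) →
        (∀ a, a ≠ 2 → s4.R a = s3.R a) → BallOK δ c s4 → s4.R 2 ≤ s3.R 2 → s4.R 2 ≤ δ m l[v] →
        wp (oracle δ) B (filterArr (.realLT 10 5)) (fun k' s' => k4 + k' ≤ 60 * (l.length + 1) + 10 ∧
          SelectInv δ c m r x (l.filter fun q => δ m q < δ m l[v]) s') s4 := by
      intro s4 k4 hk4 hN hR hok hle hle'
      refine wp_mono _ (fun k' s' h' => ⟨by omega, h'.2⟩) _ (wp_filterArr_select (v := δ m l[v]) ?_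
        (by omega) ⟨?_, ?_, ?_, ?_, ?_, ?_, hs.nodup.filter _, ?_, hok, ?_, ?_⟩ ?_ ?_ ?_)
      · intro y s' hv' hw'
        simp [Test.holds, hv', hw']
      · rw [hN 1 (by norm_num), hcore.n_eq]
      · rw [hN 15 (by norm_num), hcore.zero]
      · rw [hR 1 (by norm_num), hcore.c_eq]
      · rw [hR 3 (by norm_num), hcore.rounds]
      · rw [hR 4 (by norm_num), hcore.n_real]
      · rw [hN 5 (by norm_num), hcore.center]
      -- Here the points that drop out lie at least as far as the pivot, beyond all that are kept,
      -- so the near set stays the same.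
      · obtain ⟨Low, hL, hlow, hhigh⟩ := hcore.low
        refine ⟨Low, by rw [hN 4 (by norm_num), hL], fun q hq => hlow q (List.mem_of_mem_filter hq),
          fun q hq p hp hp' => ?_⟩
        by_cases hpl : p ∈ l
        · simp only [List.mem_filter, decide_eq_true_eq, hpl, true_and, not_lt] at hq hp'
          linarith [hq.2]
        · exact hhigh q (List.mem_of_mem_filter hq) p hp hpl
      · exact hle.trans hcore.best_le
      · intro q hq
        rcases lt_or_ge (δ m q) (δ m l[v]) with hlt | hge
        · refine (hcore.opt q hq).imp (fun h => hle.trans h) fun hql => ?_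
          simp only [List.mem_filter, hql, true_and, decide_eq_true_eq, hlt]
        · exact Or.inl (hle'.trans hge)
      · rw [hN 6 (by norm_num), h36]
      · intro i hi
        rw [hN _ (by omega), harr3 i hi]
      · rw [hR _ (by norm_num), g35]
    refine ⟨fun ht2 => ?_, fun ht2 => ?_⟩
    · rw [Test.holds, g35] at ht2
      rw [wp_seq]
      refine wp_copyR (by norm_num) fun s4 hs4 h42 => ?_
      refine wp_copyN (by norm_num) (by rw [hs4.1 _ not_false, hcore.center]; omega)
        fun s5 hs5 h53 => ?_
      have e2 : s5.R 2 = δ m l[v] := by rw [hs5.2 2 not_false, h42, g35]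
      refine wp_mono _ ?_ _ (key s5 8 (by norm_num) ?_ ?_ ?_ ?_ e2.le)
      · rintro k' s' ⟨hk', hs'⟩
        refine ⟨?_, hs'⟩
        omega
      · intro a ha
        rw [hs5.1 a ha, hs4.1 a not_false]
      · intro a ha
        rw [hs5.2 a not_false, hs4.2 a ha]
      · refine ⟨m, ?_, ?_⟩
        · rw [h53, hs4.1 _ not_false, hcore.center]
        · rw [e2]; exact ht
      · rw [e2]; exact ht2.le
    · rw [Test.holds, g35, not_lt] at ht2
      rw [wp]
      beta_reduce
      refine wp_mono _ ?_ _ (key s3 2 (by norm_num) (fun _ _ => rfl) (fun _ _ => rfl) hcore.ok le_rfl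
        ht2)
      rintro k' s' ⟨hk', hs'⟩
      refine ⟨?_, hs'⟩
      omega

end RealRAM

/-! ### Expected time of the selection, and the search for a small ball -/

namespace RealRAM

variable {B n : ℕ} {τ : ℝ≥0∞}

theorem cost_mono {a b F G : ℝ≥0∞} (h : a ≤ b) (h' : F ≤ G) : τ * a + F ≤ τ * b + G := by gcongr

/-- Draws a random pivot and examines it. -/
def pivotRound : Cmd := .seq (.natConst 8 1) (.seq (.natSub 8 6 8) (.seq (.natRand 9 8) pivotTail))

def select : Cmd := .loop (.natLT 15 6) pivotRound

theorem ert_select_le {δ : Fin n → Fin n → ℝ} {c r x : ℝ} {m : Fin n} {l : List (Fin n)}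
    {s : State} {f : State → ℝ≥0∞} {F : ℝ≥0∞} (hc : 0 < c) (hB : 8 * n + 100 ≤ B)
    (hs : SelectInv δ c m r x l s) (hf : ∀ s', SelectInv δ c m r x [] s' → f s' ≤ F) :
    ert (oracle δ) B τ select f s ≤ τ * ((1632 * l.length + 1 : ℕ) : ℝ≥0∞) + F := by
  refine ert_loop_le (fun l s => SelectInv δ c m r x l s)
    (fun l : List (Fin n) => τ * ((1632 * l.length + 1 : ℕ) : ℝ≥0∞) + F) ?_ ?_ hs
  · intro l s hs ht
    have h0 : l = [] := by
      rw [Test.holds, hs.1.zero, hs.2.1] at ht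
      exact List.length_eq_zero_iff.1 (by omega)
    subst h0
    simpa using add_le_add_right (hf s hs) τ
  · intro l s hs ht I hI
    rw [Test.holds, hs.1.zero, hs.2.1] at ht
    have hlen : l.length - 1 + 1 = l.length := by omega
    set k := l.length with hk
    -- A round leaves three quarters of the list on average, and `3/4 · 1632 = 1224`. The missing
    -- quarter, `408 k`, pays for the round, which costs `200 (k+1)` plus a few steps.
    have hY := avg_natCast_le (N := k - 1)
      (y := fun v => 200 * (k + 1) + (1632 * (pivotStep δ c m l (l.getD v m)).length + 1))
      (Y := 200 * (k + 1) + 1 + 1224 * k) (by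
        have h1 := sum_pivotStep_le δ c m l hs.1.nodup
        have h2 := sum_range_getD m l fun x => (pivotStep δ c m l x).length
        rw [hlen, Finset.sum_add_distrib, Finset.sum_add_distrib, ← Finset.mul_sum,
          ← Finset.mul_sum, h2]
        simp only [Finset.sum_const, Finset.card_range, smul_eq_mul]
        nlinarith)
    have key : ((k - 1 + 1 : ℕ) : ℝ≥0∞)⁻¹ * ∑ v ∈ Finset.range (k - 1 + 1),
        ert (oracle δ) B τ pivotTail I (((s.setN 8 1).setN 8 (k - 1)).setN 9 v)
        ≤ τ * ((200 * (k + 1) + 1 + 1224 * k : ℕ) : ℝ≥0∞) + F := by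
      refine avg_le_mul (fun v hv => ?_) hY
      have hv' : v < k := by omega
      refine ert_le_of_wp (wp_pivotTail (m := m) (r := r) (x := x) hc hB v hv' ⟨?_, ?_, ?_⟩ (by simp)) ?_
      · refine hs.1.congr (fun a ha => ?_) fun a ha => rfl
        have h8 : a ≠ 8 := by omega
        have h9 : a ≠ 9 := by omega
        simp [h8, h9]
      · simpa using hs.2.1
      · intro i hi
        rw [← hs.2.2 i hi]
        have h8 : 8 * (0 + i) + 69 ≠ 8 := by omega
        have h9 : 8 * (0 + i) + 69 ≠ 9 := by omega
        simp only [setN_N, h8, h9, if_false]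
      · rintro k' s' ⟨hk', hs'⟩
        have h1 := hI _ _ hs'
        have h2 : l.getD v m = l[v] := by
          rw [List.getD_eq_getElem?_getD, List.getElem?_eq_getElem hv', Option.getD_some]
        calc τ * k' + I s' ≤ τ * ((200 * (k + 1) : ℕ) : ℝ≥0∞) +
              (τ * ((1632 * (pivotStep δ c m l l[v]).length + 1 : ℕ) : ℝ≥0∞) + F) := by gcongr
          _ = _ := by rw [← add_assoc, ← mul_add, h2]; push_cast; ring
    have e : ert (oracle δ) B τ pivotRound I s = τ * 6 + ((k - 1 + 1 : ℕ) : ℝ≥0∞)⁻¹ *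
        ∑ v ∈ Finset.range (k - 1 + 1),
        ert (oracle δ) B τ pivotTail I (((s.setN 8 1).setN 8 (k - 1)).setN 9 v) := by
      simp only [pivotRound, ert]
      rw [if_pos (by omega)]
      simp only [setN_N, if_true, hs.2.1, Nat.reduceEqDiff, if_false, ← hk]
      ring
    rw [e]
    calc _ ≤ τ + (τ * 6 + (τ * ((200 * (k + 1) + 1 + 1224 * k : ℕ) : ℝ≥0∞) + F)) := by gcongr
      _ = τ * ((200 * (k + 1) + 1 + 1224 * k + 7 : ℕ) : ℝ≥0∞) + F := by push_cast; ring
      _ ≤ _ := cost_mono (Nat.cast_le.2 (by omega)) le_rfl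

/-- The invariant of the search for a small ball: `x` rounds are over, and the best ball so far has
radius `r`. -/
structure BallInv (δ : Fin n → Fin n → ℝ) (c x r : ℝ) (s : State) : Prop where
  n_eq : s.N 1 = n
  zero : s.N 15 = 0
  c_eq : s.R 1 = c
  rounds : s.R 3 = x
  n_real : s.R 4 = n
  ok : BallOK δ c s
  best : s.R 2 = r

/-- One round of the search, with a random centre. -/
def ballRound : Cmd :=
  .seq (.natConst 60 1) (.seq (.realOfNat 6 60) (.seq (.realAdd 3 3 6) (.seq (.natConst 4 0)
    (.seq (.natSub 8 1 60) (.seq (.natRand 5 8) (.seq fill select))))))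

/-- The bound `F` may depend on the random centre. What a round achieves is that the new radius is
at most the old one and at most every suitable radius around the centre drawn. -/
theorem ert_ballRound_le {δ : Fin n → Fin n → ℝ} {c r x : ℝ} {s : State} {f : State → ℝ≥0∞}
    {F : ℕ → ℝ≥0∞} (hn : 0 < n) (hc : 0 < c) (hB : 8 * n + 100 ≤ B) (hs : BallInv δ c x r s)
    (hf : ∀ (m : Fin n) r' s', BallInv δ c (x + 1) r' s' → r' ≤ r →
      (∀ q, (n : ℝ) ≤ closedCount δ m (δ m q) * c → r' ≤ δ m q) → f s' ≤ F m) :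
    ert (oracle δ) B τ ballRound f s
      ≤ τ * ((4000 * n : ℕ) : ℝ≥0∞) + (n : ℝ≥0∞)⁻¹ * ∑ v ∈ Finset.range n, F v := by
  have hlen : n - 1 + 1 = n := by omega
  set s0 := ((((s.setN 60 1).setR 6 1).setR 3 (x + 1)).setN 4 0).setN 8 (n - 1) with hs0
  have e : ert (oracle δ) B τ ballRound f s = τ * 12 + ((n - 1 + 1 : ℕ) : ℝ≥0∞)⁻¹ *
      ∑ v ∈ Finset.range (n - 1 + 1), ert (oracle δ) B τ (.seq fill select) f (s0.setN 5 v) := by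
    simp only [ballRound, ert]
    rw [if_pos (by omega), if_pos (by omega)]
    simp [hs.n_eq, hs.rounds, hs0]
    ring
  have key : ∀ v < n, ert (oracle δ) B τ (.seq fill select) f (s0.setN 5 v)
      ≤ τ * ((3000 * n : ℕ) : ℝ≥0∞) + F v := by
    intro v hv
    rw [ert]
    have h1 : ert (oracle δ) B τ fill (ert (oracle δ) B τ select f) (s0.setN 5 v)
        ≤ τ * ((30 * (n + 1) : ℕ) : ℝ≥0∞) + (τ * ((1632 * n + 1 : ℕ) : ℝ≥0∞) + F v) := by
      refine ert_le_of_wp (Q := fun k s' => k ≤ 30 * (n + 1) ∧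
        SelectInv δ c ⟨v, hv⟩ r (x + 1) (List.finRange n) s')
        (wp_fill (n := n) (by omega) ?_ fun s' h1 h2 h3 h4 k hk => ⟨hk, ⟨?_, ?_, ?_, ?_, ?_, ?_,
          List.nodup_finRange n, ?_, ?_, ?_, ?_⟩, by simpa using h2, h1⟩) ?_
      · simp [hs0, hs.n_eq]
      · rw [h3 1] <;> simp [hs0, hs.n_eq]
      · rw [h3 15] <;> simp [hs0, hs.zero]
      · rw [h4]; simp [hs0, hs.c_eq]
      · rw [h4]; simp [hs0]
      · rw [h4]; simp [hs0, hs.n_real]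
      · rw [h3 5] <;> simp [hs0]
      · refine ⟨∅, ?_, by simp, by simp⟩
        rw [h3 4] <;> simp [hs0]
      · have := hs.ok
        unfold BallOK at this ⊢
        rw [h3 3, h4] <;> simp [hs0]; exact this
      · rw [h4]; simp [hs0, hs.best]
      · intro q _
        exact Or.inr (List.mem_finRange q)
      · rintro k s' ⟨hk, hs'⟩
        have h2 : ert (oracle δ) B τ select f s'
            ≤ τ * ((1632 * (List.finRange n).length + 1 : ℕ) : ℝ≥0∞) + F v := by
          refine ert_select_le hc hB hs' fun s'' h => ?_
          refine hf ⟨v, hv⟩ (s''.R 2) s'' ⟨h.1.n_eq, h.1.zero, h.1.c_eq, h.1.rounds, h.1.n_real,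
            h.1.ok, rfl⟩ h.1.best_le fun q hq => ?_
          simpa using h.1.opt q hq
        rw [List.length_finRange] at h2
        gcongr
    calc _ ≤ τ + (τ * ((30 * (n + 1) : ℕ) : ℝ≥0∞) + (τ * ((1632 * n + 1 : ℕ) : ℝ≥0∞) + F v)) := by
          gcongr
      _ = τ * ((30 * (n + 1) + (1632 * n + 1) + 1 : ℕ) : ℝ≥0∞) + F v := by push_cast; ring
      _ ≤ _ := by gcongr; omega
  rw [e, hlen]
  have h1 : (n : ℝ≥0∞)⁻¹ * ∑ v ∈ Finset.range n,
      ert (oracle δ) B τ (.seq fill select) f (s0.setN 5 v)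
      ≤ (n : ℝ≥0∞)⁻¹ * ∑ v ∈ Finset.range n, (τ * ((3000 * n : ℕ) : ℝ≥0∞) + F v) := by
    gcongr with v hv
    exact key v (Finset.mem_range.1 hv)
  have h2 : (n : ℝ≥0∞)⁻¹ * ∑ v ∈ Finset.range n, (τ * ((3000 * n : ℕ) : ℝ≥0∞) + F v)
      = τ * ((3000 * n : ℕ) : ℝ≥0∞) + (n : ℝ≥0∞)⁻¹ * ∑ v ∈ Finset.range n, F v := by
    rw [Finset.sum_add_distrib, mul_add, Finset.sum_const, Finset.card_range, nsmul_eq_mul,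
      ← mul_assoc, ENNReal.inv_mul_cancel (by simp [hn.ne']) (ENNReal.natCast_ne_top _), one_mul]
  calc _ ≤ τ * 12 + (τ * ((3000 * n : ℕ) : ℝ≥0∞) + (n : ℝ≥0∞)⁻¹ * ∑ v ∈ Finset.range n, F v) := by
        rw [← h2]; gcongr
    _ = τ * ((3000 * n + 12 : ℕ) : ℝ≥0∞) + (n : ℝ≥0∞)⁻¹ * ∑ v ∈ Finset.range n, F v := by
        push_cast; ring
    _ ≤ _ := by gcongr; omega

/-- The initial ball: all points, with the centre `0`. -/
def ballInit : Cmd :=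
  block [copyN 1 0, copyR 1 0, .realOfNat 4 1, fill, each (guarded true (.realLT 2 10) (copyR 2 10))]

theorem wp_ballInit {δ : Fin n → Fin n → ℝ} {c : ℝ} (hn : 0 < n) (hc : 1 ≤ c)
    (hB : 8 * n + 100 ≤ B) :
    wp (oracle δ) B ballInit (fun k s => k ≤ 200 * n ∧ ∃ r, BallInv δ c 0 r s) (initial n c) := by
  rw [ballInit, block, wp_seq]
  refine wp_copyN (by norm_num) (by simp [initial]; omega) fun s1 hs1 h1 => ?_
  simp only [block]
  rw [wp_seq]
  refine wp_copyR (by norm_num) fun s2 hs2 h2 => ?_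
  rw [wp_seq, wp, wp_seq]
  have e1 : s2.N 1 = n := by rw [hs2.1 1 not_false, h1]; simp [initial]
  refine wp_fill (n := n) (by omega) (by simpa using e1) fun s3 h3 h4 h5 h6 k hk => ?_
  rw [wp_seq]
  have f : ∀ a < 60, 0 < a → a ≠ 6 → a ≠ 10 → a ≠ 1 → s3.N a = 0 := by
    intro a ha ha0 ha6 ha10 ha1
    rw [h5 a (by omega) ha6 ha10 (by omega) (by omega), setR_N, hs2.1 a not_false, hs1.1 a ha1]
    simp [initial, ha0.ne']
  have f1 : s3.N 1 = n := by rw [h5 1] <;> simp [e1]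
  have g : ∀ a, a ≠ 0 → a ≠ 4 → a ≠ 1 → s3.R a = 0 := by
    intro a h0 h4 h1
    rw [h6 a, setR_R, if_neg h4, hs2.2 a h1, hs1.2 a not_false]
    simp [initial, h0]
  have g1 : s3.R 1 = c := by
    rw [h6 1, setR_R, if_neg (by norm_num), h2, hs1.2 0 not_false]
    simp [initial]
  have g4 : s3.R 4 = n := by
    rw [h6 4]; simp [e1]
  refine wp_each (List.finRange n) ⟨0, hn⟩ 10 (fun i s => (∀ a, ¬ EachReg a → s.N a = s3.N a) ∧
    (∀ a, a ≠ 2 → a ≠ 10 → s.R a = s3.R a) ∧ ∀ q : Fin n, (q : ℕ) < i → δ ⟨0, hn⟩ q ≤ s.R 2)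
    (by simp; omega) ?_ ?_ ?_ ?_ ?_
  · rintro i s ⟨h1, h2, -⟩
    refine ⟨?_, ?_, fun hi => ?_⟩
    · rw [h1 6 (by norm_num [EachReg]), h4, List.length_finRange]
    · rw [h1 5 (by norm_num [EachReg]), f 5] <;> norm_num
    · rw [h1 _ (by unfold EachReg; omega), ← h3 i hi, zero_add]
  · rintro i s s' ⟨h1, h2, h3⟩ h
    exact ⟨fun a ha => by rw [h.1 a ha, h1 a ha], fun a ha ha' => by rw [h.2 a ha', h2 a ha ha'],
      fun q hq => by rw [h.2 2 (by norm_num)]; exact h3 q hq⟩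
  · rintro i hi s ⟨h1, h2, h3⟩ h10 h11 hR
    refine wp_guarded (p := s.R 2 < s.R 10) (by simp [Test.holds]) (fun hsel => ?_) (fun hsel => ?_)
    · refine wp_copyR (by norm_num) fun s' hs' h2' => ⟨by norm_num, ?_, ?_, ?_, ?_⟩
      · rw [hs'.1 _ not_false, h10]
      · intro a ha
        rw [hs'.1 _ not_false, h1 a ha]
      · intro a ha ha'
        rw [hs'.2 _ ha, h2 a ha ha']
      · intro q hq
        rw [h2']
        simp only [decide_eq_true_eq] at hsel
        rcases Nat.lt_succ_iff_lt_or_eq.1 hq with hq | hq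
        · linarith [h3 q hq]
        · rw [hR]
          simp [← hq]
    · refine ⟨by norm_num, h10, h1, h2, fun q hq => ?_⟩
      simp only [decide_eq_false_iff_not, not_lt] at hsel
      rcases Nat.lt_succ_iff_lt_or_eq.1 hq with hq | hq
      · exact h3 q hq
      · rw [hR] at hsel
        simpa [← hq] using hsel
  · exact ⟨fun _ _ => rfl, fun _ _ _ => rfl, fun q hq => absurd hq (Nat.not_lt_zero _)⟩
  · rintro s ⟨h1, h2, h3⟩ k' hk'
    rw [List.length_finRange] at hk' h3
    simp only [wp]
    refine ⟨by omega, s.R 2, ?_, ?_, ?_, ?_, ?_, ⟨⟨0, hn⟩, ?_, ?_⟩, rfl⟩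
    · rw [h1 1 (by norm_num [EachReg]), f1]
    · rw [h1 15 (by norm_num [EachReg]), f 15] <;> norm_num
    · rw [h2 1 (by norm_num) (by norm_num), g1]
    · rw [h2 3 (by norm_num) (by norm_num), g 3] <;> norm_num
    · rw [h2 4 (by norm_num) (by norm_num), g4]
    · rw [h1 3 (by norm_num [EachReg]), f 3] <;> norm_num
    · have : closedCount δ ⟨0, hn⟩ (s.R 2) = n := by
        rw [closedCount, Finset.filter_true_of_mem fun q _ => h3 q q.2]; simp
      rw [this]
      nlinarith [(Nat.cast_nonneg n : (0 : ℝ) ≤ n)]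

/-- Finds a small ball with at least `n / c` points. -/
def ballProgram : Cmd :=
  .seq ballInit (.seq (.loop (.realLT 3 1) ballRound) (.seq (copyN 0 3) (copyR 0 2)))

/-- A template for two analyses of the same program, with a potential `Φ` of the number of rounds
and the best radius: `Φ = 0` yields time and correctness, an exponential `Φ` the failure
probability. The number `ρ m` bounds the radius found from the centre `m`. -/
theorem ert_ballProgram_le {δ : Fin n → Fin n → ℝ} {c : ℝ} (hn : 0 < n) (hc : 1 ≤ c)
    (hB : 8 * n + 100 ≤ B) {f : State → ℝ≥0∞} (Φ : ℝ → ℝ → ℝ≥0∞) (ρ : ℕ → ℝ)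
    (hρ : ∀ m : Fin n, ∃ q, (n : ℝ) ≤ closedCount δ m (δ m q) * c ∧ δ m q ≤ ρ m)
    (hmono : ∀ x r r', r ≤ r' → Φ x r ≤ Φ x r')
    (hstep : ∀ x < c, ∀ r, (n : ℝ≥0∞)⁻¹ * ∑ v ∈ Finset.range n, Φ (x + 1) (min r (ρ v)) ≤ Φ x r)
    (hexit : ∀ (s : State) (x : ℝ), c ≤ x → (∃ b : Fin n, s.N 0 = (b : ℕ) ∧ (n : ℝ) ≤ closedCount δ b (s.R 0) * c) →
      f s ≤ Φ x (s.R 0)) {F : ℝ≥0∞} (hF : ∀ r, Φ 0 r ≤ F) :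
    ert (oracle δ) B τ ballProgram f (initial n c)
      ≤ τ * ENNReal.ofReal (12000 * (n * c)) + F := by
  have hn1 : (1 : ℝ) ≤ n := by exact_mod_cast hn
  have hloop : ∀ r s, BallInv δ c 0 r s →
      ert (oracle δ) B τ (.seq (.loop (.realLT 3 1) ballRound) (.seq (copyN 0 3) (copyR 0 2))) f s
        ≤ τ * ENNReal.ofReal (5000 * n * (c + 1) + 20) + F := by
    intro r s hs
    rw [ert]
    have h1 := ert_loop_le (E := oracle δ) (B := B) (τ := τ) (t := .realLT 3 1) (a := ballRound)
      (f := ert (oracle δ) B τ (.seq (copyN 0 3) (copyR 0 2)) f)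
      -- As `c` need not be an integer, the last round may overshoot it, but by less than one; the
      -- remaining time stays nonnegative.
      (fun (g : ℝ × ℝ) s => BallInv δ c g.1 g.2 s ∧ g.1 < c + 1)
      (fun g => τ * ENNReal.ofReal (5000 * n * (c + 1 - g.1) + 10) + Φ g.1 g.2) ?_ ?_
      (g := (0, r)) (s := s) ⟨hs, by simp; linarith⟩
    · calc _ ≤ τ + (τ * ENNReal.ofReal (5000 * n * (c + 1 - 0) + 10) + Φ 0 r) := by gcongr
        _ = τ * ENNReal.ofReal (5000 * n * (c + 1 - 0) + 10 + 1) + Φ 0 r := by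
          rw [ENNReal.ofReal_add (by nlinarith) zero_le_one, ENNReal.ofReal_one]; ring
        _ ≤ _ := cost_mono (ENNReal.ofReal_le_ofReal (by linarith)) (hF r)
    · rintro ⟨x, r⟩ s ⟨hs, hx⟩ ht
      simp only at hs hx ⊢
      have hs' := hs
      rw [Test.holds, hs.rounds, hs.c_eq, not_lt] at ht
      have h2 : ert (oracle δ) B τ (.seq (copyN 0 3) (copyR 0 2)) f s
          ≤ τ * ((7 : ℕ) : ℝ≥0∞) + Φ x r := by
        refine ert_le_of_wp (Q := fun k s' => k ≤ 7 ∧ f s' ≤ Φ x r) ?_ fun k s' h => ?_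
        · rw [wp_seq]
          obtain ⟨b, hb, hb'⟩ := hs.ok
          refine wp_copyN (by norm_num) (by omega) fun s1 hs1 h1 => ?_
          refine wp_copyR (by norm_num) fun s2 hs2 h2 => ⟨by norm_num, ?_⟩
          have e : s2.R 0 = s.R 2 := by rw [h2, hs1.2 _ not_false]
          rw [← hs.best, ← e]
          refine hexit s2 x ht ⟨b, ?_, ?_⟩
          · rw [hs2.1 _ not_false, h1, hb]
          · rw [e]; exact hb'
        · gcongr
          · exact h.1
          · exact h.2
      calc _ ≤ τ + (τ * ((7 : ℕ) : ℝ≥0∞) + Φ x r) := by gcongr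
        _ = τ * ENNReal.ofReal 8 + Φ x r := by
          rw [show (8 : ℝ) = ((8 : ℕ) : ℝ) by norm_num, ENNReal.ofReal_natCast]; push_cast; ring
        _ ≤ _ := cost_mono (ENNReal.ofReal_le_ofReal (by nlinarith)) le_rfl
    · rintro ⟨x, r⟩ s ⟨hs, hx⟩ ht I hI
      simp only at hs hx hI ⊢
      rw [Test.holds, hs.rounds, hs.c_eq] at ht
      set T : ℝ≥0∞ := τ * ENNReal.ofReal (5000 * n * (c + 1 - (x + 1)) + 10) with hT
      have h2 := ert_ballRound_le (τ := τ) (f := I) (F := fun v => T + Φ (x + 1) (min r (ρ v)))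
        hn (by linarith) hB hs fun m r' s' hs' hr' hq => by
          obtain ⟨q, hq1, hq2⟩ := hρ m
          refine (hI (x + 1, r') s' ⟨hs', by simpa using ht⟩).trans ?_
          dsimp only
          gcongr
          exact hmono _ _ _ (le_min hr' ((hq q hq1).trans hq2))
      have h3 : (n : ℝ≥0∞)⁻¹ * ∑ v ∈ Finset.range n, (T + Φ (x + 1) (min r (ρ v))) ≤ T + Φ x r := by
        rw [Finset.sum_add_distrib, mul_add, Finset.sum_const, Finset.card_range, nsmul_eq_mul,
          ← mul_assoc, ENNReal.inv_mul_cancel (by simp [hn.ne']) (ENNReal.natCast_ne_top _), one_mul]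
        gcongr
        exact hstep x ht r
      calc _ ≤ τ + (τ * ((4000 * n : ℕ) : ℝ≥0∞) + (T + Φ x r)) := by
            gcongr; exact h2.trans (by gcongr)
        _ = τ * ENNReal.ofReal (((4000 * n + 1 : ℕ) : ℝ) + (5000 * n * (c + 1 - (x + 1)) + 10))
            + Φ x r := by
          rw [ENNReal.ofReal_add (by positivity) (by nlinarith), ENNReal.ofReal_natCast, hT]
          push_cast; ring
        _ ≤ _ := cost_mono (ENNReal.ofReal_le_ofReal (by push_cast; nlinarith)) le_rfl
  rw [ballProgram, ert]
  have h1 : ert (oracle δ) B τ ballInit (ert (oracle δ) B τ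
      (.seq (.loop (.realLT 3 1) ballRound) (.seq (copyN 0 3) (copyR 0 2))) f) (initial n c)
      ≤ τ * ((200 * n : ℕ) : ℝ≥0∞) + (τ * ENNReal.ofReal (5000 * n * (c + 1) + 20) + F) := by
    refine ert_le_of_wp (wp_ballInit hn hc hB) ?_
    rintro k s ⟨hk, r, hs⟩
    gcongr
    exact hloop r s hs
  calc _ ≤ τ + (τ * ((200 * n : ℕ) : ℝ≥0∞) + (τ * ENNReal.ofReal (5000 * n * (c + 1) + 20) + F)) :=
        by gcongr
    _ = τ * ENNReal.ofReal (((200 * n + 1 : ℕ) : ℝ) + (5000 * n * (c + 1) + 20)) + F := by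
      rw [ENNReal.ofReal_add (p := ((200 * n + 1 : ℕ) : ℝ)) (by positivity) (by positivity),
        ENNReal.ofReal_natCast]
      push_cast; ring
    _ ≤ _ := cost_mono (ENNReal.ofReal_le_ofReal (by push_cast; nlinarith)) le_rfl

end RealRAM

/-! ### Balls of nearly minimal radius -/

/-- What the algorithms need of a distance measure, besides covering properties. -/
structure DistanceMeasure.IsPremetric {d : ℕ} (X : DistanceMeasure d) (μ : ℝ) : Prop where
  self : ∀ x ∈ X.carrier, X.dist x x = 0
  pos : ∀ x ∈ X.carrier, ∀ y ∈ X.carrier, x ≠ y → 0 < X.dist x y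
  defective : X.IsDefective μ

namespace DistanceMeasure.IsPremetric

variable {d : ℕ} {X : DistanceMeasure d} {μ : ℝ}

theorem nonneg (h : X.IsPremetric μ) {x y : Fin d → ℝ} (hx : x ∈ X.carrier) (hy : y ∈ X.carrier) :
    0 ≤ X.dist x y := by
  by_cases hxy : x = y
  · subst hxy; exact (h.self x hx).ge
  · exact (h.pos x hx y hy hxy).le

/-- Defectiveness with `a = q = y` and `b = x` compares `D(x,y)` with `μ D(x,y)`. -/
theorem one_le (h : X.IsPremetric μ) {x y : Fin d → ℝ} (hx : x ∈ X.carrier) (hy : y ∈ X.carrier)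
    (hxy : x ≠ y) : 1 ≤ μ := by
  have h1 := h.defective y hy x hx y hy
  have h2 := h.pos x hx y hy hxy
  rw [h.self y hy, zero_sub, abs_neg, abs_of_pos h2] at h1
  nlinarith

end DistanceMeasure.IsPremetric

open Classical in
/-- The smallest radius of a ball with at least `κ` points of `Q`. -/
noncomputable def subsetRadius {d n : ℕ} (X : DistanceMeasure d) (p : Fin n → Fin d → ℝ)
    (Q : Finset (Fin n)) (κ : ℝ) : ℝ :=
  sInf {r | ∃ x ∈ X.carrier, κ ≤ ((Q.filter fun j => X.dist x (p j) ≤ r).card : ℝ)}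

section

variable {d n : ℕ} {X : DistanceMeasure d} {μ : ℝ} {p : Fin n → Fin d → ℝ} {Q : Finset (Fin n)}
  {κ : ℝ}

theorem nonneg_of_subsetRadius_mem (hX : X.IsPremetric μ) (hp : ∀ j, p j ∈ X.carrier) (hκ : 0 < κ)
    {r : ℝ} (hr : r ∈ {r | ∃ x ∈ X.carrier,
      κ ≤ ((Q.filter fun j => X.dist x (p j) ≤ r).card : ℝ)}) : 0 ≤ r := by
  obtain ⟨x, hx, h⟩ := hr
  have h1 : (0 : ℝ) < ((Q.filter fun j => X.dist x (p j) ≤ r).card : ℝ) := hκ.trans_le h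
  obtain ⟨j, hj⟩ := Finset.card_pos.1 (by exact_mod_cast h1)
  exact (hX.nonneg hx (hp j)).trans (Finset.mem_filter.1 hj).2

theorem subsetRadius_bddBelow (hX : X.IsPremetric μ) (hp : ∀ j, p j ∈ X.carrier) (hκ : 0 < κ) :
    BddBelow {r | ∃ x ∈ X.carrier, κ ≤ ((Q.filter fun j => X.dist x (p j) ≤ r).card : ℝ)} :=
  ⟨0, fun _ hr => nonneg_of_subsetRadius_mem hX hp hκ hr⟩

theorem card_lt_of_lt_subsetRadius (hX : X.IsPremetric μ) (hp : ∀ j, p j ∈ X.carrier) (hκ : 0 < κ)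
    {r : ℝ} (hr : r < subsetRadius X p Q κ) {x : Fin d → ℝ} (hx : x ∈ X.carrier) :
    ((Q.filter fun j => X.dist x (p j) ≤ r).card : ℝ) < κ := by
  by_contra hcon
  refine absurd (csInf_le (subsetRadius_bddBelow hX hp hκ) ⟨x, hx, ?_⟩) (not_le.2 hr)
  convert not_lt.1 hcon

/-- Some set of `κ` points has diameter at most `μ + 1` times the smallest radius. -/
theorem exists_subset_dist_le (hX : X.IsPremetric μ) (hp : ∀ j, p j ∈ X.carrier) (hκ : 0 < κ)
    (hQ : κ ≤ Q.card) : ∃ S ⊆ Q, κ ≤ (S.card : ℝ) ∧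
      ∀ m ∈ S, ∀ q ∈ S, X.dist (p m) (p q) ≤ (μ + 1) * subsetRadius X p Q κ := by
  classical
  set A := {r | ∃ x ∈ X.carrier, κ ≤ ((Q.filter fun j => X.dist x (p j) ≤ r).card : ℝ)} with hA
  have hR : subsetRadius X p Q κ = sInf A := by
    rw [subsetRadius, hA]
  set R := subsetRadius X p Q κ with hRdef
  have hbdd : BddBelow A := subsetRadius_bddBelow hX hp hκ
  obtain ⟨j0, hj0⟩ : Q.Nonempty := by
    rw [← Finset.card_pos]; exact_mod_cast hκ.trans_le hQ
  have hmemA : ∀ r, (∀ q ∈ Q, X.dist (p j0) (p q) ≤ r) → r ∈ A := fun r hr =>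
    ⟨p j0, hp j0, by rwa [Finset.filter_true_of_mem hr]⟩
  have hne : A.Nonempty := ⟨∑ q ∈ Q, X.dist (p j0) (p q), hmemA _ fun q hq =>
    Finset.single_le_sum (f := fun q => X.dist (p j0) (p q))
      (fun i _ => hX.nonneg (hp j0) (hp i)) hq⟩
  by_cases hall : ∀ m ∈ Q, ∀ q ∈ Q, X.dist (p m) (p q) ≤ (μ + 1) * R
  · exact ⟨Q, subset_rfl, hQ, hall⟩
  push Not at hall
  obtain ⟨m0, hm0, q0, hq0, h0⟩ := hall
  -- On a domain with a single point all distances and `R` vanish, which contradicts `h0`; otherwise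
  -- `μ ≥ 1`.
  have hμ : 0 ≤ μ := by
    by_cases hsub : ∃ x ∈ X.carrier, ∃ y ∈ X.carrier, x ≠ y
    · obtain ⟨x, hx, y, hy, hxy⟩ := hsub
      linarith [hX.one_le hx hy hxy]
    · push Not at hsub
      exfalso
      have hz : ∀ q q', X.dist (p q) (p q') = 0 := fun q q' => by
        rw [hsub _ (hp q) _ (hp q')]; exact hX.self _ (hp q')
      have h1 : R = 0 := by
        rw [hR]
        refine le_antisymm (csInf_le hbdd (hmemA 0 fun q _ => (hz _ _).le))
          (le_csInf hne fun r hr => nonneg_of_subsetRadius_mem hX hp hκ hr)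
      rw [h1, hz, mul_zero] at h0
      exact lt_irrefl _ h0
  -- The infimum `R` need not be attained. Let `v` realize the least of the finitely many distances
  -- above `(μ+1)R`, and take a ball of a radius `r` for which `(μ+1) r` is still smaller. Distances
  -- within it are below that of `v`, hence at most `(μ+1)R`.
  obtain ⟨v, hv, hmin⟩ := Finset.exists_min_image
    ((Finset.univ : Finset (Fin n × Fin n)).filter fun z => (μ + 1) * R < X.dist (p z.1) (p z.2))
    (fun z => X.dist (p z.1) (p z.2)) ⟨(m0, q0), by simpa using h0⟩
  simp only [Finset.mem_filter, Finset.mem_univ, true_and] at hv hmin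
  have hlt : sInf A < X.dist (p v.1) (p v.2) / (μ + 1) := by
    rw [← hR, lt_div_iff₀ (by linarith)]; linarith
  obtain ⟨r, ⟨x, hx, hxr⟩, hr⟩ := exists_lt_of_csInf_lt hne hlt
  rw [lt_div_iff₀ (by linarith)] at hr
  refine ⟨_, Finset.filter_subset _ _, hxr, fun m hm q hq => ?_⟩
  by_contra hcon
  have h1 := hmin (m, q) (not_le.1 hcon)
  -- The triangle inequality through the centre: `D(m,q) ≤ D(x,q) + μ D(x,m)`. Both distances on the
  -- right start at `x`, as they do in a left-ball.
  have h2 := (abs_le.1 (hX.defective (p m) (hp m) x hx (p q) (hp q))).2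
  have h3 := (Finset.mem_filter.1 hm).2
  have h4 := (Finset.mem_filter.1 hq).2
  have h5 : μ * X.dist x (p m) ≤ μ * r := by gcongr
  simp only at h1
  nlinarith

open RealRAM in
-- Every point of a set of `n/c` points with mutual distances at most `(μ+1)` times the optimum is a
-- good centre, and each round draws one with probability at least `1/c`.
theorem computesApproxBalls {F : Set (DistanceMeasure d)} (hF : ∀ X ∈ F, X.IsPremetric μ) :
    ComputesApproxBalls F μ 12000 := by
  classical
  refine ⟨ballProgram, fun X hXF n p hp c hc hcn => ?_⟩
  have hX := hF X hXF
  have hn1 : (1 : ℝ) ≤ n := hc.trans hcn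
  have hn : 0 < n := by exact_mod_cast zero_lt_one.trans_le hn1
  set δ := pairDist X p with hδ
  have hcount : ∀ m r, closedBallCount X p (p m) r = closedCount δ m r := fun m r => by
    rw [closedBallCount, closedCount]; rfl
  have hinit : ∀ i, (initial n c).N i ≤ 8 * n + 100 := by
    intro i
    simp only [initial, Function.update_apply]
    split_ifs <;> omega
  have hmax : ∀ m : Fin n, ∃ q, (n : ℝ) ≤ closedCount δ m (δ m q) * c := by
    intro m
    obtain ⟨q, -, hq⟩ := Finset.exists_max_image Finset.univ (δ m) ⟨m, Finset.mem_univ m⟩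
    refine ⟨q, ?_⟩
    rw [closedCount, Finset.filter_true_of_mem fun x hx => hq x hx, Finset.card_fin]
    nlinarith
  choose qm hqm using hmax
  -- Time and correctness hold whatever the centres are; as `ρ` the distance to a farthest point
  -- will do.
  have htime := ert_ballProgram_le (B := 8 * n + 100) (τ := 1) (δ := δ) hn hc le_rfl
    (f := guarantee fun s =>
      ∃ m : Fin n, s.N 0 = m ∧ (n : ℝ) / c ≤ (closedBallCount X p (p m) (s.R 0) : ℝ)) (fun _ _ => 0) (fun v => if h : v < n then δ ⟨v, h⟩ (qm ⟨v, h⟩) else 0)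
    (fun m => ⟨qm m, hqm m, by simp⟩) (fun _ _ _ _ => le_rfl) (by simp)
    (by
      rintro s x hx ⟨b, hb, hb'⟩
      refine guarantee_le ⟨b, hb, ?_⟩ _
      rw [hcount, div_le_iff₀ (by linarith)]
      exact hb') (F := 0) (fun _ => le_rfl)
  rw [one_mul, add_zero] at htime
  have hne := ne_top_of_le_ne_top ENNReal.ofReal_ne_top htime
  refine ⟨(expectedTime_le hinit _).trans htime, memoryBounded_of_ert hinit hne ?_,
    haltsOnlyWith_of_ert hinit hne, ?_⟩
  · push_cast; linarith
  obtain ⟨S, -, hS, hSd⟩ := exists_subset_dist_le (Q := Finset.univ) (κ := n / c) hX hp.2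
    (by positivity) (by simpa using div_le_self (by linarith) hc)
  have hopt : optRadius X p c = subsetRadius X p Finset.univ (n / c) := rfl
  rw [← hopt] at hSd
  set b := (μ + 1) * optRadius X p c with hb
  have hSq : ∀ m ∈ S, ∃ q, (n : ℝ) ≤ closedCount δ m (δ m q) * c ∧ δ m q ≤ b := by
    intro m hm
    obtain ⟨q, hq, hq'⟩ := Finset.exists_max_image S (δ m) ⟨m, hm⟩
    refine ⟨q, ?_, hSd m hm q hq⟩
    rw [← div_le_iff₀ (by linarith)]
    refine hS.trans ?_
    rw [Nat.cast_le, closedCount]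
    exact Finset.card_le_card fun x hx => by simpa using hq' x hx
  refine failsWithProbLE_of_ert hinit (B := 8 * n + 100)
    (f := fun s => if s.R 0 ≤ b then 0 else 1) (fun s hs => by rw [if_neg hs]) ?_
  have hfail := ert_ballProgram_le (B := 8 * n + 100) (τ := 0) (δ := δ) hn hc le_rfl
    (f := fun s => if s.R 0 ≤ b then 0 else 1)
    -- The potential bounds the probability that the remaining `c - x` rounds all fail. It starts at
    -- `1/e`, shrinks on average by `1 - 1/c ≤ exp(-1/c)`, and is at least `1` once `x ≥ c` without
    -- success.
    (fun x r => if r ≤ b then 0 else ENNReal.ofReal (Real.exp (-(c - x) / c)))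
    (fun v => if h : v < n then (if ⟨v, h⟩ ∈ S then b else δ ⟨v, h⟩ (qm ⟨v, h⟩)) else 0)
    (fun m => ?_) (fun x r r' h => ?_) (fun x hx r => ?_) (fun s x hx _ => ?_)
    (F := ENNReal.ofReal (Real.exp (-1))) (fun r => ?_)
  · simpa using hfail
  · by_cases hm : m ∈ S
    · simpa [hm] using hSq m hm
    · exact ⟨qm m, hqm m, by simp [hm]⟩
  · split_ifs with h1 h2
    · exact le_rfl
    · exact zero_le
    · linarith
    · exact le_rfl
  · by_cases hr : r ≤ b
    · rw [if_pos hr, Finset.sum_eq_zero, mul_zero]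
      exact fun v _ => if_pos ((min_le_left _ _).trans hr)
    · rw [if_neg hr]
      set e := Real.exp (-(c - (x + 1)) / c) with he
      have h1 : ∑ v ∈ Finset.range n, (if min r (if h : v < n then (if ⟨v, h⟩ ∈ S then b else
          δ ⟨v, h⟩ (qm ⟨v, h⟩)) else 0) ≤ b then 0 else ENNReal.ofReal e)
          ≤ ((Sᶜ).card : ℝ≥0∞) * ENNReal.ofReal e := by
        rw [Finset.sum_range, ← nsmul_eq_mul, ← Finset.sum_const, ← Finset.sum_filter_add_sum_filter_not
          (s := Finset.univ) (p := fun m => m ∈ S), Finset.sum_eq_zero, zero_add]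
        · rw [show (Finset.univ.filter fun m => m ∉ S) = Sᶜ by ext; simp]
          refine Finset.sum_le_sum fun v _ => ?_
          split_ifs <;> simp
        · intro m hm
          simp only [Finset.mem_filter, Finset.mem_univ, true_and] at hm
          simp [hm]
      have hcard : ((Sᶜ).card : ℝ) = n - S.card := by
        rw [Finset.card_compl, Fintype.card_fin, Nat.cast_sub]
        simpa using Finset.card_le_univ S
      calc _ ≤ (n : ℝ≥0∞)⁻¹ * (((Sᶜ).card : ℝ≥0∞) * ENNReal.ofReal e) := by gcongr
        _ = ENNReal.ofReal ((n : ℝ)⁻¹ * ((Sᶜ).card * e)) := by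
          rw [ENNReal.ofReal_mul (by positivity), ENNReal.ofReal_mul (by positivity),
            ENNReal.ofReal_inv_of_pos (by linarith), ENNReal.ofReal_natCast, ENNReal.ofReal_natCast]
        _ ≤ _ := by
          apply ENNReal.ofReal_le_ofReal
          have e1 : Real.exp (-(c - x) / c) = Real.exp (-(1 / c)) * e := by
            rw [he, ← Real.exp_add]; congr 1; field_simp; ring
          rw [e1, ← mul_assoc]
          gcongr
          have h2 := Real.add_one_le_exp (-(1 / c))
          refine le_trans ?_ h2
          rw [hcard, inv_mul_le_iff₀ (by linarith)]
          have : (n : ℝ) * (-(1 / c) + 1) = n - n / c := by ring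
          linarith
  · split_ifs with h
    · exact le_rfl
    · rw [← ENNReal.ofReal_one]
      apply ENNReal.ofReal_le_ofReal
      rw [Real.one_le_exp_iff]
      apply div_nonneg <;> linarith
  · split_ifs
    · exact zero_le
    · apply ENNReal.ofReal_le_ofReal
      rw [sub_zero, neg_div, div_self (by linarith)]

end

namespace RealRAM

/-! ### Random ring separators -/

variable {B n : ℕ} {τ : ℝ≥0∞}

/-- For `i < k` these are `k` equidistant radii in `[r, 9r)`, where `r` is the distance of two
random points. -/
noncomputable def ringOuter (δ : Fin n → Fin n → ℝ) (k : ℕ) (m j : Fin n) (i : ℕ) : ℝ :=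
  δ m j * (i / k * 8 + 1)

/-- The parameter `t` of the ring is only known up to a lower estimate `tl` and an upper estimate
`tu`. The division by `1 + 1/tl ≥ 1 + 1/t` makes the ring at least as thick as required, and
`GoodRing` tests its load against the stricter bound given by `tu`. For trees `t` is `log n`, of
which the machine has just such estimates. -/
noncomputable def ringInner (δ : Fin n → Fin n → ℝ) (tl : ℝ) (k : ℕ) (m j : Fin n) (i : ℕ) : ℝ :=
  ringOuter δ k m j i / (1 + 1 / tl)

/-- The number of points of the list in an open ball. -/
noncomputable def openCount (δ : Fin n → Fin n → ℝ) (l : List (Fin n)) (m : Fin n) (r : ℝ) : ℕ :=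
  l.countP fun q => δ m q < r

/-- The test of a ring with inner and outer radius `r₁`, `r₂`. -/
def GoodRing (δ : Fin n → Fin n → ℝ) (c₀ : ℕ) (tu : ℝ) (l : List (Fin n)) (m : Fin n)
    (r₁ r₂ : ℝ) : Prop :=
  (l.length : ℝ) < c₀ * openCount δ l m r₁ ∧
  (c₀ : ℝ) * openCount δ l m r₂ + l.length < c₀ * l.length ∧
  ¬ (l.length : ℝ) < ((openCount δ l m r₂ : ℝ) - openCount δ l m r₁) * tu

/-- The ring with centre and point of indices `N[9]`, `N[13]`, and with the random number `N[14]`. -/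
def ringRadii : Cmd :=
  block [load 69 5 9, load 69 11 13, .distance 24 5 11, .realOfNat 25 14, .realOfNat 23 6,
    .realDiv 25 25 23, .natConst 60 8, .realOfNat 26 60, .realMul 25 25 26, .natConst 60 1,
    .realOfNat 26 60, .realAdd 25 25 26, .realMul 31 24 25, .realDiv 30 31 20]

def ringCounts : Cmd :=
  block [copyR 5 30, count true (.realLT 10 5), .realOfNat 27 12,
    copyR 5 31, count true (.realLT 10 5), .realOfNat 28 12]

def ringTest : Cmd :=
  .seq (.realMul 29 22 27) (.cond (.realLT 23 29)
    (.seq (.realMul 29 22 28) (.seq (.realAdd 29 29 23) (.seq (.realMul 32 22 23)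
      (.cond (.realLT 29 32)
        (.seq (.realSub 29 28 27) (.seq (.realMul 29 29 21)
          (.cond (.realLT 23 29) .skip (.natConst 16 0)))) .skip)))) .skip)

/-- The registers that are used in the search for a ring separator. -/
def SepRegN (a : ℕ) : Prop := (5 ≤ a ∧ a ≤ 16 ∧ a ≠ 6 ∧ a ≠ 7 ∧ a ≠ 15) ∨ a = 60 ∨ a = 61

def SepRegR (a : ℕ) : Prop := a = 5 ∨ a = 10 ∨ (23 ≤ a ∧ a ≤ 32)

/-- The input of the search for a ring separator. -/
structure SepInput (c₀ : ℕ) (tl tu : ℝ) (l : List (Fin n)) (s : State) : Prop where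
  zero : s.N 15 = 0
  size : s.N 6 = l.length
  arr : Arr 69 0 l s
  factor : s.R 20 = 1 + 1 / tl
  upper : s.R 21 = tu
  balance : s.R 22 = c₀

theorem SepInput.congr {c₀ : ℕ} {tl tu : ℝ} {l : List (Fin n)} {s s' : State}
    (h : SepInput c₀ tl tu l s) (h' : Agree SepRegN SepRegR s s') : SepInput c₀ tl tu l s' := by
  obtain ⟨h1, h2, h3, h4, h5, h6⟩ := h
  refine ⟨?_, ?_, fun i hi => ?_, ?_, ?_, ?_⟩
  · rw [h'.1 _ (by unfold SepRegN; omega), h1]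
  · rw [h'.1 _ (by unfold SepRegN; omega), h2]
  · rw [h'.1 _ (by unfold SepRegN; omega), h3 i hi]
  · rw [h'.2 _ (by unfold SepRegR; omega), h4]
  · rw [h'.2 _ (by unfold SepRegR; omega), h5]
  · rw [h'.2 _ (by unfold SepRegR; omega), h6]

theorem wp_ringRadii {δ : Fin n → Fin n → ℝ} {c₀ : ℕ} {tl tu : ℝ} {l : List (Fin n)} {s : State}
    (hB : 8 * l.length + 100 ≤ B) (hs : SepInput c₀ tl tu l s) {v w : ℕ} (hv : v < l.length)
    (hw : w < l.length) (h9 : s.N 9 = v) (h13 : s.N 13 = w) :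
    wp (oracle δ) B ringRadii (fun k s' => k ≤ 100 ∧ Agree SepRegN SepRegR s s' ∧
      s'.N 16 = s.N 16 ∧ s'.N 5 = (l[v] : ℕ) ∧ s'.R 23 = l.length ∧
      s'.R 31 = ringOuter δ l.length l[v] l[w] (s.N 14) ∧
      s'.R 30 = ringInner δ tl l.length l[v] l[w] (s.N 14)) s := by
  rw [ringRadii, block, wp_seq]
  refine wp_load (by norm_num) (by omega) (by norm_num) fun s1 hs1 h1 => ?_
  rw [h9, ← zero_add v, hs.arr v hv] at h1
  rw [block, wp_seq]
  have e13 : s1.N 13 = w := by rw [hs1.1 13 (by norm_num), h13]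
  refine wp_load (by norm_num) (by omega) (by norm_num) fun s2 hs2 h2 => ?_
  rw [e13, hs1.1 _ (by omega), ← zero_add w, hs.arr w hw] at h2
  have e5 : s2.N 5 = l[v] := by rw [hs2.1 5 (by norm_num), h1]
  have e14 : s2.N 14 = s.N 14 := by rw [hs2.1 14 (by norm_num), hs1.1 14 (by norm_num)]
  have e16 : s2.N 16 = s.N 16 := by rw [hs2.1 16 (by norm_num), hs1.1 16 (by norm_num)]
  have e6 : s2.N 6 = l.length := by rw [hs2.1 6 (by norm_num), hs1.1 6 (by norm_num), hs.size]
  have eR : ∀ a, s2.R a = s.R a := fun a => by rw [hs2.2 _ not_false, hs1.2 _ not_false]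
  simp only [block, wp]
  refine ⟨by omega, by omega, by norm_num, ⟨fun a ha => ?_, fun a ha => ?_⟩, ?_, ?_, ?_, ?_, ?_⟩
  · simp only [SepRegN, not_or] at ha
    have h60 : a ≠ 60 := by omega
    simp only [setR_N, setN_N, if_neg h60]
    rw [hs2.1 _ (by omega), hs1.1 _ (by omega)]
  · simp only [SepRegR, not_or] at ha
    have h23 : a ≠ 23 := by omega
    have h24 : a ≠ 24 := by omega
    have h25 : a ≠ 25 := by omega
    have h26 : a ≠ 26 := by omega
    have h30 : a ≠ 30 := by omega
    have h31 : a ≠ 31 := by omega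
    simp [h23, h24, h25, h26, h30, h31, eR]
  · simp [e16]
  · simp [e5]
  · simp [e6]
  · simp [ringOuter, e5, h2, oracle_apply, e14, e6]
  · simp [ringOuter, ringInner, e5, h2, oracle_apply, e14, e6, eR, hs.factor]

theorem wp_ringCounts {δ : Fin n → Fin n → ℝ} {c₀ : ℕ} {tl tu : ℝ} {l : List (Fin n)} {s : State}
    (hB : 8 * l.length + 100 ≤ B) (hs : SepInput c₀ tl tu l s) {m : Fin n} (h5 : s.N 5 = m) :
    wp (oracle δ) B ringCounts (fun k s' => k ≤ 120 * (l.length + 1) ∧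
      Agree (fun a => a = 12 ∨ EachReg a) (fun a => a = 5 ∨ a = 10 ∨ a = 27 ∨ a = 28) s s' ∧
      s'.R 27 = openCount δ l m (s.R 30) ∧ s'.R 28 = openCount δ l m (s.R 31)) s := by
  rw [ringCounts, block, wp_seq]
  refine wp_copyR (by norm_num) fun s1 hs1 h1 => ?_
  simp only [block]
  rw [wp_seq]
  refine wp_count l m (s.R 30) (fun q => δ m q < s.R 30) ?_ (by omega) ?_ ?_ ?_ h1
    fun s2 hs2 h2 k2 hk2 => ?_
  · intro y s' hv' hw'
    simp [Test.holds, hv', hw']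
  · rw [hs1.1 _ not_false, h5]
  · rw [hs1.1 _ not_false, hs.size]
  · intro i hi
    rw [hs1.1 _ not_false, hs.arr i hi]
  rw [wp_seq, wp, wp_seq]
  refine wp_copyR (by norm_num) fun s3 hs3 h3 => ?_
  rw [wp_seq]
  have fN : ∀ a, ¬ (a = 12 ∨ EachReg a) → s3.N a = s.N a := fun a ha => by
    rw [hs3.1 _ not_false, setR_N, hs2.1 _ ha, hs1.1 _ not_false]
  have fR : ∀ a, a ≠ 5 → a ≠ 10 → a ≠ 27 → s3.R a = s.R a := fun a h5 h10 h27 => by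
    rw [hs3.2 _ h5, setR_R, if_neg h27, hs2.2 _ h10, hs1.2 _ h5]
  refine wp_count l m (s.R 31) (fun q => δ m q < s.R 31) ?_ (by omega) ?_ ?_ ?_ ?_
    fun s4 hs4 h4 k4 hk4 => ?_
  · intro y s' hv' hw'
    simp [Test.holds, hv', hw']
  · rw [fN _ (by unfold EachReg; omega), h5]
  · rw [fN _ (by unfold EachReg; omega), hs.size]
  · intro i hi
    rw [fN _ (by unfold EachReg; omega), hs.arr i hi]
  · rw [h3, setR_R, if_neg (by norm_num), hs2.2 _ (by norm_num), hs1.2 _ (by norm_num)]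
  rw [wp_seq, wp]
  simp only [wp]
  refine ⟨by omega, ⟨fun a ha => ?_, fun a ha => ?_⟩, ?_, ?_⟩
  · rw [setR_N, hs4.1 _ ha, fN _ ha]
  · simp only [not_or] at ha
    rw [setR_R, if_neg ha.2.2.2, hs4.2 _ ha.2.1, fR _ ha.1 ha.2.1 ha.2.2.1]
  · rw [setR_R, if_neg (by norm_num), hs4.2 _ (by norm_num), hs3.2 _ (by norm_num), setR_R,
      if_pos rfl, h2]
    rfl
  · rw [setR_R, if_pos rfl, h4]
    rfl

theorem wp_ringTest {E : ℕ → ℕ → ℝ} {c₀ : ℕ} {tl tu : ℝ} {l : List (Fin n)} {s : State}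
    {δ : Fin n → Fin n → ℝ} {m : Fin n} {r₁ r₂ : ℝ}
    (hs : SepInput c₀ tl tu l s) (h23 : s.R 23 = l.length) (h27 : s.R 27 = openCount δ l m r₁)
    (h28 : s.R 28 = openCount δ l m r₂) :
    wp E B ringTest (fun k s' => k ≤ 50 ∧
      Agree (fun a => a = 16) (fun a => a = 29 ∨ a = 32) s s' ∧
      (GoodRing δ c₀ tu l m r₁ r₂ → s'.N 16 = 0) ∧
      (¬ GoodRing δ c₀ tu l m r₁ r₂ → s'.N 16 = s.N 16)) s := by
  have h22 := hs.balance
  have h21 := hs.upper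
  have aux : ∀ s' : State, s'.N = s.N → (∀ a, a ≠ 29 → a ≠ 32 → s'.R a = s.R a) →
      Agree (fun a => a = 16) (fun a => a = 29 ∨ a = 32) s s' := fun s' h1 h2 =>
    ⟨fun a _ => by rw [h1], fun a ha => h2 a (by tauto) (by tauto)⟩
  simp only [ringTest, wp, Test.holds]
  simp [h23, h27, h28, h22, h21]
  refine ⟨fun ht1 => ⟨fun ht2 => ⟨fun ht3 => ⟨aux _ rfl ?_, fun h => ?_⟩,
    fun ht3 => ⟨⟨fun a ha => ?_, fun a ha => ?_⟩, fun h => ?_⟩⟩, fun ht2 => ⟨aux _ rfl ?_, ?_⟩⟩,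
    fun ht1 => ⟨aux _ rfl ?_, ?_⟩⟩
  · intro a h1 h2; simp [h1, h2]
  · exact absurd ht3 h.2.2
  · simp [show a ≠ 16 from ha]
  · simp only [not_or] at ha
    simp [ha]
  · exact absurd ⟨ht1, ht2, not_lt.2 ht3⟩ h
  · intro a h1 h2; simp [h1, h2]
  · intro h; exact absurd h.2.1 (not_lt.2 ht2)
  · intro a h1 h2; simp [h1]
  · intro h; exact absurd h.1 (not_lt.2 ht1)

/-- Tests the random ring. -/
def sepTail : Cmd := .seq ringRadii (.seq ringCounts ringTest)

theorem wp_sepTail {δ : Fin n → Fin n → ℝ} {c₀ : ℕ} {tl tu : ℝ} {l : List (Fin n)} {s : State}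
    (hB : 8 * l.length + 100 ≤ B) (hs : SepInput c₀ tl tu l s) {v w i : ℕ} (hv : v < l.length)
    (hw : w < l.length) (h9 : s.N 9 = v) (h13 : s.N 13 = w) (h14 : s.N 14 = i) :
    wp (oracle δ) B sepTail (fun k s' => k ≤ 300 * (l.length + 1) ∧ Agree SepRegN SepRegR s s' ∧
      (GoodRing δ c₀ tu l l[v] (ringInner δ tl l.length l[v] l[w] i)
        (ringOuter δ l.length l[v] l[w] i) → s'.N 16 = 0 ∧ s'.N 5 = (l[v] : ℕ) ∧
          s'.R 30 = ringInner δ tl l.length l[v] l[w] i ∧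
          s'.R 31 = ringOuter δ l.length l[v] l[w] i) ∧
      (¬ GoodRing δ c₀ tu l l[v] (ringInner δ tl l.length l[v] l[w] i)
        (ringOuter δ l.length l[v] l[w] i) → s'.N 16 = s.N 16)) s := by
  rw [sepTail, wp_seq]
  refine wp_mono _ ?_ _ (wp_ringRadii hB hs hv hw h9 h13)
  rintro k1 s1 ⟨hk1, hs1, h16, h5, h23, h31, h30⟩
  rw [h14] at h31 h30
  have hin1 := hs.congr hs1
  rw [wp_seq]
  refine wp_mono _ ?_ _ (wp_ringCounts (δ := δ) hB hin1 h5)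
  rintro k2 s2 ⟨hk2, hs2, h27, h28⟩
  have hs2' : Agree SepRegN SepRegR s1 s2 :=
    ⟨fun a ha => hs2.1 a (by simp only [EachReg, SepRegN] at *; omega),
      fun a ha => hs2.2 a (by simp only [SepRegR] at *; omega)⟩
  refine wp_mono _ ?_ _ (wp_ringTest (hin1.congr hs2') (by rw [hs2.2 _ (by norm_num), h23]) h27 h28)
  rintro k3 s3 ⟨hk3, hs3, hg, hng⟩
  rw [h30, h31] at hg hng
  have hs3' : Agree SepRegN SepRegR s2 s3 :=
    ⟨fun a ha => hs3.1 a (by simp only [SepRegN] at *; omega),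
      fun a ha => hs3.2 a (by simp only [SepRegR] at *; omega)⟩
  refine ⟨by omega, ?_, fun h => ⟨hg h, ?_, ?_, ?_⟩, fun h => ?_⟩
  · exact (hs1.trans hs2' (fun _ => id) (fun _ => id) (fun _ => id) (fun _ => id)).trans hs3'
      (fun _ => id) (fun _ => id) (fun _ => id) (fun _ => id)
  · rw [hs3.1 _ (by norm_num), hs2.1 _ (by norm_num [EachReg]), h5]
  · rw [hs3.2 _ (by norm_num), hs2.2 _ (by norm_num), h30]
  · rw [hs3.2 _ (by norm_num), hs2.2 _ (by norm_num), h31]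
  · rw [hng h, hs2.1 _ (by norm_num [EachReg]), h16]

theorem card_pointsInBall {δ : Fin n → Fin n → ℝ} {l : List (Fin n)} (hl : l.Nodup) (m : Fin n)
    (r : ℝ) : (pointsInBall δ l.toFinset m r).card = openCount δ l m r := by
  classical
  rw [openCount, List.countP_eq_length_filter, ← List.toFinset_card_of_nodup (hl.filter _)]
  congr 1
  ext q
  simp [pointsInBall]

/-- Two of the four balance conditions are tested. As the inner ball is contained in the outer one,
its lower bound and the upper bound of the outer ball imply the other two. -/
theorem GoodRing.isRingSeparator {δ : Fin n → Fin n → ℝ} {c₀ : ℕ} {tu ε : ℝ} {l : List (Fin n)}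
    {m : Fin n} {r₁ r₂ : ℝ} (h : GoodRing δ c₀ tu l m r₁ r₂) (hl : l.Nodup) (hm : m ∈ l)
    (hr : (1 + ε) * r₁ ≤ r₂) (hr' : r₁ ≤ r₂) (htu : 0 < tu) (hε : 1 / tu ≤ ε) :
    IsRingSeparator δ c₀ ε l.toFinset m r₁ r₂ := by
  obtain ⟨h1, h2, h3⟩ := h
  have hcard : l.toFinset.card = l.length := List.toFinset_card_of_nodup hl
  have hlen : (0 : ℝ) < l.length := by exact_mod_cast List.length_pos_of_mem hm
  have hc : (0 : ℝ) < c₀ := by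
    by_contra hc
    have : (c₀ : ℝ) = 0 := le_antisymm (not_lt.1 hc) (Nat.cast_nonneg _)
    rw [this, zero_mul] at h1
    linarith
  have hsub : pointsInBall δ l.toFinset m r₁ ⊆ pointsInBall δ l.toFinset m r₂ := by
    intro q hq
    simp only [pointsInBall, Finset.mem_filter] at hq ⊢
    exact ⟨hq.1, hq.2.trans_le hr'⟩
  have hle : openCount δ l m r₁ ≤ openCount δ l m r₂ := by
    rw [← card_pointsInBall hl, ← card_pointsInBall hl]
    exact Finset.card_le_card hsub
  have hle' : (openCount δ l m r₁ : ℝ) ≤ openCount δ l m r₂ := by exact_mod_cast hle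
  have hup : (openCount δ l m r₂ : ℝ) < (1 - 1 / c₀) * l.length := by
    have : (c₀ : ℝ) * ((1 - 1 / c₀) * l.length) = c₀ * l.length - l.length := by
      field_simp
    nlinarith
  have hlo : (l.length : ℝ) / c₀ < openCount δ l m r₁ := by
    rw [div_lt_iff₀ hc]; linarith
  refine ⟨by simpa using hm, ?_, ?_, ?_, ?_, hr, ?_⟩
  · rwa [hcard, card_pointsInBall hl]
  · rw [hcard, card_pointsInBall hl]; linarith
  · rw [hcard, card_pointsInBall hl]; linarith
  · rwa [hcard, card_pointsInBall hl]
  · rw [Finset.card_sdiff_of_subset hsub, card_pointsInBall hl, card_pointsInBall hl, hcard,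
      Nat.cast_sub hle]
    rw [not_lt, ← le_div_iff₀ htu] at h3
    calc _ ≤ (l.length : ℝ) / tu := h3
      _ = 1 / tu * l.length := by ring
      _ ≤ _ := by gcongr

end RealRAM

/-! ### Rejection sampling of ring separators -/

namespace RealRAM

variable {B n : ℕ} {τ : ℝ≥0∞}

/-- Average over `0, …, N`. -/
noncomputable def avg (N : ℕ) (g : ℕ → ℝ≥0∞) : ℝ≥0∞ :=
  ((N + 1 : ℕ) : ℝ≥0∞)⁻¹ * ∑ v ∈ Finset.range (N + 1), g v

theorem add_avg_le {N : ℕ} {g y : ℕ → ℝ≥0∞} {F a : ℝ≥0∞} (h : ∀ v ≤ N, g v ≤ τ * y v + F) :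
    τ * a + avg N g ≤ τ * (a + avg N y) + F := by
  rw [mul_add, add_assoc]
  gcongr
  exact avg_le_mul h le_rfl

theorem avg_const (N : ℕ) (a : ℝ≥0∞) : avg N (fun _ => a) = a := by
  rw [avg, Finset.sum_const, Finset.card_range, nsmul_eq_mul, ← mul_assoc,
    ENNReal.inv_mul_cancel (by simp) (ENNReal.natCast_ne_top _), one_mul]

theorem avg_add (N : ℕ) (g h : ℕ → ℝ≥0∞) : avg N (fun v => g v + h v) = avg N g + avg N h := by
  rw [avg, Finset.sum_add_distrib, mul_add]; rfl

theorem avg_avg_avg_le {N Y : ℕ} {y : ℕ → ℕ → ℕ → ℕ}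
    (h : ∑ v ∈ Finset.range (N + 1), ∑ w ∈ Finset.range (N + 1), ∑ i ∈ Finset.range (N + 1), y v w i
      ≤ (N + 1) ^ 3 * Y) :
    avg N (fun v => avg N fun w => avg N fun i => (y v w i : ℝ≥0∞)) ≤ Y := by
  simp only [avg, ← Finset.mul_sum]
  set M : ℝ≥0∞ := ((N + 1 : ℕ) : ℝ≥0∞) with hM
  have h1 : M⁻¹ * M = 1 := ENNReal.inv_mul_cancel (by simp [hM]) (ENNReal.natCast_ne_top _)
  have h2 : ∑ v ∈ Finset.range (N + 1), ∑ w ∈ Finset.range (N + 1), ∑ i ∈ Finset.range (N + 1),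
      (y v w i : ℝ≥0∞) ≤ M ^ 3 * Y := by
    rw [hM]; exact_mod_cast h
  calc _ ≤ M⁻¹ * (M⁻¹ * (M⁻¹ * (M ^ 3 * Y))) := by gcongr
    _ = (M⁻¹ * M) ^ 3 * Y := by ring
    _ = Y := by rw [h1]; ring

/-- Draws a random ring and tests it. -/
def sepRound : Cmd :=
  .seq (.natConst 8 1) (.seq (.natSub 8 6 8) (.seq (.natRand 9 8) (.seq (.natRand 13 8)
    (.seq (.natRand 14 8) sepTail))))

/-- Finds a ring separator of the points in the array. -/
def findSep : Cmd := .seq (.natConst 16 1) (.loop (.natLT 15 16) sepRound)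

open Classical in
/-- The number of triples of random numbers that yield a ring separator. -/
noncomputable def goodTriples (δ : Fin n → Fin n → ℝ) (c₀ : ℕ) (tl tu : ℝ) (l : List (Fin n)) : ℕ :=
  ∑ m ∈ l.toFinset, ∑ j ∈ l.toFinset, ∑ i ∈ Finset.range l.length,
    if GoodRing δ c₀ tu l m (ringInner δ tl l.length m j i) (ringOuter δ l.length m j i)
    then 1 else 0

/-- A round succeeds with probability at least `1/p`, so the expected number of rounds is at most
`p`. Accordingly, the potential of an unsuccessful state is `p b₀`, where `b₀` exceeds the cost of a
round. -/
theorem ert_findSep_le {δ : Fin n → Fin n → ℝ} {c₀ p : ℕ} {tl tu ε : ℝ} {l : List (Fin n)}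
    {s : State} {f : State → ℝ≥0∞} {F : ℝ≥0∞} (hB : 8 * l.length + 100 ≤ B)
    (hs : SepInput c₀ tl tu l s) (hl : l.Nodup) (hlen : 0 < l.length) (hδ : ∀ i j, 0 ≤ δ i j)
    (htl : 0 < tl) (htu : 0 < tu) (hε : ε ≤ 1 / tl) (hε' : 1 / tu ≤ ε)
    (hp : l.length ^ 3 ≤ p * goodTriples δ c₀ tl tu l)
    (hf : ∀ s', Agree SepRegN SepRegR s s' → (∃ m : Fin n, m ∈ l ∧ s'.N 5 = m ∧
      IsRingSeparator δ c₀ ε l.toFinset m (s'.R 30) (s'.R 31)) → f s' ≤ F) :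
    ert (oracle δ) B τ findSep f s ≤ τ * ((p * 400 * (l.length + 1) : ℕ) : ℝ≥0∞) + F := by
  classical
  set k := l.length with hk
  have hN : k - 1 + 1 = k := by omega
  set b₀ := 300 * (k + 1) + 20 with hb₀
  obtain ⟨d, -⟩ : ∃ d, d ∈ l := List.exists_mem_of_length_pos hlen
  have hp1 : 1 ≤ p := by
    by_contra hp0
    have : p = 0 := by omega
    rw [this, zero_mul] at hp
    have : 0 < k ^ 3 := by positivity
    omega
  set good : Fin n → Fin n → ℕ → Prop := fun m j i =>
    GoodRing δ c₀ tu l m (ringInner δ tl k m j i) (ringOuter δ k m j i) with hgood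
  -- The cost of testing the triple plus the potential after the test.
  let y : ℕ → ℕ → ℕ → ℕ := fun v w i =>
    300 * (k + 1) + 1 + if good (l.getD v d) (l.getD w d) i then 0 else p * b₀
  have h19 : 19 ≤ p * b₀ := le_trans (by omega) (Nat.le_mul_of_pos_left b₀ hp1)
  have h400 : p * b₀ + 3 ≤ p * 400 * (k + 1) := by
    have h1 := Nat.mul_le_mul_left p (show b₀ + 3 ≤ 400 * (k + 1) by omega)
    rw [mul_assoc]
    rw [mul_add] at h1
    omega
  -- Each good triple saves `p b₀`, and there are at least `k³/p` of them, so the average of `y` is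
  -- at most `300 (k+1) + 1 + p b₀ - b₀ = p b₀ - 19`. The 19 units pay for the loop test and the
  -- random draws.
  have hsum : ∑ v ∈ Finset.range (k - 1 + 1), ∑ w ∈ Finset.range (k - 1 + 1),
      ∑ i ∈ Finset.range (k - 1 + 1), y v w i ≤ (k - 1 + 1) ^ 3 * (p * b₀ - 19) := by
    rw [hN]
    have e1 : ∑ v ∈ Finset.range k, ∑ w ∈ Finset.range k, ∑ i ∈ Finset.range k,
        (if good (l.getD v d) (l.getD w d) i then 1 else 0) = goodTriples δ c₀ tl tu l := by
      rw [goodTriples, List.sum_toFinset _ hl, ← sum_range_getD d]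
      refine Finset.sum_congr rfl fun v _ => ?_
      rw [List.sum_toFinset _ hl, ← sum_range_getD d]
    have e2 : ∑ v ∈ Finset.range k, ∑ w ∈ Finset.range k, ∑ i ∈ Finset.range k,
        (y v w i + p * b₀ * if good (l.getD v d) (l.getD w d) i then 1 else 0)
        = k ^ 3 * (300 * (k + 1) + 1 + p * b₀) := by
      rw [Finset.sum_congr rfl fun v _ => Finset.sum_congr rfl fun w _ => Finset.sum_congr rfl
        fun i _ => show (y v w i + p * b₀ * if good (l.getD v d) (l.getD w d) i then 1 else 0)
          = 300 * (k + 1) + 1 + p * b₀ by simp only [y]; split_ifs <;> ring]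
      simp only [Finset.sum_const, Finset.card_range, smul_eq_mul]
      ring
    clear_value y
    simp only [Finset.sum_add_distrib, ← Finset.mul_sum] at e2
    rw [e1] at e2
    have h1 : k ^ 3 * b₀ ≤ p * b₀ * goodTriples δ c₀ tl tu l :=
      (Nat.mul_le_mul_right b₀ hp).trans_eq (by ring)
    obtain ⟨z, hz⟩ := Nat.exists_eq_add_of_le h19
    rw [hz, Nat.add_sub_cancel_left]
    rw [show k ^ 3 * (300 * (k + 1) + 1 + p * b₀) = k ^ 3 * b₀ + k ^ 3 * z by rw [hz, hb₀]; ring]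
      at e2
    omega
  have havg := avg_avg_avg_le hsum
  have key := ert_loop_le (E := oracle δ) (B := B) (τ := τ) (t := .natLT 15 16) (a := sepRound)
    -- The ghost variable is `true` as long as no separator has been found.
    (f := f) (fun (g : Bool) s' => Agree SepRegN SepRegR s s' ∧
      if g then s'.N 16 = 1 else s'.N 16 = 0 ∧ ∃ m : Fin n, m ∈ l ∧ s'.N 5 = m ∧
        IsRingSeparator δ c₀ ε l.toFinset m (s'.R 30) (s'.R 31))
    (fun g => τ * (((if g then p * b₀ else 0) + 1 : ℕ) : ℝ≥0∞) + F) ?_ ?_ (g := true)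
    (s := s.setN 16 1) ⟨⟨fun a ha => ?_, fun _ _ => rfl⟩, by simp⟩
  · rw [findSep, ert, ert, if_pos (by omega)]
    calc _ ≤ τ + (τ + (τ * ((p * b₀ + 1 : ℕ) : ℝ≥0∞) + F)) := by
          gcongr; simpa using key
      _ = τ * ((p * b₀ + 3 : ℕ) : ℝ≥0∞) + F := by push_cast; ring
      _ ≤ _ := cost_mono (Nat.cast_le.2 h400) le_rfl
  · rintro g s1 ⟨hs1, hg⟩ ht
    have h15 := (hs.congr hs1).zero
    rw [Test.holds, h15] at ht
    cases g
    · simp only [Bool.false_eq_true, if_false] at hg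
      simpa using add_le_add_right (hf s1 hs1 hg.2) τ
    · simp at hg
      omega
  · rintro g s1 ⟨hs1, hg⟩ ht I hI
    have hin := hs.congr hs1
    rw [Test.holds, hin.zero] at ht
    cases g
    · simp at hg; omega
    simp only [if_true] at hg
    set s2 := (s1.setN 8 1).setN 8 (k - 1) with hs2
    have e : ert (oracle δ) B τ sepRound I s1 = τ * 6 + avg (k - 1) fun v =>
        (τ * 2 + avg (k - 1) fun w => (τ * 2 + avg (k - 1) fun i =>
        ert (oracle δ) B τ sepTail I (((s2.setN 9 v).setN 13 w).setN 14 i))) := by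
      have h8 : s2.N 8 = k - 1 := by simp [hs2]
      simp only [sepRound, ert]
      rw [if_pos (by omega)]
      simp only [setN_N, if_true, hin.size, Nat.reduceEqDiff, if_false, ← hk, ← hs2, h8, avg,
        mul_two, add_assoc]
      ring
    have hrun : ∀ v ≤ k - 1, ∀ w ≤ k - 1, ∀ i ≤ k - 1,
        ert (oracle δ) B τ sepTail I (((s2.setN 9 v).setN 13 w).setN 14 i) ≤ τ * y v w i + F := by
      intro v hv w hw i hi
      have hv' : v < l.length := by omega
      have hw' : w < l.length := by omega
      have ev : l.getD v d = l[v] := by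
        rw [List.getD_eq_getElem?_getD, List.getElem?_eq_getElem hv', Option.getD_some]
      have ew : l.getD w d = l[w] := by
        rw [List.getD_eq_getElem?_getD, List.getElem?_eq_getElem hw', Option.getD_some]
      have hag : Agree SepRegN SepRegR s1 (((s2.setN 9 v).setN 13 w).setN 14 i) := by
        refine ⟨fun a ha => ?_, fun _ _ => rfl⟩
        have h8 : a ≠ 8 := by unfold SepRegN at ha; omega
        have h9 : a ≠ 9 := by unfold SepRegN at ha; omega
        have h13 : a ≠ 13 := by unfold SepRegN at ha; omega
        have h14 : a ≠ 14 := by unfold SepRegN at ha; omega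
        simp [hs2, h8, h9, h13, h14]
      refine ert_le_of_wp (wp_sepTail (δ := δ) (v := v) (w := w) (i := i) hB
        (hin.congr hag) hv' hw' (by simp) (by simp) (by simp)) ?_
      rintro k' s3 ⟨hk', hs3, hg1, hg2⟩
      have hs3' : Agree SepRegN SepRegR s s3 :=
        (hs1.trans hag (fun _ => id) (fun _ => id) (fun _ => id) (fun _ => id)).trans hs3
          (fun _ => id) (fun _ => id) (fun _ => id) (fun _ => id)
      simp only [y, ev, ew]
      by_cases hgd : good l[v] l[w] i
      · obtain ⟨g1, g2, g3, g4⟩ := hg1 hgd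
        have hout : 0 ≤ ringOuter δ k l[v] l[w] i := mul_nonneg (hδ _ _) (by positivity)
        have h1t : 0 < 1 + 1 / tl := by positivity
        have := hI false s3 ⟨hs3', by
          simp only [Bool.false_eq_true, if_false]
          refine ⟨g1, l[v], List.getElem_mem hv', g2, ?_⟩
          rw [g3, g4]
          refine GoodRing.isRingSeparator hgd hl (List.getElem_mem hv') ?_ ?_ htu hε'
          · rw [ringInner, ← mul_div_assoc, div_le_iff₀ h1t, mul_comm]
            gcongr
          · rw [ringInner]
            refine div_le_self hout ?_
            have : 0 ≤ 1 / tl := by positivity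
            linarith⟩
        rw [if_pos hgd]
        calc τ * k' + I s3 ≤ τ * ((300 * (k + 1) : ℕ) : ℝ≥0∞) + (τ * ((0 + 1 : ℕ) : ℝ≥0∞) + F) := by
              gcongr
              simpa using this
          _ = _ := by push_cast; ring
      · have := hI true s3 ⟨hs3', by simp [hg2 hgd, hs2, hg]⟩
        rw [if_neg hgd]
        calc τ * k' + I s3 ≤ τ * ((300 * (k + 1) : ℕ) : ℝ≥0∞)
              + (τ * ((p * b₀ + 1 : ℕ) : ℝ≥0∞) + F) := by
              gcongr
              simpa using this
          _ = _ := by push_cast; ring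
    have hall := add_avg_le (τ := τ) (F := F) (N := k - 1) (a := 6)
      (g := fun v => (τ * 2 + avg (k - 1) fun w => (τ * 2 + avg (k - 1) fun i =>
        ert (oracle δ) B τ sepTail I (((s2.setN 9 v).setN 13 w).setN 14 i))))
      (y := fun v => 2 + avg (k - 1) fun w => 2 + avg (k - 1) fun i => (y v w i : ℝ≥0∞))
      fun v hv => add_avg_le fun w hw => add_avg_le fun i hi => hrun v hv w hw i hi
    rw [← e] at hall
    simp only [avg_add, avg_const] at hall
    calc _ ≤ τ + (τ * (6 + (2 + (2 + ((p * b₀ - 19 : ℕ) : ℝ≥0∞)))) + F) := by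
          gcongr; refine hall.trans ?_; gcongr
      _ = τ * ((p * b₀ - 19 + 11 : ℕ) : ℝ≥0∞) + F := by push_cast; ring
      _ ≤ _ := cost_mono (Nat.cast_le.2 (by
        simp only [if_true]; omega)) le_rfl
  · have : a ≠ 16 := by unfold SepRegN at ha; omega
    simp [this]

end RealRAM

/-! ### Double counting of points in random rings -/

namespace RealRAM

variable {n : ℕ}

theorem card_le_of_mem_Ioc (F : Finset ℕ) {a b : ℝ} (hab : a ≤ b)
    (h : ∀ i ∈ F, a < (i : ℝ) ∧ (i : ℝ) ≤ b) : (F.card : ℝ) ≤ b - a + 1 := by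
  rcases F.eq_empty_or_nonempty with rfl | hF
  · simp; linarith
  have h1 := h _ (F.min'_mem hF)
  have h2 := h _ (F.max'_mem hF)
  have h3 : F ⊆ Finset.Icc (F.min' hF) (F.max' hF) := fun i hi =>
    Finset.mem_Icc.2 ⟨F.min'_le i hi, F.le_max' i hi⟩
  have h4 := Finset.card_le_card h3
  rw [Nat.card_Icc] at h4
  have h5 : F.min' hF ≤ F.max' hF := F.min'_le _ (F.max'_mem hF)
  have h6 : F.card + F.min' hF ≤ F.max' hF + 1 := by omega
  have h7 : (F.card : ℝ) + (F.min' hF : ℕ) ≤ (F.max' hF : ℕ) + 1 := by exact_mod_cast h6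
  linarith [h1.1, h2.2]

open Classical in
theorem openCount_sub_openCount {δ : Fin n → Fin n → ℝ} {l : List (Fin n)} (hl : l.Nodup)
    (m : Fin n) {r₁ r₂ : ℝ} (hr : r₁ ≤ r₂) :
    (openCount δ l m r₂ : ℝ) - openCount δ l m r₁
      = ((l.toFinset.filter fun q => r₁ ≤ δ m q ∧ δ m q < r₂).card : ℝ) := by
  rw [← card_pointsInBall hl, ← card_pointsInBall hl]
  have hsub : pointsInBall δ l.toFinset m r₁ ⊆ pointsInBall δ l.toFinset m r₂ := by
    intro q hq
    simp only [pointsInBall, Finset.mem_filter] at hq ⊢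
    exact ⟨hq.1, hq.2.trans_le hr⟩
  rw [← Nat.cast_sub (Finset.card_le_card hsub), ← Finset.card_sdiff_of_subset hsub]
  congr 2
  ext q
  simp only [pointsInBall, Finset.mem_sdiff, Finset.mem_filter, not_and, not_lt]
  tauto

open Classical in
/-- For suitable `m`, `j`, a constant fraction of the random numbers yields a ring separator. -/
theorem le_card_goodRing {δ : Fin n → Fin n → ℝ} {c₀ : ℕ} {tl tu : ℝ} {l : List (Fin n)}
    (hl : l.Nodup) (hc : 2 ≤ c₀) (hlen : 12 ≤ l.length) (htl : 1 / 2 ≤ tl) (htu' : tu ≤ 4 * tl) {m j : Fin n} (hr : 0 < δ m j)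
    (h1 : (l.length : ℝ) < c₀ * ((l.toFinset.filter fun q => δ m q ≤ δ m j).card : ℝ))
    (h2 : 36 * ((l.toFinset.filter fun q => δ m q < 9 * δ m j).card : ℝ) < l.length) :
    l.length ≤ 8 * ((Finset.range l.length).filter fun i =>
      GoodRing δ c₀ tu l m (ringInner δ tl l.length m j i) (ringOuter δ l.length m j i)).card := by
  set k := l.length with hk
  set r := δ m j with hrdef
  set A := l.toFinset.filter fun q => δ m q < 9 * r with hA
  have hk0 : (12 : ℝ) ≤ k := by exact_mod_cast hlen
  have htl0 : 0 < tl := by linarith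
  set r₂ : ℕ → ℝ := fun i => ringOuter δ k m j i with hr₂
  set r₁ : ℕ → ℝ := fun i => ringInner δ tl k m j i with hr₁
  have hr12 : ∀ i, r₁ i * (1 + 1 / tl) = r₂ i := fun i => by
    simp only [hr₁, ringInner, hr₂]
    rw [div_mul_cancel₀]
    positivity
  have hr2pos : ∀ i, 0 < r₂ i := fun i => by
    simp only [hr₂, ringOuter]
    positivity
  have hr1pos : ∀ i, 0 < r₁ i := fun i => by
    have h := hr2pos i
    rw [← hr12] at h
    exact pos_of_mul_pos_left h (by positivity)
  have hle : ∀ i, r₁ i ≤ r₂ i := fun i => by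
    rw [← hr12 i]
    have := hr1pos i
    have : 0 < r₁ i * (1 / tl) := by positivity
    linarith
  -- All outer balls lie in `A`, which has few points; this gives the upper balance condition.
  have hr29 : ∀ i < k, r₂ i < 9 * r := fun i hi => by
    have hi' : (i : ℝ) / k < 1 := by
      rw [div_lt_one (by linarith)]; exact_mod_cast hi
    simp only [hr₂, ringOuter]
    rw [← hrdef]
    nlinarith
  -- Beyond the first quarter of the grid the outer radius exceeds `3r`, and `1 + 1/tl ≤ 3` keeps
  -- the inner radius above `r`. The inner ball then contains the ball of `h1`.
  have hr1r : ∀ i, k < 4 * i → r < r₁ i := fun i hi => by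
    have h4 : (k : ℝ) < 4 * i := by exact_mod_cast hi
    have hi' : (1 : ℝ) / 4 < i / k := by
      rw [lt_div_iff₀ (by linarith)]; linarith
    have h3 : 1 + 1 / tl ≤ 3 := by
      have : 1 / tl ≤ 2 := by rw [div_le_iff₀ htl0]; linarith
      linarith
    have h5 : 3 * r < r₂ i := by
      simp only [hr₂, ringOuter]
      rw [← hrdef]
      nlinarith
    have h6 := hr12 i
    have h7 := hr1pos i
    nlinarith
  set ring : ℕ → Finset (Fin n) := fun i => l.toFinset.filter fun q => r₁ i ≤ δ m q ∧ δ m q < r₂ i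
    with hring
  set bad := (Finset.range k).filter fun i => (k : ℝ) < (ring i).card * tu with hbad
  -- all points of the rings lie in few rings each
  have hsum : ∑ i ∈ Finset.range k, ((ring i).card : ℝ) ≤ A.card * (9 * k / (8 * tl) + 1) := by
    have e : ∀ i ∈ Finset.range k, ((ring i).card : ℝ)
        = ∑ q ∈ A, if r₁ i ≤ δ m q ∧ δ m q < r₂ i then (1 : ℝ) else 0 := fun i hi => by
      rw [← Finset.sum_filter, Finset.sum_const, nsmul_eq_mul, mul_one]
      congr 2
      ext q
      simp only [hring, hA, Finset.mem_filter]
      have := hr29 i (Finset.mem_range.1 hi)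
      constructor
      · rintro ⟨h1, h2⟩; exact ⟨⟨h1, h2.2.trans this⟩, h2⟩
      · rintro ⟨h1, h2⟩; exact ⟨h1.1, h2⟩
    rw [Finset.sum_congr rfl e, Finset.sum_comm, ← nsmul_eq_mul]
    refine Finset.sum_le_card_nsmul _ _ _ fun q hq => ?_
    rw [← Finset.sum_filter, Finset.sum_const, nsmul_eq_mul, mul_one]
    have hq9 : δ m q < 9 * r := (Finset.mem_filter.1 hq).2
    set v := δ m q with hv
    by_cases hv0 : v ≤ 0
    · rw [Finset.filter_false_of_mem]
      · simp; positivity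
      · rintro i - ⟨h, -⟩
        linarith [hr1pos i]
    -- Solved for the grid index, `r₁ i ≤ v < r₂ i` confines `i` to a half-open interval of length
    -- `k (v/r) / (8 tl) ≤ 9k / (8 tl)`.
    have hlow : k * (v / r - 1) / 8 ≤ k * (v * (1 + 1 / tl) / r - 1) / 8 := by
      have : v ≤ v * (1 + 1 / tl) := by
        have : 0 < v * (1 / tl) := mul_pos (not_le.1 hv0) (by positivity)
        linarith
      gcongr
    refine (card_le_of_mem_Ioc _ hlow fun i hi => ?_).trans ?_
    · obtain ⟨-, ha, hb⟩ := Finset.mem_filter.1 hi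
      have hb' : v < r * (i / k * 8 + 1) := hb
      have ha' : r * (i / k * 8 + 1) ≤ v * (1 + 1 / tl) := by
        have h := hr12 i
        have : r₂ i ≤ v * (1 + 1 / tl) := by rw [← h]; gcongr
        exact this
      have hk1 : (0 : ℝ) < k := by linarith
      constructor
      · rw [← div_lt_iff₀' hr] at hb'
        have : v / r - 1 < i / k * 8 := by linarith
        rw [div_lt_iff₀ (by norm_num)]
        calc k * (v / r - 1) < k * (i / k * 8) := by gcongr
          _ = i * 8 := by field_simp
      · rw [← le_div_iff₀' hr] at ha'
        have : (i : ℝ) / k * 8 ≤ v * (1 + 1 / tl) / r - 1 := by linarith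
        rw [le_div_iff₀ (by norm_num)]
        calc (i : ℝ) * 8 = k * (i / k * 8) := by field_simp
          _ ≤ _ := by gcongr
    · have : k * (v * (1 + 1 / tl) / r - 1) / 8 - k * (v / r - 1) / 8 = k * (v / r) / (8 * tl) := by
        field_simp; ring
      rw [this]
      have h9 : v / r ≤ 9 := by rw [div_le_iff₀ hr]; exact hq9.le
      have : k * (v / r) / (8 * tl) ≤ 9 * k / (8 * tl) := by
        gcongr ?_ / _
        nlinarith
      linarith
  -- A crowded ring has at least `w = max 1 (k/(4 tl))` points, where the `1` absorbs the rounding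
  -- term of the interval count. A point lies in at most `11/2 · w` rings and `A` has at most `k/36`
  -- points, so at most `11k/72` rings are crowded.
  have hbadcard : (bad.card : ℝ) ≤ k / 6 := by
    have hA0 : (0 : ℝ) ≤ A.card := Nat.cast_nonneg _
    have hb1 : ∀ i ∈ bad, max 1 (k / (4 * tl)) ≤ ((ring i).card : ℝ) := fun i hi => by
      have h := (Finset.mem_filter.1 hi).2
      refine max_le ?_ ?_
      · rw [Nat.one_le_cast, Nat.one_le_iff_ne_zero]
        intro h0
        rw [h0] at h
        simp at h
        linarith
      · rw [div_le_iff₀ (by positivity)]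
        refine h.le.trans ?_
        gcongr
    set w := max 1 (k / (4 * tl)) with hw
    have hw1 : 1 ≤ w := le_max_left _ _
    have hw2 : k / (4 * tl) ≤ w := le_max_right _ _
    have h3 : bad.card * w ≤ A.card * (9 * k / (8 * tl) + 1) := by
      refine le_trans ?_ hsum
      rw [← nsmul_eq_mul]
      refine (Finset.card_nsmul_le_sum _ _ _ hb1).trans ?_
      exact Finset.sum_le_sum_of_subset_of_nonneg (Finset.filter_subset _ _)
        fun _ _ _ => Nat.cast_nonneg _
    have h4 : 9 * k / (8 * tl) + 1 ≤ 11 / 2 * w := by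
      have : 9 * k / (8 * tl) = 9 / 2 * (k / (4 * tl)) := by field_simp; ring
      rw [this]; linarith
    have h5 : bad.card * w ≤ (k / 36) * (11 / 2 * w) := by
      refine h3.trans ?_
      gcongr
      linarith
    have h6 : (bad.card : ℝ) * w ≤ (k * 11 / 72) * w := by linarith
    have h7 := le_of_mul_le_mul_right h6 (by linarith)
    linarith
  have hsub : (Finset.Ico (k / 4 + 1) k) \ bad ⊆ (Finset.range k).filter fun i =>
      GoodRing δ c₀ tu l m (r₁ i) (r₂ i) := by
    intro i hi
    rw [Finset.mem_sdiff, Finset.mem_Ico] at hi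
    obtain ⟨⟨hi1, hi2⟩, hib⟩ := hi
    refine Finset.mem_filter.2 ⟨Finset.mem_range.2 hi2, ?_, ?_, ?_⟩
    · refine h1.trans_le ?_
      gcongr
      rw [← card_pointsInBall hl]
      refine Finset.card_le_card fun q hq => ?_
      simp only [pointsInBall, Finset.mem_filter] at hq ⊢
      exact ⟨hq.1, hq.2.trans_lt (hr1r i (by omega))⟩
    · have hb : (openCount δ l m (r₂ i) : ℝ) ≤ A.card := by
        rw [← card_pointsInBall hl, Nat.cast_le]
        refine Finset.card_le_card fun q hq => ?_
        simp only [hA, pointsInBall, Finset.mem_filter] at hq ⊢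
        exact ⟨hq.1, hq.2.trans (hr29 i hi2)⟩
      have hc' : (2 : ℝ) ≤ c₀ := by exact_mod_cast hc
      nlinarith
    · intro hlt
      refine hib (Finset.mem_filter.2 ⟨Finset.mem_range.2 hi2, ?_⟩)
      rw [openCount_sub_openCount hl m (hle i)] at hlt
      convert hlt using 1
  have h3 := Finset.card_le_card hsub
  have h4 := Finset.le_card_sdiff bad (Finset.Ico (k / 4 + 1) k)
  rw [Nat.card_Ico] at h4
  have h5 : 6 * bad.card ≤ k := by
    have : (6 : ℝ) * bad.card ≤ k := by linarith
    exact_mod_cast this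
  -- Of the `k` indices, a quarter is too small and a sixth is crowded. The remainder is at least
  -- `k/8`, as `k ≥ 12`.
  have h6 : k ≤ 8 * (k - (k / 4 + 1) - bad.card) := by omega
  exact h6.trans (Nat.mul_le_mul_left 8 (h4.trans h3))

end RealRAM

/-- The points of a finite set in a ball are covered by `N` balls, with centres in the domain, of a
radius that is smaller by a factor `A`. -/
def DistanceMeasure.IsCovering {d : ℕ} (X : DistanceMeasure d) (A : ℝ) (N : ℕ) : Prop :=
  ∀ P : Finset (Fin d → ℝ), (∀ y ∈ P, y ∈ X.carrier) → ∀ m ∈ X.carrier, ∀ r : ℝ, 0 < r →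
    ∃ T : Finset (Fin d → ℝ), T.card ≤ N ∧ (∀ x ∈ T, x ∈ X.carrier) ∧
      ∀ y ∈ P, X.dist m y < A * r → ∃ x ∈ T, X.dist x y < r

/-! ### The probability that a random triple yields a ring separator -/

section

variable {d n : ℕ} {X : DistanceMeasure d} {μ : ℝ} {p : Fin n → Fin d → ℝ} {Q : Finset (Fin n)}
  {κ : ℝ} {N : ℕ}

open Classical in
-- None of the `N` covering balls of radius `R` can hold `κ` points: they are open, and `R` is the
-- infimum of the radii of closed balls with that many points.
theorem card_ball_lt_mul (hX : X.IsPremetric μ) (hcov : X.IsCovering (9 * (μ + 1)) N)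
    (hp : ∀ j, p j ∈ X.carrier) (hκ : 0 < κ) (hN : 0 < N)
    (hR : 0 < subsetRadius X p Q κ) (m : Fin n) :
    ((Q.filter fun q => X.dist (p m) (p q) < 9 * (μ + 1) * subsetRadius X p Q κ).card : ℝ)
      < N * κ := by
  set R := subsetRadius X p Q κ with hRdef
  obtain ⟨T, hT, hTX, hcovT⟩ := hcov (Finset.univ.image p) (fun y hy => by
    obtain ⟨j, -, rfl⟩ := Finset.mem_image.1 hy
    exact hp j) (p m) (hp m) R hR
  have hball : ∀ x ∈ T, ((Q.filter fun q => X.dist x (p q) < R).card : ℝ) < κ := by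
    intro x hx
    rcases (Q.filter fun q => X.dist x (p q) < R).eq_empty_or_nonempty with h0 | h0
    · rw [h0]; simpa using hκ
    -- Shrinking the open ball to the closed one through its farthest point `b` loses no points and
    -- makes the radius smaller than `R`.
    obtain ⟨b, hb, hmax⟩ := Finset.exists_max_image _ (fun q => X.dist x (p q)) h0
    have hbR := (Finset.mem_filter.1 hb).2
    refine lt_of_le_of_lt ?_ (card_lt_of_lt_subsetRadius hX hp hκ hbR (hTX x hx))
    rw [Nat.cast_le]
    refine Finset.card_le_card fun q hq => ?_
    exact Finset.mem_filter.2 ⟨(Finset.mem_filter.1 hq).1, hmax q hq⟩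
  have hsub : (Q.filter fun q => X.dist (p m) (p q) < 9 * (μ + 1) * R)
      ⊆ T.biUnion fun x => Q.filter fun q => X.dist x (p q) < R := by
    intro q hq
    obtain ⟨hq1, hq2⟩ := Finset.mem_filter.1 hq
    obtain ⟨x, hx, hxq⟩ := hcovT (p q) (Finset.mem_image_of_mem _ (Finset.mem_univ q)) hq2
    exact Finset.mem_biUnion.2 ⟨x, hx, Finset.mem_filter.2 ⟨hq1, hxq⟩⟩
  have h1 := (Finset.card_le_card hsub).trans Finset.card_biUnion_le
  have h2 : (((Q.filter fun q => X.dist (p m) (p q) < 9 * (μ + 1) * R).card : ℕ) : ℝ)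
      ≤ ∑ x ∈ T, ((Q.filter fun q => X.dist x (p q) < R).card : ℝ) := by
    exact_mod_cast h1
  have hTN : (T.card : ℝ) ≤ N := by exact_mod_cast hT
  rcases T.eq_empty_or_nonempty with h0 | h0
  · rw [h0] at h2
    simp only [Finset.sum_empty] at h2
    have : (0 : ℝ) < N * κ := by positivity
    linarith
  · refine h2.trans_lt ((Finset.sum_lt_sum_of_nonempty h0 hball).trans_le ?_)
    rw [Finset.sum_const, nsmul_eq_mul]
    gcongr

open Classical in
/-- Only few points of a set are not separated from the centre by many other points. -/
theorem card_filter_count_le {n : ℕ} (Q S : Finset (Fin n)) (hS : S ⊆ Q) (g : Fin n → ℝ) (a : ℝ)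
    (ha : 0 ≤ a) :
    ((S.filter fun j => ((Q.filter fun q => g q ≤ g j).card : ℝ) ≤ a).card : ℝ) ≤ a := by
  rcases (S.filter fun j => ((Q.filter fun q => g q ≤ g j).card : ℝ) ≤ a).eq_empty_or_nonempty
    with h0 | h0
  · rw [h0]; simpa using ha
  -- The ball through the farthest of the selected points contains all of them, and by selection it
  -- is small.
  obtain ⟨b, hb, hmax⟩ := Finset.exists_max_image _ g h0
  refine le_trans ?_ (Finset.mem_filter.1 hb).2
  rw [Nat.cast_le]
  refine Finset.card_le_card fun q hq => ?_
  exact Finset.mem_filter.2 ⟨hS (Finset.mem_filter.1 hq).1, hmax q hq⟩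

open RealRAM

open Classical in
-- A cluster `S` of `κ = k/(36N)` points supplies the centres. For each centre, at least half as
-- many `j ∈ S` have more than `κ/2` points within distance `D(m,j)`, and an eighth of the radii is
-- good for such a pair. The probability of success is at least `1/(36N) · 1/(72N) · 1/8 = 1/(20736
-- N²)`.
theorem goodTriples_large {l : List (Fin n)} {tl tu : ℝ} (hX : X.IsPremetric μ)
    (hcov : X.IsCovering (9 * (μ + 1)) N) (hpX : IsPointSet X p)
    (hN : 0 < N) (hl : l.Nodup) (hlen : 72 * N ≤ l.length) (htl : 1 / 2 ≤ tl)
    (htu : tu ≤ 4 * tl) :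
    l.length ^ 3 ≤ 20736 * N ^ 2 * goodTriples (pairDist X p) (72 * N) tl tu l := by
  have hp := hpX.2
  set δ := pairDist X p with hδ
  set k := l.length with hk
  have hNr : (1 : ℝ) ≤ N := by exact_mod_cast hN
  have hkr : 72 * (N : ℝ) ≤ k := by exact_mod_cast hlen
  have hk0 : (0 : ℝ) < k := by linarith
  have hcard : l.toFinset.card = k := List.toFinset_card_of_nodup hl
  set κ : ℝ := k / (36 * N) with hκdef
  have hκ : 0 < κ := by positivity
  have hκk : κ ≤ l.toFinset.card := by
    rw [hcard]; exact div_le_self hk0.le (by linarith)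
  obtain ⟨S, hSQ, hScard, hSd⟩ := exists_subset_dist_le hX hp hκ hκk
  set R := subsetRadius X p l.toFinset κ with hR
  have key : ∀ m ∈ S, ∀ j ∈ S, ¬ ((l.toFinset.filter fun q => δ m q ≤ δ m j).card : ℝ) ≤ k / (72 * N) →
      k ≤ 8 * ((Finset.range k).filter fun i =>
      GoodRing δ (72 * N) tu l m (ringInner δ tl k m j i) (ringOuter δ k m j i)).card := by
    intro m hm j hj hmj
    have hmj' := not_le.1 hmj
    -- As `k ≥ 72N`, more than one point lies within distance `δ m j` of `m`, one of them different
    -- from `m`.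
    have hr : 0 < δ m j := by
      have h1 : (1 : ℝ) < (l.toFinset.filter fun q => δ m q ≤ δ m j).card := by
        refine lt_of_le_of_lt ?_ hmj'
        rw [le_div_iff₀ (by positivity)]; linarith
      obtain ⟨a, ha, b, hb, hab⟩ := Finset.one_lt_card.1 (by exact_mod_cast h1)
      obtain ⟨q, hq, hqm⟩ : ∃ q ∈ l.toFinset.filter fun q => δ m q ≤ δ m j, m ≠ q := by
        by_cases h : m = a
        · exact ⟨b, hb, h ▸ hab⟩
        · exact ⟨a, ha, h⟩
      exact (hX.pos _ (hp m) _ (hp q) (hpX.1.ne hqm)).trans_le (Finset.mem_filter.1 hq).2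
    have hle := hSd m hm j hj
    have hne : p m ≠ p j := by
      intro h
      rw [hδ, pairDist, ← h, hX.self _ (hp m)] at hr
      exact lt_irrefl _ hr
    have hμ := hX.one_le (hp m) (hp j) hne
    have hRpos : 0 < R := by
      have : 0 < (μ + 1) * R := lt_of_lt_of_le hr hle
      exact pos_of_mul_pos_right this (by linarith)
    refine le_card_goodRing hl (by omega) (by omega) htl htu hr ?_ ?_
    · rw [div_lt_iff₀ (by positivity)] at hmj'
      push_cast
      rwa [mul_comm]
    · have h1 := card_ball_lt_mul (Q := l.toFinset) hX hcov hp hκ hN hRpos m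
      have h2 : N * κ = k / 36 := by rw [hκdef]; field_simp
      rw [h2] at h1
      have h3 : ((l.toFinset.filter fun q => δ m q < 9 * δ m j).card : ℝ)
          ≤ (l.toFinset.filter fun q => X.dist (p m) (p q) < 9 * (μ + 1) * R).card := by
        rw [Nat.cast_le]
        refine Finset.card_le_card fun q hq => ?_
        rw [Finset.mem_filter] at hq ⊢
        refine ⟨hq.1, hq.2.trans_le ?_⟩
        calc 9 * δ m j ≤ 9 * ((μ + 1) * R) := by gcongr; exact hle
          _ = _ := by ring
      linarith
  have hJ : ∀ m ∈ S, (k : ℝ) / (72 * N) ≤ (S.filter fun j =>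
      ¬ ((l.toFinset.filter fun q => δ m q ≤ δ m j).card : ℝ) ≤ k / (72 * N)).card := by
    intro m hm
    have h1 := card_filter_count_le l.toFinset S hSQ (δ m) (k / (72 * N)) (by positivity)
    have h2 := Finset.card_filter_add_card_filter_not (s := S)
      (p := fun j => ((l.toFinset.filter fun q => δ m q ≤ δ m j).card : ℝ) ≤ k / (72 * N))
    have h2' : ((S.filter fun j => ((l.toFinset.filter fun q => δ m q ≤ δ m j).card : ℝ)
        ≤ k / (72 * N)).card : ℝ) + (S.filter fun j =>
      ¬ ((l.toFinset.filter fun q => δ m q ≤ δ m j).card : ℝ) ≤ k / (72 * N)).card = S.card := by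
      exact_mod_cast h2
    have h3 : κ = k / (72 * N) + k / (72 * N) := by rw [hκdef]; field_simp; ring
    linarith
  have hG : κ * ((k / (72 * N)) * (k / 8)) ≤ goodTriples δ (72 * N) tl tu l := by
    rw [goodTriples]
    push_cast
    calc κ * ((k / (72 * N)) * (k / 8)) ≤ S.card * ((k / (72 * N)) * (k / 8)) := by gcongr
      _ = ∑ m ∈ S, ((k : ℝ) / (72 * N)) * (k / 8) := by rw [Finset.sum_const, nsmul_eq_mul]
      _ ≤ ∑ m ∈ S, ∑ j ∈ S.filter fun j =>
          ¬ ((l.toFinset.filter fun q => δ m q ≤ δ m j).card : ℝ) ≤ k / (72 * N), (k : ℝ) / 8 := by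
        refine Finset.sum_le_sum fun m hm => ?_
        rw [Finset.sum_const, nsmul_eq_mul]
        gcongr
        exact hJ m hm
      _ ≤ ∑ m ∈ S, ∑ j ∈ S.filter fun j =>
          ¬ ((l.toFinset.filter fun q => δ m q ≤ δ m j).card : ℝ) ≤ k / (72 * N),
          ∑ i ∈ Finset.range k, if GoodRing δ (72 * N) tu l m (ringInner δ tl k m j i)
            (ringOuter δ k m j i) then (1 : ℝ) else 0 := by
        refine Finset.sum_le_sum fun m hm => Finset.sum_le_sum fun j hj => ?_
        rw [Finset.mem_filter] at hj
        have := key m hm j hj.1 hj.2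
        rw [← Finset.sum_filter, Finset.sum_const, nsmul_eq_mul, mul_one,
          div_le_iff₀ (by norm_num), mul_comm]
        exact_mod_cast this
      _ ≤ ∑ m ∈ S, ∑ j ∈ l.toFinset,
          ∑ i ∈ Finset.range k, if GoodRing δ (72 * N) tu l m (ringInner δ tl k m j i)
            (ringOuter δ k m j i) then (1 : ℝ) else 0 := by
        refine Finset.sum_le_sum fun m _ => Finset.sum_le_sum_of_subset_of_nonneg
          ((Finset.filter_subset _ _).trans hSQ) fun j _ _ => Finset.sum_nonneg fun i _ => ?_
        split_ifs <;> norm_num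
      _ ≤ _ := by
        refine Finset.sum_le_sum_of_subset_of_nonneg hSQ fun m _ _ =>
          Finset.sum_nonneg fun j _ => Finset.sum_nonneg fun i _ => ?_
        split_ifs <;> norm_num
  have e : (k : ℝ) ^ 3 = 20736 * N ^ 2 * (κ * ((k / (72 * N)) * (k / 8))) := by
    rw [hκdef]; field_simp; ring
  have : (k : ℝ) ^ 3 ≤ 20736 * N ^ 2 * goodTriples δ (72 * N) tl tu l := by
    rw [e]; gcongr
  exact_mod_cast this

open Classical in
-- With fewer than `c₀` points a ball with the single point `m` is balanced. It is obtained from the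
-- nearest neighbour `j` and `i = 0`, when both radii are at most the distance of `j` and the ring
-- is empty. Thus every centre has a good triple.
theorem goodTriples_small {l : List (Fin n)} {δ : Fin n → Fin n → ℝ} {c₀ : ℕ} {tl tu : ℝ}
    (h0 : ∀ m, δ m m = 0) (hpos : ∀ m q, m ≠ q → 0 < δ m q) (hc : 3 ≤ c₀) (hl : l.Nodup)
    (hlen : 2 ≤ l.length) (hlen' : l.length < c₀) (htl : 0 < tl) :
    l.length ^ 3 ≤ c₀ ^ 2 * goodTriples δ c₀ tl tu l := by
  set k := l.length with hk
  have hcard : l.toFinset.card = k := List.toFinset_card_of_nodup hl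
  have hlt : (k : ℝ) < c₀ := by exact_mod_cast hlen'
  have hc3 : (3 : ℝ) ≤ c₀ := by exact_mod_cast hc
  have hk2 : (2 : ℝ) ≤ k := by exact_mod_cast hlen
  have key : ∀ m ∈ l.toFinset, 1 ≤ ∑ j ∈ l.toFinset, ∑ i ∈ Finset.range k,
      if GoodRing δ c₀ tu l m (ringInner δ tl k m j i) (ringOuter δ k m j i) then 1 else 0 := by
    intro m hm
    have hne : (l.toFinset.erase m).Nonempty := by
      rw [← Finset.card_pos, Finset.card_erase_of_mem hm]; omega
    obtain ⟨j, hj, hmin⟩ := Finset.exists_min_image _ (δ m) hne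
    rw [Finset.mem_erase] at hj
    have hr := hpos m j hj.1.symm
    have hcount : ∀ r, 0 < r → r ≤ δ m j → openCount δ l m r = 1 := by
      intro r hr0 hrle
      rw [← card_pointsInBall hl, Finset.card_eq_one]
      refine ⟨m, ?_⟩
      ext q
      rw [pointsInBall, Finset.mem_filter, Finset.mem_singleton]
      constructor
      · rintro ⟨hq, hqr⟩
        by_contra hqm
        linarith [hmin q (Finset.mem_erase.2 ⟨hqm, hq⟩)]
      · rintro rfl
        exact ⟨hm, by rw [h0]; exact hr0⟩
    have e2 : ringOuter δ k m j 0 = δ m j := by simp [ringOuter]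
    have h1t : 1 < 1 + 1 / tl := by
      have : 0 < 1 / tl := by positivity
      linarith
    have e1 : openCount δ l m (ringInner δ tl k m j 0) = 1 := by
      rw [ringInner, e2]
      exact hcount _ (by positivity) (div_le_self hr.le h1t.le)
    have hgood : GoodRing δ c₀ tu l m (ringInner δ tl k m j 0) (ringOuter δ k m j 0) := by
      refine ⟨?_, ?_, ?_⟩
      · rw [e1]; simpa using hlt
      · rw [e2, hcount _ hr le_rfl]
        push_cast
        nlinarith
      · rw [e1, e2, hcount _ hr le_rfl]
        simp
    refine le_trans ?_ (Finset.single_le_sum (f := fun j => ∑ i ∈ Finset.range k,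
      if GoodRing δ c₀ tu l m (ringInner δ tl k m j i) (ringOuter δ k m j i) then 1 else 0)
      (fun _ _ => Nat.zero_le _) hj.2)
    refine le_trans ?_ (Finset.single_le_sum (f := fun i =>
      if GoodRing δ c₀ tu l m (ringInner δ tl k m j i) (ringOuter δ k m j i) then 1 else 0)
      (fun _ _ => Nat.zero_le _) (Finset.mem_range.2 (show 0 < k by omega)))
    rw [if_pos hgood]
  have hG : k ≤ goodTriples δ c₀ tl tu l := by
    calc k = l.toFinset.card • 1 := by rw [hcard, smul_eq_mul, mul_one]
      _ ≤ _ := Finset.card_nsmul_le_sum _ _ _ key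
  calc k ^ 3 = k ^ 2 * k := by ring
    _ ≤ c₀ ^ 2 * k := by gcongr
    _ ≤ _ := by gcongr

theorem le_goodTriples {l : List (Fin n)} {tl tu : ℝ} (hX : X.IsPremetric μ)
    (hcov : X.IsCovering (9 * (μ + 1)) N) (hp : IsPointSet X p) (hN : 0 < N) (hl : l.Nodup)
    (hlen : 2 ≤ l.length) (htl : 1 / 2 ≤ tl) (htu : tu ≤ 4 * tl) :
    l.length ^ 3 ≤ 20736 * N ^ 2 * goodTriples (pairDist X p) (72 * N) tl tu l := by
  rcases le_or_gt (72 * N) l.length with h | h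
  · exact goodTriples_large hX hcov hp hN hl h htl htu
  · refine (goodTriples_small (δ := pairDist X p) (tl := tl) (tu := tu) (fun m => hX.self _ (hp.2 m))
      (fun m q hmq => hX.pos _ (hp.2 m) _ (hp.2 q) (hp.1.ne hmq)) (by omega) hl hlen h
      (by linarith)).trans ?_
    refine Nat.mul_le_mul_right _ ?_
    rw [mul_pow]
    exact Nat.mul_le_mul_right _ (by norm_num)

end

theorem IsRingSeparator.mono {n : ℕ} {δ : Fin n → Fin n → ℝ} {c c' τ : ℝ} {Q : Finset (Fin n)}
    {m : Fin n} {r₁ r₂ : ℝ} (h : IsRingSeparator δ c τ Q m r₁ r₂) (hc : 0 < c) (hcc : c ≤ c') :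
    IsRingSeparator δ c' τ Q m r₁ r₂ := by
  have h1 : (Q.card : ℝ) / c' ≤ Q.card / c := by gcongr
  have h2 : (1 - 1 / c) * (Q.card : ℝ) ≤ (1 - 1 / c') * Q.card := by
    gcongr
  exact ⟨h.center_mem, h1.trans_lt h.inner_lower, h.inner_upper.trans_le h2,
    h1.trans_lt h.outer_lower, h.outer_upper.trans_le h2, h.thickness, h.few_repeated⟩

/-! ### The program for ring separators -/

namespace RealRAM

variable {B n : ℕ}

/-- Loads the array and the parameters of the search for a `1/t`-ring separator. -/
def sepSetup (c₀ : ℕ) : Cmd :=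
  block [copyN 1 0, .natConst 60 1, .realOfNat 20 60, .realDiv 21 20 0, .realAdd 20 20 21,
    copyR 21 0, .natConst 60 c₀, .realOfNat 22 60, fill]

def sepProgram (c₀ : ℕ) : Cmd :=
  .seq (sepSetup c₀) (.seq findSep (block [copyN 0 5, copyR 0 30, copyR 1 31]))

theorem wp_sepSetup {E : ℕ → ℕ → ℝ} {c₀ : ℕ} {t : ℝ} (hB : 8 * n + 100 + c₀ ≤ B) :
    wp E B (sepSetup c₀) (fun k s => k ≤ 100 * (n + 1) ∧ SepInput c₀ t t (List.finRange n) s)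
      (initial n t) := by
  have h0 : (initial n t).N 0 = n := by simp [initial]
  have h15 : (initial n t).N 15 = 0 := by simp [initial]
  have hR0 : (initial n t).R 0 = t := by simp [initial]
  generalize initial n t = s at h0 h15 hR0
  rw [sepSetup, block, wp_seq]
  refine wp_copyN (by norm_num) (by omega) fun s1 hs1 h1 => ?_
  simp only [block]
  rw [wp_seq]
  refine ⟨by omega, ?_⟩
  simp only [wp]
  refine wp_copyR (by norm_num) fun s2 hs2 h2 => ⟨by omega, ?_⟩
  refine wp_fill (n := n) (by omega) ?_ fun s3 harr h6 hN hR k hk => ⟨by omega, ?_, ?_, harr, ?_, ?_, ?_⟩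
  · simp [hs2.1 1 not_false, h1, h0]
  · rw [hN 15 (by omega) (by norm_num) (by norm_num) (by norm_num) (by norm_num)]
    simp [hs2.1 15 not_false, hs1.1 15 (by norm_num), h15]
  · rw [h6, List.length_finRange]
  · rw [hR]
    simp [hs2.2 20 (by norm_num), hs1.2 0 not_false, hR0]
  · rw [hR]
    simp [h2, hs1.2 0 not_false, hR0]
  · rw [hR]; simp

theorem ert_sepProgram_le {δ : Fin n → Fin n → ℝ} {c₀ p : ℕ} {t : ℝ} {τ F : ENNReal}
    {f : State → ENNReal} (hB : 8 * n + 100 + c₀ ≤ B) (hn : 0 < n) (hδ : ∀ i j, 0 ≤ δ i j)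
    (ht : 0 < t) (hp : n ^ 3 ≤ p * goodTriples δ c₀ t t (List.finRange n))
    (hf : ∀ s, (∃ m : Fin n, s.N 0 = (m : ℕ) ∧
      IsRingSeparator δ c₀ (1 / t) Finset.univ m (s.R 0) (s.R 1)) → f s ≤ F) :
    ert (oracle δ) B τ (sepProgram c₀) f (initial n t)
      ≤ τ * (((p * 400 + 200) * (n + 1) : ℕ) : ENNReal) + F := by
  have hlen : (List.finRange n).length = n := List.length_finRange
  have key : ert (oracle δ) B τ (sepSetup c₀) (ert (oracle δ) B τ
      (.seq findSep (block [copyN 0 5, copyR 0 30, copyR 1 31])) f) (initial n t)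
      ≤ τ * ((100 * (n + 1) + (1 + (p * 400 * (n + 1) + 13)) : ℕ) : ENNReal) + F := by
    refine ert_le_of_wp (wp_sepSetup hB) ?_
    rintro k s ⟨hk, hs⟩
    have h1 := ert_findSep_le (B := B) (τ := τ) (δ := δ) (p := p) (ε := 1 / t)
      (f := ert (oracle δ) B τ (block [copyN 0 5, copyR 0 30, copyR 1 31]) f)
      (F := τ * ((13 : ℕ) : ENNReal) + F) (by omega) hs (List.nodup_finRange n) (by omega) hδ ht ht
      le_rfl le_rfl (by rwa [hlen]) (by
        rintro s1 - ⟨m, -, hm, hsep⟩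
        refine ert_le_of_wp (Q := fun k s => k = 13 ∧ ∃ m : Fin n, s.N 0 = (m : ℕ) ∧
          IsRingSeparator δ c₀ (1 / t) Finset.univ m (s.R 0) (s.R 1)) ?_ ?_
        · rw [block, wp_seq]
          refine wp_copyN (by norm_num) (by omega) fun s2 hs2 h2 => ?_
          rw [block, wp_seq]
          refine wp_copyR (by norm_num) fun s3 hs3 h3 => ?_
          rw [block, wp_seq]
          refine wp_copyR (by norm_num) fun s4 hs4 h4 => ?_
          refine ⟨rfl, m, ?_, ?_⟩
          · rw [hs4.1 0 not_false, hs3.1 0 not_false, h2, hm]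
          · rw [h4, hs4.2 0 (by norm_num), h3, hs3.2 31 (by norm_num), hs2.2 31 not_false,
              hs2.2 30 not_false]
            have : (List.finRange n).toFinset = Finset.univ := by ext; simp
            rwa [this] at hsep
        · rintro k s2 ⟨rfl, hs2⟩
          gcongr
          exact hf _ hs2)
    rw [hlen] at h1
    calc _ ≤ τ * ((100 * (n + 1) : ℕ) : ENNReal) + (τ + (τ * ((p * 400 * (n + 1) : ℕ) : ENNReal)
          + (τ * ((13 : ℕ) : ENNReal) + F))) := by
          gcongr
          rw [ert]
          gcongr
      _ = _ := by push_cast; ring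
  rw [sepProgram, ert]
  calc _ ≤ τ + (τ * ((100 * (n + 1) + (1 + (p * 400 * (n + 1) + 13)) : ℕ) : ENNReal) + F) := by
        gcongr
    _ = τ * ((100 * (n + 1) + (1 + (p * 400 * (n + 1) + 13)) + 1 : ℕ) : ENNReal) + F := by
        push_cast; ring
    _ ≤ _ := cost_mono (Nat.cast_le.2 (by rw [add_mul]; omega)) le_rfl

end RealRAM

open RealRAM in
-- The parameter `t` is part of the input, so both estimates `tl` and `tu` are `t` itself.
theorem computesRingSeparators {d N : ℕ} {μ c C : ℝ} {F : Set (DistanceMeasure d)}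
    (hF : ∀ X ∈ F, X.IsPremetric μ ∧ X.IsCovering (9 * (μ + 1)) N) (hN : 0 < N)
    (hc : 72 * N ≤ c) (hC : 20000000 * (N : ℝ) ^ 2 ≤ C) : ComputesRingSeparators F c C := by
  refine ⟨sepProgram (72 * N), fun X hXF n p hp t ht htn => ?_⟩
  obtain ⟨hX, hcov⟩ := hF X hXF
  have hn1 : (1 : ℝ) < n := ht.trans htn
  have hn : 1 < n := by exact_mod_cast hn1
  have hNr : (1 : ℝ) ≤ N := by exact_mod_cast hN
  have hNN : (N : ℝ) ≤ (N : ℝ) ^ 2 := by nlinarith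
  set δ := pairDist X p with hδ
  have hlen : (List.finRange n).length = n := List.length_finRange
  have hinit : ∀ i, (initial n t).N i ≤ 8 * n + 100 + 72 * N := by
    intro i
    simp only [initial, Function.update_apply]
    split_ifs <;> omega
  have hgood := le_goodTriples hX hcov hp hN (List.nodup_finRange n) (by omega)
    (show 1 / 2 ≤ t by linarith) (show t ≤ 4 * t by linarith)
  rw [hlen] at hgood
  have htime := ert_sepProgram_le (B := 8 * n + 100 + 72 * N) (τ := 1) (F := 0)
    (f := guarantee fun s => ∃ m : Fin n, s.N 0 = (m : ℕ) ∧
      IsRingSeparator δ c (1 / t) Finset.univ m (s.R 0) (s.R 1)) le_rfl (by omega)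
    (fun i j => hX.nonneg (hp.2 i) (hp.2 j)) (by linarith) hgood (by
      rintro s ⟨m, hm, hsep⟩
      refine guarantee_le ⟨m, hm, hsep.mono (by positivity) ?_⟩ _
      push_cast
      exact hc)
  rw [one_mul, add_zero] at htime
  have hne := ne_top_of_le_ne_top (ENNReal.natCast_ne_top _) htime
  refine ⟨(expectedTime_le hinit _).trans (htime.trans ?_), memoryBounded_of_ert hinit hne ?_,
    haltsOnlyWith_of_ert hinit hne⟩
  · rw [← ENNReal.ofReal_natCast]
    apply ENNReal.ofReal_le_ofReal
    push_cast
    calc (20736 * (N : ℝ) ^ 2 * 400 + 200) * (n + 1) ≤ (20736 * (N : ℝ) ^ 2 * 400 + 200 * N ^ 2)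
          * (2 * n) := by gcongr <;> nlinarith
      _ ≤ 20000000 * (N : ℝ) ^ 2 * n := by nlinarith [show (0 : ℝ) ≤ (N : ℝ) ^ 2 * n by positivity]
      _ ≤ _ := by gcongr
  · push_cast
    calc (8 * (n : ℝ) + 100 + 72 * N) ≤ 20000000 * (N : ℝ) ^ 2 * n := by nlinarith
      _ ≤ _ := by gcongr

namespace RealRAM

/-! ### A stack of point sets -/

variable {E : ℕ → ℕ → ℝ} {B n : ℕ}

/-- The stack holds the list, with its head on top. -/
def Stk : List ℕ → State → Prop
  | [], _ => True
  | x :: L, s => s.N (8 * L.length + 68) = x ∧ Stk L s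

theorem Stk.congr {L : List ℕ} {s s' : State} (h : Stk L s)
    (h' : ∀ k < L.length, s'.N (8 * k + 68) = s.N (8 * k + 68)) : Stk L s' := by
  induction L with
  | nil => trivial
  | cons x L ih =>
    refine ⟨?_, ih h.2 fun k hk => h' k (by simp; omega)⟩
    rw [h' _ (by simp)]
    exact h.1

/-- The cells that are used by the stack. -/
def StkReg (a : ℕ) : Prop := a = 7 ∨ a = 60 ∨ a = 61 ∨ (a % 8 = 4 ∧ 64 ≤ a)

def push (x : ℕ) : Cmd := .seq (store 68 7 x) (inc 7)

def pop (x : ℕ) : Cmd := .seq (.natConst 60 1) (.seq (.natSub 7 7 60) (load 68 x 7))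

theorem wp_push {x : ℕ} {L : List ℕ} {Q : ℕ → State → Prop} {s : State} (hx : x < 60)
    (hB : 8 * L.length + 68 ≤ B) (h7 : s.N 7 = L.length) (hS : Stk L s)
    (h : ∀ s', Agree StkReg (fun _ => False) s s' → s'.N 7 = L.length + 1 →
      Stk (s.N x :: L) s' → Q 17 s') : wp E B (push x) Q s := by
  rw [push, wp_seq]
  refine wp_store (by norm_num) hx (by omega) fun s1 hs1 h1 => ?_
  rw [h7] at hs1 h1
  have e7 : s1.N 7 = L.length := by rw [hs1.1 7 (by omega), h7]
  refine wp_inc (by norm_num) (by omega) fun s2 hs2 h2 => ?_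
  have e : ∀ k, s2.N (8 * k + 68) = s1.N (8 * k + 68) := fun k => hs2.1 _ (by omega)
  refine h s2 ⟨fun a ha => ?_, fun a _ => ?_⟩ (by rw [h2, e7]) ⟨by rw [e, h1], ?_⟩
  · unfold StkReg at ha
    rw [hs2.1 _ (by omega), hs1.1 _ (by omega)]
  · rw [hs2.2 _ not_false, hs1.2 _ not_false]
  · exact hS.congr fun k hk => by rw [e, hs1.1 _ (by omega)]

theorem wp_pop {x y : ℕ} {L : List ℕ} {Q : ℕ → State → Prop} {s : State} (hx : x < 60)
    (hx7 : x ≠ 7) (hB : 8 * L.length + 68 ≤ B) (h7 : s.N 7 = L.length + 1) (hS : Stk (y :: L) s)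
    (h : ∀ s', Agree (fun a => a = 7 ∨ a = x ∨ a = 60 ∨ a = 61) (fun _ => False) s s' →
      s'.N 7 = L.length → s'.N x = y → Stk L s' → Q 17 s') : wp E B (pop x) Q s := by
  rw [pop, wp_seq]
  refine ⟨by omega, ?_⟩
  beta_reduce
  rw [wp_seq, wp]
  have e7 : ((s.setN 60 1).setN 7 ((s.setN 60 1).N 7 - (s.setN 60 1).N 60)).N 7 = L.length := by
    simp [h7]
  refine wp_load (by norm_num) (by omega) (by norm_num) fun s1 hs1 h1 => ?_
  rw [e7] at h1
  refine h s1 ⟨fun a ha => ?_, fun a _ => ?_⟩ ?_ ?_ ?_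
  · simp only [not_or] at ha
    rw [hs1.1 _ (by tauto)]
    simp [ha]
  · rw [hs1.2 _ not_false]; rfl
  · rw [hs1.1 _ (by omega), e7]
  · rw [h1, ← hS.1]
    simp only [setN_N]
    rw [if_neg (by omega), if_neg (by omega)]
  · refine hS.2.congr fun k hk => ?_
    rw [hs1.1 _ (by omega)]
    simp only [setN_N]
    rw [if_neg (by omega), if_neg (by omega)]

/-- Pushes the points that are selected by the test, their number and the address `N[17]` of the
next free node. -/
def pushSel (b : Bool) : Cmd :=
  .seq (.natConst 12 0) (.seq (each (guarded b (.realLT 10 5) (.seq (push 11) (inc 12))))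
    (block [push 12, push 17, .natConst 60 8, .natAdd 17 17 60]))

/-- The last selected point ends up on top, whence the reversal. The length and the address come
above the points, so that an entry can be read off without knowing its size. -/
theorem wp_pushSel {δ : Fin n → Fin n → ℝ} {b : Bool} {Q : ℕ → State → Prop} {s : State}
    {L : List ℕ} (l : List (Fin n)) (m : Fin n) (v : ℝ) (sel : Fin n → Bool)
    (ht : ∀ q, δ m q < v ↔ sel q = b) (hB : 8 * l.length + 69 ≤ B)
    (hB' : 8 * ((l.filter sel).length + 2 + L.length) + 68 ≤ B) (hB17 : s.N 17 + 8 ≤ B)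
    (h5 : s.N 5 = m) (h6 : s.N 6 = l.length) (hl : Arr 69 0 l s) (hv : s.R 5 = v)
    (h7 : s.N 7 = L.length) (hS : Stk L s)
    (h : ∀ s', Agree (fun a => a = 12 ∨ a = 17 ∨ EachReg a ∨ StkReg a) (fun a => a = 10) s s' →
      s'.N 7 = (l.filter sel).length + 2 + L.length → s'.N 17 = s.N 17 + 8 →
      Stk (s.N 17 :: (l.filter sel).length :: ((l.filter sel).reverse.map Fin.val ++ L)) s' →
      ∀ k ≤ 150 * (l.length + 1), Q k s') :
    wp (oracle δ) B (pushSel b) Q s := by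
  rw [pushSel, wp_seq]
  refine ⟨Nat.zero_le _, ?_⟩
  beta_reduce
  rw [wp_seq]
  have hpre : ∀ i, ((l.take i).filter sel).length ≤ (l.filter sel).length := fun i =>
    (List.Sublist.filter _ (List.take_sublist i l)).length_le
  refine wp_each l m 30 (fun i s' => s'.N 12 = ((l.take i).filter sel).length ∧
    s'.N 7 = ((l.take i).filter sel).length + L.length ∧
    Stk (((l.take i).filter sel).reverse.map Fin.val ++ L) s' ∧
    Agree (fun a => a = 12 ∨ EachReg a ∨ StkReg a) (fun a => a = 10) s s') hB ?_ ?_ ?_ ?_ ?_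
  · rintro i s' ⟨-, -, -, hs'⟩
    refine ⟨by rw [hs'.1 6 (by norm_num [EachReg, StkReg]), h6],
      by rw [hs'.1 5 (by norm_num [EachReg, StkReg]), h5], fun hi => ?_⟩
    rw [hs'.1 _ (by simp only [EachReg, StkReg]; omega), ← hl i hi, zero_add]
  · rintro i s1 s2 ⟨h1, h2, h3, h4⟩ h'
    refine ⟨by rw [h'.1 12 (by norm_num [EachReg]), h1],
      by rw [h'.1 7 (by norm_num [EachReg]), h2],
      h3.congr fun k _ => h'.1 _ (by simp only [EachReg]; omega),
      h4.trans h' (fun _ => id) (fun _ h => Or.inr (Or.inl h)) (fun _ => id) (fun _ => id)⟩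
  · rintro i hi s1 ⟨h1, h2, h3, h4⟩ h10 h11 hR
    have hle := hpre i
    have hle' := hpre (i + 1)
    refine wp_guarded (p := sel l[i]) ?_ (fun hsel => ?_) (fun hsel => ?_)
    · rw [Test.holds, hR, h4.2 5 (by norm_num), hv, ht]
    · have e : (l.take (i + 1)).filter sel = (l.take i).filter sel ++ [l[i]] := by
        rw [filter_take_succ _ _ _ hi]; simp [hsel]
      rw [e, List.length_append, List.length_singleton] at hle'
      rw [wp_seq]
      refine wp_push (L := ((l.take i).filter sel).reverse.map Fin.val ++ L) (by norm_num)
        (by simp; omega) (by simp [h2]) h3 fun s2 hs2 h27 hS2 => ?_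
      have e12 : s2.N 12 = ((l.take i).filter sel).length := by
        rw [hs2.1 12 (by norm_num [StkReg]), h1]
      refine wp_inc (by norm_num) (by omega) fun s3 hs3 h12 => ⟨by norm_num, ?_, ?_, ?_, ?_, ?_⟩
      · rw [hs3.1 10 (by norm_num), hs2.1 10 (by norm_num [StkReg]), h10]
      · rw [h12, e12, e]; simp
      · rw [hs3.1 7 (by norm_num), h27, e]
        simp; ring
      · rw [e]
        rw [h11] at hS2
        simp only [List.reverse_append, List.reverse_cons, List.reverse_nil, List.nil_append,
          List.map_cons, List.cons_append]
        exact hS2.congr fun k _ => hs3.1 _ (by omega)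
      · refine (h4.trans (A₂ := fun a => a = 12 ∨ EachReg a ∨ StkReg a) (A₂' := fun a => a = 10) hs2
          (fun _ => id) (fun _ h => Or.inr (Or.inr h)) (fun _ => id)
          (fun _ h => h.elim)).trans hs3 (fun _ => id) (fun a h => ?_) (fun _ => id)
          (fun _ h => h.elim)
        simp only [EachReg, StkReg]; omega
    · have e : (l.take (i + 1)).filter sel = (l.take i).filter sel := by
        rw [filter_take_succ _ _ _ hi]; simp [hsel]
      exact ⟨by norm_num, h10, by rw [e, h1], by rw [e, h2], by rw [e]; exact h3, h4⟩
  · refine ⟨by simp, by simp [h7], ?_, fun a ha => ?_, fun _ _ => rfl⟩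
    · simp only [List.take_zero, List.filter_nil, List.reverse_nil, List.map_nil, List.nil_append]
      exact hS.congr fun k _ => by simp only [setN_N]; rw [if_neg (by omega)]
    · simp only [not_or] at ha
      simp [ha]
  · rintro s1 ⟨h1, h2, h3, h4⟩ k hk
    rw [List.take_length] at h1 h2 h3
    rw [block, wp_seq]
    refine wp_push (L := (l.filter sel).reverse.map Fin.val ++ L) (by norm_num)
      (by simp; omega) (by simp [h2]) h3 fun s2 hs2 h27 hS2 => ?_
    rw [h1] at hS2
    rw [block, wp_seq]
    have e17 : s2.N 17 = s.N 17 := by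
      rw [hs2.1 17 (by norm_num [StkReg]), h4.1 17 (by norm_num [StkReg, EachReg])]
    refine wp_push (L := (l.filter sel).length :: ((l.filter sel).reverse.map Fin.val ++ L))
      (by norm_num) (by simp; omega) (by simp [h27]) hS2 fun s3 hs3 h37 hS3 => ?_
    rw [e17] at hS3
    have e17' : s3.N 17 = s.N 17 := by rw [hs3.1 17 (by norm_num [StkReg]), e17]
    simp only [block, wp]
    refine ⟨by omega, by simp; omega, h _ ⟨fun a ha => ?_, fun a ha => ?_⟩ ?_ ?_ ?_ _ (by omega)⟩
    · simp only [not_or] at ha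
      obtain ⟨ha12, ha17, haE, haS⟩ := ha
      have h60 : a ≠ 60 := by unfold EachReg at haE; omega
      simp only [setN_N, if_neg h60, if_neg ha17]
      rw [hs3.1 _ haS, hs2.1 _ haS, h4.1 _ (by tauto)]
    · simp only [setN_R]
      rw [hs3.2 _ not_false, hs2.2 _ not_false, h4.2 _ ha]
    · simp [h37]; ring
    · simp [e17']
    · exact hS3.congr fun k _ => by
        simp only [setN_N]
        rw [if_neg (by omega), if_neg (by omega)]

/-- Moves the topmost point set of the stack to the array, and its address to `N[18]`. -/
def popEntry : Cmd :=
  block [pop 18, pop 6, .natConst 10 0,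
    .loop (.natLT 10 6) (.seq (pop 11) (.seq (store 69 10 11) (inc 10)))]

/-- The cells that are used by `popEntry`. -/
def PopReg (a : ℕ) : Prop :=
  a = 6 ∨ a = 7 ∨ a = 18 ∨ EachReg a ∨ (a % 8 = 5 ∧ 64 ≤ a)

theorem wp_popEntry {Q : ℕ → State → Prop} {s : State} {L : List ℕ} (l : List (Fin n)) (a : ℕ)
    (hB : 8 * (l.length + 2 + L.length) + 69 ≤ B) (h7 : s.N 7 = l.length + 2 + L.length)
    (hS : Stk (a :: l.length :: (l.map Fin.val ++ L)) s)
    (h : ∀ s', Agree PopReg (fun _ => False) s s' → s'.N 6 = l.length → s'.N 18 = a →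
      s'.N 7 = L.length → Stk L s' → Arr 69 0 l s' → ∀ k ≤ 80 * (l.length + 1), Q k s') :
    wp E B popEntry Q s := by
  rw [popEntry, block, wp_seq]
  refine wp_pop (L := l.length :: (l.map Fin.val ++ L)) (by norm_num) (by norm_num)
    (by simp; omega) (by simp; omega) hS fun s1 hs1 h17 h18 hS1 => ?_
  rw [block, wp_seq]
  refine wp_pop (L := l.map Fin.val ++ L) (by norm_num) (by norm_num)
    (by simp; omega) (by simpa using h17) hS1 fun s2 hs2 h27 h26 hS2 => ?_
  rw [block, wp_seq]
  refine ⟨Nat.zero_le _, ?_⟩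
  simp only [block]
  rw [wp_seq]
  have e18 : s2.N 18 = a := by rw [hs2.1 18 (by norm_num), h18]
  refine wp_loop (fun i s' => s'.N 10 = i ∧ s'.N 6 = l.length ∧ s'.N 18 = a ∧
    s'.N 7 = (l.drop i).length + L.length ∧ Stk ((l.drop i).map Fin.val ++ L) s' ∧
    (∀ j < i, ∀ h : j < l.length, s'.N (8 * j + 69) = (l[j] : ℕ)) ∧
    Agree PopReg (fun _ => False) s s') l.length 40 ?_ ?_ ?_
  · refine ⟨by simp, by simp [h26], by simp [e18], by simpa using h27, ?_, by simp, ?_, ?_⟩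
    · simp only [List.drop_zero]
      exact hS2.congr fun k _ => by simp only [setN_N]; rw [if_neg (by omega)]
    · intro b hb
      simp only [PopReg, EachReg] at hb
      simp only [setN_N]
      rw [if_neg (by omega), hs2.1 _ (by omega), hs1.1 _ (by omega)]
    · intro b hb
      simp only [setN_R]
      rw [hs2.2 _ hb, hs1.2 _ hb]
  · rintro i hi s3 ⟨h10, h6, h18', h7', hS', hj, hA⟩
    refine ⟨by simp [Test.holds, h10, h6, hi], ?_⟩
    rw [List.drop_eq_getElem_cons hi, List.map_cons, List.cons_append] at hS'
    rw [List.length_drop] at h7'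
    rw [wp_seq]
    refine wp_pop (L := (l.drop (i + 1)).map Fin.val ++ L) (by norm_num) (by norm_num)
      (by simp; omega) (by simp; omega) hS' fun s4 hs4 h47 h411 hS4 => ?_
    have e10 : s4.N 10 = i := by rw [hs4.1 10 (by norm_num), h10]
    rw [wp_seq]
    refine wp_store (by norm_num) (by norm_num) (by omega) fun s5 hs5 hst => ?_
    rw [e10] at hs5 hst
    have e10' : s5.N 10 = i := by rw [hs5.1 10 (by omega), e10]
    refine wp_inc (by norm_num) (by omega) fun s6 hs6 h10' => ?_
    refine ⟨by norm_num, by omega, ?_, ?_, ?_, ?_, ?_, ?_, ?_⟩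
    · rw [hs6.1 6 (by norm_num), hs5.1 6 (by omega), hs4.1 6 (by norm_num), h6]
    · rw [hs6.1 18 (by norm_num), hs5.1 18 (by omega), hs4.1 18 (by norm_num), h18']
    · rw [hs6.1 7 (by norm_num), hs5.1 7 (by omega), h47]; simp
    · exact hS4.congr fun k _ => by rw [hs6.1 _ (by omega), hs5.1 _ (by omega)]
    · intro j hji hjl
      rw [hs6.1 _ (by omega)]
      rcases Nat.lt_succ_iff_lt_or_eq.1 hji with h | rfl
      · rw [hs5.1 _ (by omega), hs4.1 _ (by omega), hj j h hjl]
      · rw [hst, h411]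
    · intro b hb
      have hb' := hb
      simp only [PopReg, EachReg] at hb'
      rw [hs6.1 _ (by omega), hs5.1 _ (by omega), hs4.1 _ (by omega), hA.1 _ hb]
    · intro b hb
      rw [hs6.2 _ hb, hs5.2 _ hb, hs4.2 _ hb, hA.2 _ hb]
  · rintro s3 ⟨h10, h6, h18', h7', hS', hj, hA⟩
    refine ⟨by simp [Test.holds, h10, h6], fun k hk => ?_⟩
    simp only [wp]
    refine h s3 hA h6 h18' (by simpa using h7') (by simpa using hS') (fun i hi => ?_) _ (by omega)
    rw [zero_add, hj i hi hi]

end RealRAM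

namespace RealRAM

/-! ### Construction of ring trees -/

variable {E : ℕ → ℕ → ℝ} {B n : ℕ}

/-- The point sets that wait to be split, with the addresses of their nodes, as stored on the
stack. -/
def stackList : List (List (Fin n) × ℕ) → List ℕ
  | [] => []
  | e :: es => e.2 :: e.1.length :: (e.1.map Fin.val ++ stackList es)

/-- The states have the same contents of the node with address `a`. -/
def SameNode (a : ℕ) (s s' : State) : Prop :=
  (∀ i < 4, s'.N (a + i) = s.N (a + i)) ∧ ∀ i < 2, s'.R (a + i) = s.R (a + i)

/-- The parameters of the construction of a tree with `M` nodes so far. -/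
structure TreeRegs (c₀ : ℕ) (tl tu : ℝ) (M : ℕ) (s : State) : Prop where
  zero : s.N 15 = 0
  two : s.N 19 = 2
  free : s.N 17 = 8 * M + 64
  factor : s.R 20 = 1 + 1 / tl
  upper : s.R 21 = tu
  balance : s.R 22 = c₀

/-- The tree has `M` nodes, and it remains to build subtrees for the point sets in `es`. -/
structure TreePart (δ : Fin n → Fin n → ℝ) (c₀ : ℕ) (ε : ℝ) (es : List (List (Fin n) × ℕ)) (M : ℕ)
    (s : State) : Prop where
  nodup : (es.map Prod.snd).Nodup
  addr : ∀ e ∈ es, ∃ k < M, e.2 = 8 * k + 64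
  lists : ∀ e ∈ es, e.1.Nodup ∧ 1 ≤ e.1.length
  -- A partial tree is described by what it can become: any state that keeps the finished nodes and
  -- holds correct subtrees at the pending addresses holds a correct tree. Unfinished trees need no
  -- representation of their own.
  complete : ∀ s', (∀ k < M, 8 * k + 64 ∉ es.map Prod.snd → SameNode (8 * k + 64) s s') →
    (∀ e ∈ es, ∃ T : RingTree n, Stores s' e.2 T ∧ T.IsRingTreeFor δ c₀ ε e.1.toFinset) →
    ∃ T : RingTree n, Stores s' 64 T ∧ T.IsRingTreeFor δ c₀ ε Finset.univ

theorem SameNode.trans {a : ℕ} {s s' s'' : State} (h : SameNode a s s') (h' : SameNode a s' s'') :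
    SameNode a s s'' :=
  ⟨fun i hi => (h'.1 i hi).trans (h.1 i hi), fun i hi => (h'.2 i hi).trans (h.2 i hi)⟩

variable {δ : Fin n → Fin n → ℝ} {c₀ M : ℕ} {ε tl tu : ℝ} {es : List (List (Fin n) × ℕ)}
  {s s' : State}

theorem TreePart.congr (h : TreePart δ c₀ ε es M s)
    (h' : ∀ k < M, 8 * k + 64 ∉ es.map Prod.snd → SameNode (8 * k + 64) s s') :
    TreePart δ c₀ ε es M s' :=
  ⟨h.nodup, h.addr, h.lists, fun s'' h1 h2 =>
    h.complete s'' (fun k hk hk' => (h' k hk hk').trans (h1 k hk hk')) h2⟩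

/-- The node at `a` is no longer pending, so every later state keeps it and the hypothesis about
pending entries is met there by the leaf. -/
theorem TreePart.leaf {j : Fin n} {a : ℕ} (h : TreePart δ c₀ ε (([j], a) :: es) M s)
    (ha : s'.N a = 0) (ha' : s'.N (a + 1) = j)
    (hs : ∀ k < M, 8 * k + 64 ≠ a → SameNode (8 * k + 64) s s') : TreePart δ c₀ ε es M s' := by
  have hnd := h.nodup
  rw [List.map_cons, List.nodup_cons] at hnd
  refine ⟨hnd.2, fun e he => h.addr e (List.mem_cons_of_mem _ he),
    fun e he => h.lists e (List.mem_cons_of_mem _ he), fun s'' h1 h2 => h.complete s'' ?_ ?_⟩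
  · intro k hk hk'
    rw [List.map_cons, List.mem_cons, not_or] at hk'
    exact (hs k hk hk'.1).trans (h1 k hk hk'.2)
  · intro e he
    rcases List.mem_cons.1 he with rfl | he
    · obtain ⟨k, hk, hka⟩ := h.addr _ List.mem_cons_self
      simp only at hka
      have := h1 k hk (hka ▸ hnd.1)
      rw [← hka] at this
      refine ⟨.leaf j, ⟨?_, ?_⟩, by simp [RingTree.IsRingTreeFor]⟩
      · exact (this.1 0 (by norm_num)).trans ha
      · exact (this.1 1 (by norm_num)).trans ha'
    · exact h2 e he

/-- The pending node is traded for two pending children at fresh addresses. Later states keep the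
new node, so subtrees for the children combine to one for `a`. Both children are nonempty because
the separator is balanced. -/
theorem TreePart.node {l l₁ l₂ : List (Fin n)} {a : ℕ} {m : Fin n} {r₁ r₂ : ℝ}
    (h : TreePart δ c₀ ε ((l, a) :: es) M s)
    (hsep : IsRingSeparator δ c₀ ε l.toFinset m r₁ r₂)
    (hl₁ : l₁.toFinset = pointsInBall δ l.toFinset m r₂)
    (hl₂ : l₂.toFinset = l.toFinset \ pointsInBall δ l.toFinset m r₁)
    (hn₁ : l₁.Nodup) (hn₂ : l₂.Nodup)
    (h0 : s'.N a = 1) (h1 : s'.N (a + 1) = m) (h2 : s'.N (a + 2) = 8 * M + 64)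
    (h3 : s'.N (a + 3) = 8 * M + 72) (hR : s'.R a = r₁) (hR' : s'.R (a + 1) = r₂)
    (hs : ∀ k < M, 8 * k + 64 ≠ a → SameNode (8 * k + 64) s s') :
    TreePart δ c₀ ε ((l₂, 8 * M + 72) :: (l₁, 8 * M + 64) :: es) (M + 2) s' := by
  have hnd := h.nodup
  rw [List.map_cons, List.nodup_cons] at hnd
  have haddr : ∀ b ∈ es.map Prod.snd, ∃ k < M, b = 8 * k + 64 := by
    intro b hb
    obtain ⟨e, he, rfl⟩ := List.mem_map.1 hb
    exact h.addr e (List.mem_cons_of_mem _ he)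
  obtain ⟨k₀, hk₀, hka⟩ := h.addr _ List.mem_cons_self
  simp only at hka
  have hcard : (0 : ℝ) ≤ (l.toFinset.card : ℝ) / c₀ := by positivity
  refine ⟨?_, ?_, ?_, fun s'' g1 g2 => h.complete s'' ?_ ?_⟩
  · simp only [List.map_cons, List.nodup_cons, List.mem_cons, not_or]
    refine ⟨⟨by omega, fun hb => ?_⟩, fun hb => ?_, hnd.2⟩
    · obtain ⟨k, hk, e⟩ := haddr _ hb; omega
    · obtain ⟨k, hk, e⟩ := haddr _ hb; omega
  · intro e he
    simp only [List.mem_cons] at he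
    rcases he with rfl | rfl | he
    · exact ⟨M + 1, by omega, by simp; ring⟩
    · exact ⟨M, by omega, rfl⟩
    · obtain ⟨k, hk, e⟩ := h.addr e (List.mem_cons_of_mem _ he)
      exact ⟨k, by omega, e⟩
  · intro e he
    simp only [List.mem_cons] at he
    rcases he with rfl | rfl | he
    · refine ⟨hn₂, ?_⟩
      simp only
      rw [← List.toFinset_card_of_nodup hn₂, hl₂, Nat.one_le_iff_ne_zero]
      intro h0
      have hsub := Finset.sdiff_eq_empty_iff_subset.1 (Finset.card_eq_zero.1 h0)
      have hle : (l.toFinset.card : ℝ) ≤ (pointsInBall δ l.toFinset m r₁).card := by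
        exact_mod_cast Finset.card_le_card hsub
      have := hsep.inner_upper
      have e : (1 - 1 / (c₀ : ℝ)) * l.toFinset.card = l.toFinset.card - l.toFinset.card / c₀ := by
        ring
      linarith
    · refine ⟨hn₁, ?_⟩
      simp only
      rw [← List.toFinset_card_of_nodup hn₁, hl₁, Nat.one_le_iff_ne_zero]
      intro h0
      have := hsep.outer_lower
      rw [h0] at this
      simp at this
      linarith
    · exact h.lists e (List.mem_cons_of_mem _ he)
  · intro k hk hk'
    rw [List.map_cons, List.mem_cons, not_or] at hk'
    refine (hs k hk hk'.1).trans (g1 k (by omega) ?_)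
    simp only [List.map_cons, List.mem_cons, not_or]
    exact ⟨by omega, by omega, hk'.2⟩
  · intro e he
    rcases List.mem_cons.1 he with rfl | he
    · obtain ⟨T₁, hT₁, hT₁'⟩ := g2 (l₁, 8 * M + 64) (by simp)
      obtain ⟨T₂, hT₂, hT₂'⟩ := g2 (l₂, 8 * M + 72) (by simp)
      have := g1 k₀ (by omega) (by
        simp only [List.map_cons, List.mem_cons, not_or]
        exact ⟨by omega, by omega, hka ▸ hnd.1⟩)
      rw [← hka] at this
      have e0 := (this.1 0 (by norm_num)).trans h0
      have e1 := (this.1 1 (by norm_num)).trans h1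
      have e2 := (this.1 2 (by norm_num)).trans h2
      have e3 := (this.1 3 (by norm_num)).trans h3
      have e4 := (this.2 0 (by norm_num)).trans hR
      have e5 := (this.2 1 (by norm_num)).trans hR'
      simp only at hT₁ hT₂ hT₁' hT₂'
      refine ⟨.node m r₁ r₂ T₁ T₂, ⟨e0, e1, e4, e5, ?_, ?_⟩, hsep, ?_, ?_⟩
      · simp only; rw [e2]; exact hT₁
      · simp only; rw [e3]; exact hT₂
      · rw [← hl₁]; exact hT₁'
      · rw [← hl₂]; exact hT₂'
    · exact g2 e (by simp [he])

/-- Writes a leaf at the address `N[18]`. -/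
def writeLeaf : Cmd :=
  block [.natStore 18 15, load 69 11 15, .natConst 60 1, .natAdd 61 18 60, .natStore 61 11]

/-- Writes an inner node at the address `N[18]`. -/
def writeNode : Cmd :=
  block [.natConst 60 1, .natStore 18 60, .natAdd 61 18 60, .natStore 61 5, .realStore 18 30,
    .realStore 61 31, .natAdd 61 61 60, .natStore 61 17, .natAdd 61 61 60, .natConst 60 8,
    .natAdd 60 17 60, .natStore 61 60]

/-- The single point is read from the array cell `69` after the node cell `a` has been written,
which is why `a ≠ 69` is needed. -/
theorem wp_writeLeaf {Q : ℕ → State → Prop} {a j : ℕ} (hB : a + 100 ≤ B) (ha : 64 ≤ a)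
    (ha' : a ≠ 69) (h15 : s.N 15 = 0) (h18 : s.N 18 = a) (hj : s.N 69 = j)
    (h : ∀ s', Agree (fun b => b = 11 ∨ b = 60 ∨ b = 61 ∨ b = a ∨ b = a + 1) (fun _ => False) s s' →
      s'.N a = 0 → s'.N (a + 1) = j → ∀ k ≤ 30, Q k s') : wp E B writeLeaf Q s := by
  rw [writeLeaf, block, wp_seq, wp, block, wp_seq, h18]
  have e15 : (s.setN a (s.N 15)).N 15 = 0 := by
    simp only [setN_N]; rw [if_neg (by omega), h15]
  refine wp_load (by norm_num) (by omega) (by norm_num) fun s1 hs1 h1 => ?_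
  rw [e15] at h1
  simp only [setN_N] at h1
  rw [if_neg (by omega), hj] at h1
  have e : ∀ b, b ≠ 11 → b ≠ 60 → b ≠ 61 → b ≠ a → s1.N b = s.N b := fun b h11 h60 h61 hba => by
    rw [hs1.1 b (by tauto)]; simp [hba]
  have ea : s1.N a = 0 := by rw [hs1.1 a (by omega)]; simp [h15]
  have e18 : s1.N 18 = a := by rw [e 18 (by norm_num) (by norm_num) (by norm_num) (by omega), h18]
  simp only [block, wp]
  refine ⟨by omega, by simp [e18]; omega, h _ ⟨fun b hb => ?_, fun b hb => ?_⟩ ?_ ?_ _ (by norm_num)⟩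
  · simp only [not_or] at hb
    simp [e18, hb, e]
  · simp only [setN_R]; rw [hs1.2 _ hb, setN_R]
  · have h1 : a ≠ 60 := by omega
    have h2 : a ≠ 61 := by omega
    simp [e18, ea, h1, h2]
  · simp [e18, h1]

theorem wp_writeNode {Q : ℕ → State → Prop} {a : ℕ} (hB : a + 100 ≤ B) (ha : 64 ≤ a)
    (h17 : s.N 17 + 8 ≤ B) (h18 : s.N 18 = a)
    (h : ∀ s', Agree (fun b => b = 60 ∨ b = 61 ∨ (a ≤ b ∧ b < a + 4)) (fun b => b = a ∨ b = a + 1)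
      s s' → s'.N a = 1 → s'.N (a + 1) = s.N 5 → s'.N (a + 2) = s.N 17 → s'.N (a + 3) = s.N 17 + 8 →
      s'.R a = s.R 30 → s'.R (a + 1) = s.R 31 → ∀ k ≤ 30, Q k s') : wp E B writeNode Q s := by
  have b1 : a ≠ 60 := by omega
  have b2 : a ≠ 61 := by omega
  have b3 : a + 1 ≠ 60 := by omega
  have b4 : a + 1 ≠ 61 := by omega
  have b5 : a + 2 ≠ 60 := by omega
  have b6 : a + 2 ≠ 61 := by omega
  have b7 : a + 3 ≠ 60 := by omega
  have b8 : a + 3 ≠ 61 := by omega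
  have b9 : 17 ≠ a := by omega
  have b10 : 17 ≠ a + 1 := by omega
  have b11 : 17 ≠ a + 2 := by omega
  have b12 : 5 ≠ a := by omega
  have b13 : 60 ≠ a := by omega
  have b14 : 60 ≠ a + 1 := by omega
  have b15 : 60 ≠ a + 2 := by omega
  have b16 : 18 ≠ a := by omega
  have b17 : 18 ≠ a + 1 := by omega
  have b19 : 61 ≠ a + 1 := by omega
  have b20 : 61 ≠ a + 2 := by omega
  have b21 : 31 ≠ a := by omega
  simp only [writeNode, block, wp]
  simp [h18, b9, b10, b11, b12, b13, b14, b15, b16, b17, b19, b20, b21, add_assoc]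
  refine ⟨by omega, by omega, by omega, by omega, by omega, by omega,
    h _ ⟨fun b hb => ?_, fun b hb => ?_⟩ ?_ ?_ ?_ ?_ ?_ ?_ _ (by norm_num)⟩
  · have c1 : b ≠ 60 := by omega
    have c2 : b ≠ 61 := by omega
    have c3 : b ≠ a := by omega
    have c4 : b ≠ a + 1 := by omega
    have c5 : b ≠ a + 2 := by omega
    have c6 : b ≠ a + 3 := by omega
    simp [c1, c2, c3, c4, c5, c6]
  · simp only [not_or] at hb
    simp [hb]
  · simp [b1, b2]
  · simp [b3, b4]
  · simp [b5, b6]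
  · simp
  · simp
  · simp

end RealRAM

/-! ### One round of the tree construction -/

namespace RealRAM

variable {B n : ℕ} {τ : ℝ≥0∞}

/-- The invariant of the construction of a ring tree. -/
structure TreeInv (δ : Fin n → Fin n → ℝ) (c₀ : ℕ) (ε tl tu : ℝ) (es : List (List (Fin n) × ℕ))
    (M : ℕ) (s : State) : Prop where
  regs : TreeRegs c₀ tl tu M s
  part : TreePart δ c₀ ε es M s
  top : s.N 7 = (stackList es).length
  stk : Stk (stackList es) s

/-- The invariant after the topmost point set has been moved to the array. -/
structure TreePopped (δ : Fin n → Fin n → ℝ) (c₀ : ℕ) (ε tl tu : ℝ) (l : List (Fin n)) (a : ℕ)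
    (es : List (List (Fin n) × ℕ)) (M : ℕ) (s : State) : Prop where
  regs : TreeRegs c₀ tl tu M s
  part : TreePart δ c₀ ε ((l, a) :: es) M s
  top : s.N 7 = (stackList es).length
  stk : Stk (stackList es) s
  size : s.N 6 = l.length
  node : s.N 18 = a
  arr : Arr 69 0 l s

variable {δ : Fin n → Fin n → ℝ} {c₀ M : ℕ} {ε tl tu : ℝ} {es : List (List (Fin n) × ℕ)}
  {s s' : State} {l : List (Fin n)} {a : ℕ}

theorem TreePopped.input (h : TreePopped δ c₀ ε tl tu l a es M s) : SepInput c₀ tl tu l s :=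
  ⟨h.regs.zero, h.size, h.arr, h.regs.factor, h.regs.upper, h.regs.balance⟩

theorem TreePopped.congr (h : TreePopped δ c₀ ε tl tu l a es M s)
    (h' : Agree SepRegN SepRegR s s') : TreePopped δ c₀ ε tl tu l a es M s' := by
  have hN : ∀ b, ¬ SepRegN b → s'.N b = s.N b := h'.1
  have hi := h.input.congr h'
  refine ⟨⟨hi.zero, ?_, ?_, hi.factor, hi.upper, hi.balance⟩, h.part.congr fun k _ _ =>
    ⟨fun i hi => ?_, fun i hi => ?_⟩, ?_, h.stk.congr fun k _ => ?_, hi.size, ?_, hi.arr⟩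
  · rw [hN _ (by unfold SepRegN; omega), h.regs.two]
  · rw [hN _ (by unfold SepRegN; omega), h.regs.free]
  · rw [hN _ (by unfold SepRegN; omega)]
  · rw [h'.2 _ (by unfold SepRegR; omega)]
  · rw [hN _ (by unfold SepRegN; omega), h.top]
  · rw [hN _ (by unfold SepRegN; omega)]
  · rw [hN _ (by unfold SepRegN; omega), h.node]

theorem wp_popEntry_tree {E : ℕ → ℕ → ℝ} (h : TreeInv δ c₀ ε tl tu ((l, a) :: es) M s)
    (hB : 8 * (l.length + 2 + (stackList es).length) + 69 ≤ B) :
    wp E B popEntry (fun k s' => k ≤ 80 * (l.length + 1) ∧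
      TreePopped δ c₀ ε tl tu l a es M s') s := by
  refine wp_popEntry l a hB ?_ h.stk fun s' hs' h6 h18 h7 hS harr k hk => ⟨hk, ⟨?_, ?_, ?_, ?_,
    ?_, ?_⟩, h.part.congr fun k _ _ => ⟨fun i hi => ?_, fun i hi => ?_⟩, h7, hS, h6, h18, harr⟩
  · rw [h.top]; simp [stackList]; ring
  · rw [hs'.1 _ (by norm_num [PopReg, EachReg]), h.regs.zero]
  · rw [hs'.1 _ (by norm_num [PopReg, EachReg]), h.regs.two]
  · rw [hs'.1 _ (by norm_num [PopReg, EachReg]), h.regs.free]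
  · rw [hs'.2 _ not_false, h.regs.factor]
  · rw [hs'.2 _ not_false, h.regs.upper]
  · rw [hs'.2 _ not_false, h.regs.balance]
  · rw [hs'.1 _ (by simp only [PopReg, EachReg]; omega)]
  · rw [hs'.2 _ not_false]

theorem wp_writeLeaf_tree {E : ℕ → ℕ → ℝ} (h : TreePopped δ c₀ ε tl tu l a es M s)
    (hl : l.length = 1) (hB : 8 * M + 200 ≤ B) :
    wp E B writeLeaf (fun k s' => k ≤ 30 ∧ TreeInv δ c₀ ε tl tu es M s') s := by
  obtain ⟨j, rfl⟩ := List.length_eq_one_iff.1 hl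
  obtain ⟨k₀, hk₀, hka⟩ := h.part.addr _ List.mem_cons_self
  simp only at hka
  refine wp_writeLeaf (j := j) (by omega) (by omega) (by omega) h.regs.zero h.node ?_
    fun s' hs' ha ha' k hk => ⟨hk, ⟨?_, ?_, ?_, ?_, ?_, ?_⟩, h.part.leaf ha ha' fun k _ hk' =>
      ⟨fun i hi => ?_, fun i hi => ?_⟩, ?_, h.stk.congr fun k _ => ?_⟩
  · simpa using h.arr 0 (by simp)
  · rw [hs'.1 _ (by omega), h.regs.zero]
  · rw [hs'.1 _ (by omega), h.regs.two]
  · rw [hs'.1 _ (by omega), h.regs.free]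
  · rw [hs'.2 _ not_false, h.regs.factor]
  · rw [hs'.2 _ not_false, h.regs.upper]
  · rw [hs'.2 _ not_false, h.regs.balance]
  · rw [hs'.1 _ (by omega)]
  · rw [hs'.2 _ not_false]
  · rw [hs'.1 _ (by omega), h.top]
  · rw [hs'.1 _ (by omega)]

/-- Writes an inner node and pushes the point sets of its children. -/
def splitNode : Cmd :=
  .seq writeNode (.seq (copyR 5 31) (.seq (pushSel true) (.seq (copyR 5 30) (pushSel false))))

/-- `l₁` and `l₂` are the points in the outer ball, and the points outside of the inner ball. -/
structure IsSplit (δ : Fin n → Fin n → ℝ) (l : List (Fin n)) (m : Fin n) (r₁ r₂ : ℝ)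
    (l₁ l₂ : List (Fin n)) : Prop where
  inner : l₁.toFinset = pointsInBall δ l.toFinset m r₂
  outer : l₂.toFinset = l.toFinset \ pointsInBall δ l.toFinset m r₁
  inner_nodup : l₁.Nodup
  outer_nodup : l₂.Nodup

/-- The child pointers are written before the children are pushed. They are correct because pushing
assigns the address in `N[17]` and advances it by `8`: the outer ball gets `8 M + 64`, the
complement of the inner ball `8 M + 72`. -/
theorem wp_splitNode {m : Fin n} (h : TreePopped δ c₀ ε tl tu l a es M s) (h5 : s.N 5 = m)
    (hsep : IsRingSeparator δ c₀ ε l.toFinset m (s.R 30) (s.R 31))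
    (hB : 8 * (2 * l.length + 4 + (stackList es).length) + 69 ≤ B) (hB' : 8 * M + 200 ≤ B) :
    wp (oracle δ) B splitNode (fun k s' => k ≤ 400 * (l.length + 1) ∧ ∃ l₁ l₂,
      IsSplit δ l m (s.R 30) (s.R 31) l₁ l₂ ∧
      TreeInv δ c₀ ε tl tu ((l₂, 8 * M + 72) :: (l₁, 8 * M + 64) :: es) (M + 2) s') s := by
  classical
  obtain ⟨k₀, hk₀, hka⟩ := h.part.addr _ List.mem_cons_self
  simp only at hka
  have hl := (h.part.lists _ List.mem_cons_self).1
  simp only at hl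
  have h17 := h.regs.free
  set r₁ := s.R 30 with hr₁
  set r₂ := s.R 31 with hr₂
  set selI : Fin n → Bool := fun q => decide (δ m q < r₂) with hselI
  set selO : Fin n → Bool := fun q => ! decide (δ m q < r₁) with hselO
  have hlI : (l.filter selI).length ≤ l.length := List.length_filter_le _ _
  have hlO : (l.filter selO).length ≤ l.length := List.length_filter_le _ _
  have hsplit : IsSplit δ l m r₁ r₂ (l.filter selI).reverse (l.filter selO).reverse := by
    refine ⟨?_, ?_, List.nodup_reverse.2 (hl.filter _), List.nodup_reverse.2 (hl.filter _)⟩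
    · ext q; simp [pointsInBall, hselI]
    · ext q
      simp only [pointsInBall, hselO, List.toFinset_reverse, List.mem_toFinset, List.mem_filter,
        Finset.mem_sdiff, Finset.mem_filter, Bool.not_eq_true', decide_eq_false_iff_not]
      tauto
  rw [splitNode, wp_seq]
  refine wp_writeNode (by omega) (by omega) (by omega) h.node
    fun s1 hs1 g0 g1 g2 g3 g4 g5 k1 hk1 => ?_
  rw [wp_seq]
  refine wp_copyR (by norm_num) fun s2 hs2 g6 => ?_
  have eN : ∀ b, b ≠ 60 → b ≠ 61 → (b < a ∨ a + 4 ≤ b) → s2.N b = s.N b := fun b h1 h2 h3 => by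
    rw [hs2.1 _ not_false, hs1.1 _ (by omega)]
  have eR : ∀ b, b ≠ 5 → b ≠ a → b ≠ a + 1 → s2.R b = s.R b := fun b h1 h2 h3 => by
    rw [hs2.2 _ h1, hs1.2 _ (by omega)]
  have e17 : s2.N 17 = 8 * M + 64 := by rw [eN _ (by norm_num) (by norm_num) (by omega), h17]
  rw [wp_seq]
  refine wp_pushSel (L := stackList es) l m r₂ selI (fun q => by simp [hselI]) (by omega) (by omega)
    (by omega) ?_ ?_ (fun i hi => ?_) ?_ ?_ (h.stk.congr fun k _ => ?_)
    fun s3 hs3 h37 h317 hS3 k3 hk3 => ?_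
  · rw [eN _ (by norm_num) (by norm_num) (by omega), h5]
  · rw [eN _ (by norm_num) (by norm_num) (by omega), h.size]
  · rw [eN _ (by omega) (by omega) (by omega), h.arr i hi]
  · rw [g6, hs1.2 _ (by omega)]
  · rw [eN _ (by norm_num) (by norm_num) (by omega), h.top]
  · rw [eN _ (by omega) (by omega) (by omega)]
  rw [e17] at h317 hS3
  rw [wp_seq]
  refine wp_copyR (by norm_num) fun s4 hs4 g7 => ?_
  have fN : ∀ b, b ≠ 12 → b ≠ 17 → ¬ EachReg b → ¬ StkReg b → (b < a ∨ a + 4 ≤ b) →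
      s4.N b = s.N b := fun b h1 h2 h3 h4 h5 => by
    rw [hs4.1 _ not_false, hs3.1 _ (by tauto), eN b (by unfold EachReg at h3; omega)
      (by unfold EachReg at h3; omega) h5]
  have fR : ∀ b, b ≠ 5 → b ≠ 10 → b ≠ a → b ≠ a + 1 → s4.R b = s.R b := fun b h1 h2 h3 h4 => by
    rw [hs4.2 _ h1, hs3.2 _ h2, eR b h1 h3 h4]
  have e417 : s4.N 17 = 8 * M + 72 := by rw [hs4.1 _ not_false, h317]
  refine wp_pushSel (L := stackList (((l.filter selI).reverse, 8 * M + 64) :: es)) l m r₁ selO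
    (fun q => by simp [hselO]) (by omega) (by simp [stackList]; omega) (by omega) ?_ ?_
    (fun i hi => ?_) ?_ ?_ ?_ fun s5 hs5 h57 h517 hS5 k5 hk5 => ?_
  · rw [fN _ (by norm_num) (by norm_num) (by norm_num [EachReg]) (by norm_num [StkReg]) (by omega), h5]
  · rw [fN _ (by norm_num) (by norm_num) (by norm_num [EachReg]) (by norm_num [StkReg]) (by omega),
      h.size]
  · rw [fN _ (by omega) (by omega) (by simp only [EachReg]; omega) (by simp only [StkReg]; omega)
      (by omega), h.arr i hi]
  · rw [g7, hs3.2 _ (by norm_num), eR _ (by norm_num) (by omega) (by omega)]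
  · rw [hs4.1 _ not_false, h37]; simp [stackList]; ring
  · rw [stackList]
    simp only [List.length_reverse]
    exact hS3.congr fun k _ => hs4.1 _ not_false
  rw [e417] at h517 hS5
  have gN : ∀ b, b ≠ 12 → b ≠ 17 → ¬ EachReg b → ¬ StkReg b → (b < a ∨ a + 4 ≤ b) →
      s5.N b = s.N b := fun b h1 h2 h3 h4 h5 => by
    rw [hs5.1 _ (by tauto), fN b h1 h2 h3 h4 h5]
  have gR : ∀ b, b ≠ 5 → b ≠ 10 → b ≠ a → b ≠ a + 1 → s5.R b = s.R b := fun b h1 h2 h3 h4 => by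
    rw [hs5.2 _ h2, fR b h1 h2 h3 h4]
  have gN' : ∀ i < 4, s5.N (a + i) = s1.N (a + i) := fun i hi => by
    have h1 : ¬ (a + i = 12 ∨ a + i = 17 ∨ EachReg (a + i) ∨ StkReg (a + i)) := by
      simp only [EachReg, StkReg]; omega
    rw [hs5.1 _ h1, hs4.1 _ not_false, hs3.1 _ h1, hs2.1 _ not_false]
  have gR' : ∀ i < 2, s5.R (a + i) = s1.R (a + i) := fun i hi => by
    rw [hs5.2 _ (by omega), hs4.2 _ (by omega), hs3.2 _ (by omega), hs2.2 _ (by omega)]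
  refine ⟨by omega, _, _, hsplit, ⟨?_, ?_, ?_, ?_, ?_, ?_⟩,
    h.part.node hsep hsplit.inner hsplit.outer hsplit.inner_nodup hsplit.outer_nodup
    ?_ ?_ ?_ ?_ ?_ ?_ fun k _ hk => ⟨fun i hi => ?_, fun i hi => ?_⟩, ?_, ?_⟩
  · rw [gN _ (by norm_num) (by norm_num) (by norm_num [EachReg]) (by norm_num [StkReg]) (by omega),
      h.regs.zero]
  · rw [gN _ (by norm_num) (by norm_num) (by norm_num [EachReg]) (by norm_num [StkReg]) (by omega),
      h.regs.two]
  · omega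
  · rw [gR _ (by norm_num) (by norm_num) (by omega) (by omega), h.regs.factor]
  · rw [gR _ (by norm_num) (by norm_num) (by omega) (by omega), h.regs.upper]
  · rw [gR _ (by norm_num) (by norm_num) (by omega) (by omega), h.regs.balance]
  · rw [← g0]; exact gN' 0 (by norm_num)
  · rw [gN' 1 (by norm_num), g1, h5]
  · rw [gN' 2 (by norm_num), g2, h17]
  · rw [gN' 3 (by norm_num), g3, h17]
  · exact (gR' 0 (by norm_num)).trans g4
  · rw [gR' 1 (by norm_num), g5]
  · rw [gN _ (by omega) (by omega) (by simp only [EachReg]; omega) (by simp only [StkReg]; omega)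
      (by omega)]
  · rw [gR _ (by omega) (by omega) (by omega) (by omega)]
  · rw [h57]; simp [stackList]; ring
  · rw [stackList]
    simp only [List.length_reverse]
    exact hS5

/-- Splits the topmost point set of the stack. -/
def treeRound : Cmd := .seq popEntry (.cond (.natLT 6 19) writeLeaf (.seq findSep splitNode))

theorem ert_treeRound_le {p : ℕ} {I : State → ℝ≥0∞} {F : ℝ≥0∞}
    (h : TreeInv δ c₀ ε tl tu ((l, a) :: es) M s)
    (hB : 16 * (stackList ((l, a) :: es)).length + 100 ≤ B) (hB' : 8 * M + 200 ≤ B)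
    (hδ : ∀ i j, 0 ≤ δ i j) (htl : 0 < tl) (htu : 0 < tu) (hε : ε ≤ 1 / tl) (hε' : 1 / tu ≤ ε)
    (hp : 2 ≤ l.length → l.length ^ 3 ≤ p * goodTriples δ c₀ tl tu l)
    (hleaf : l.length = 1 → ∀ s', TreeInv δ c₀ ε tl tu es M s' → I s' ≤ F)
    (hnode : 2 ≤ l.length → ∀ m r₁ r₂ l₁ l₂ s', IsRingSeparator δ c₀ ε l.toFinset m r₁ r₂ →
      IsSplit δ l m r₁ r₂ l₁ l₂ →
      TreeInv δ c₀ ε tl tu ((l₂, 8 * M + 72) :: (l₁, 8 * M + 64) :: es) (M + 2) s' → I s' ≤ F) :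
    ert (oracle δ) B τ treeRound I s ≤ τ * (((p * 400 + 600) * (l.length + 1) : ℕ) : ℝ≥0∞) + F := by
  have hst : (stackList ((l, a) :: es)).length = l.length + 2 + (stackList es).length := by
    simp [stackList]; ring
  rw [hst] at hB
  have hlen := (h.part.lists _ List.mem_cons_self).2
  have hnd := (h.part.lists _ List.mem_cons_self).1
  simp only at hlen hnd
  set k := l.length with hk
  have key : ert (oracle δ) B τ popEntry (ert (oracle δ) B τ
      (.cond (.natLT 6 19) writeLeaf (.seq findSep splitNode)) I) s
      ≤ τ * ((80 * (k + 1) + (32 + p * 400 * (k + 1) + 400 * (k + 1)) : ℕ) : ℝ≥0∞) + F := by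
    refine ert_le_of_wp (wp_popEntry_tree h (by omega)) ?_
    rintro k1 s1 ⟨hk1, hs1⟩
    have h619 : (Test.natLT 6 19).holds s1 ↔ k < 2 := by
      rw [Test.holds, hs1.size, hs1.regs.two]
    have hcond : ert (oracle δ) B τ (.cond (.natLT 6 19) writeLeaf (.seq findSep splitNode)) I s1
        ≤ τ * ((32 + p * 400 * (k + 1) + 400 * (k + 1) : ℕ) : ℝ≥0∞) + F := by
      rw [ert]
      split_ifs with ht
      · rw [h619] at ht
        have : ert (oracle δ) B τ writeLeaf I s1 ≤ τ * ((30 : ℕ) : ℝ≥0∞) + F := by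
          refine ert_le_of_wp (wp_writeLeaf_tree hs1 (by omega) hB') ?_
          rintro k2 s2 ⟨hk2, hs2⟩
          exact cost_mono (Nat.cast_le.2 hk2) (hleaf (by omega) s2 hs2)
        calc _ ≤ τ + (τ * ((30 : ℕ) : ℝ≥0∞) + F) := by gcongr
          _ = τ * ((31 : ℕ) : ℝ≥0∞) + F := by push_cast; ring
          _ ≤ _ := cost_mono (Nat.cast_le.2 (by omega)) le_rfl
      · rw [h619, not_lt] at ht
        have := ert_findSep_le (B := B) (τ := τ) (δ := δ) (p := p) (ε := ε)
          (f := ert (oracle δ) B τ splitNode I) (F := τ * ((400 * (k + 1) : ℕ) : ℝ≥0∞) + F)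
          (by omega) hs1.input hnd (by omega) hδ htl htu hε hε' (hp ht) (by
            rintro s2 hs2 ⟨m, hm, h5, hsep⟩
            refine ert_le_of_wp (wp_splitNode (hs1.congr hs2) h5 hsep (by omega) hB') ?_
            rintro k3 s3 ⟨hk3, l₁, l₂, hsplit, hs3⟩
            exact cost_mono (Nat.cast_le.2 hk3) (hnode ht m _ _ l₁ l₂ s3 hsep hsplit hs3))
        rw [ert]
        calc _ ≤ τ + (τ + (τ * ((p * 400 * (k + 1) : ℕ) : ℝ≥0∞)
              + (τ * ((400 * (k + 1) : ℕ) : ℝ≥0∞) + F))) := by gcongr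
          _ = τ * ((2 + p * 400 * (k + 1) + 400 * (k + 1) : ℕ) : ℝ≥0∞) + F := by push_cast; ring
          _ ≤ _ := cost_mono (Nat.cast_le.2 (by omega)) le_rfl
    calc _ ≤ τ * ((80 * (k + 1) : ℕ) : ℝ≥0∞)
          + (τ * ((32 + p * 400 * (k + 1) + 400 * (k + 1) : ℕ) : ℝ≥0∞) + F) := by gcongr
      _ = _ := by push_cast; ring
  rw [treeRound, ert]
  calc _ ≤ τ + (τ * ((80 * (k + 1) + (32 + p * 400 * (k + 1) + 400 * (k + 1)) : ℕ) : ℝ≥0∞) + F) := by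
        gcongr
    _ = τ * ((80 * (k + 1) + (32 + p * 400 * (k + 1) + 400 * (k + 1)) + 1 : ℕ) : ℝ≥0∞) + F := by
        push_cast; ring
    _ ≤ _ := cost_mono (Nat.cast_le.2 (by rw [add_mul]; omega)) le_rfl

end RealRAM

/-! ### Time, stack and memory of the whole construction -/

namespace RealRAM

variable {B n : ℕ} {τ : ℝ≥0∞}

/-- Functions of the size of a point set that bound the size of a ring tree, and the time to build
it. -/
structure IsTreePotential (δ : Fin n → Fin n → ℝ) (c₀ : ℕ) (ε : ℝ) (W U : ℕ → ℝ) : Prop where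
  le_size : ∀ k : ℕ, 1 ≤ k → (k : ℝ) ≤ W k
  size_le_time : ∀ k : ℕ, 1 ≤ k → W k ≤ U k
  split : ∀ Q m r₁ r₂, 2 ≤ Q.card → IsRingSeparator δ c₀ ε Q m r₁ r₂ →
    W (pointsInBall δ Q m r₂).card + W (Q \ pointsInBall δ Q m r₁).card ≤ W Q.card ∧
    U (pointsInBall δ Q m r₂).card + U (Q \ pointsInBall δ Q m r₁).card + W Q.card ≤ U Q.card

def treeLoop : Cmd := .loop (.natLT 15 7) treeRound

/-- The sum of a potential over all point sets on the stack. -/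
noncomputable def potSum (W : ℕ → ℝ) (es : List (List (Fin n) × ℕ)) : ℝ :=
  (es.map fun e => W e.1.length).sum

theorem potSum_nonneg {W : ℕ → ℝ} {es : List (List (Fin n) × ℕ)}
    (h : ∀ e ∈ es, 0 ≤ W e.1.length) : 0 ≤ potSum W es :=
  List.sum_nonneg fun x hx => by
    obtain ⟨e, he, rfl⟩ := List.mem_map.1 hx
    exact h e he

/-- A nonempty set of `k` points occupies `k + 2 ≤ 3k` cells. -/
theorem stackList_length_le {W : ℕ → ℝ} (hW : ∀ k : ℕ, 1 ≤ k → (k : ℝ) ≤ W k)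
    {es : List (List (Fin n) × ℕ)} (h : ∀ e ∈ es, 1 ≤ e.1.length) :
    ((stackList es).length : ℝ) ≤ 3 * potSum W es := by
  induction es with
  | nil => simp [stackList, potSum]
  | cons e es ih =>
    have h1 := ih fun e he => h e (List.mem_cons_of_mem _ he)
    have h2 := h e List.mem_cons_self
    have h3 := hW _ h2
    have h4 : (1 : ℝ) ≤ e.1.length := by exact_mod_cast h2
    simp only [stackList, potSum, List.map_cons, List.sum_cons, List.length_cons,
      List.length_append, List.length_map] at h1 ⊢
    push_cast
    linarith

/-- A tree with at most `W` leaves has at most `2 W - 1` nodes. One of them exists as soon as its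
entry is on the stack, so `2 W - 2` bounds the nodes that are still to come. -/
theorem potSum_sub {W : ℕ → ℝ} (es : List (List (Fin n) × ℕ)) :
    potSum (fun k => 2 * W k - 2) es = 2 * potSum W es - 2 * es.length := by
  induction es with
  | nil => simp [potSum]
  | cons e es ih =>
    simp only [potSum, List.map_cons, List.sum_cons, List.length_cons] at ih ⊢
    rw [ih]; push_cast; ring

/-- Three sums over the pending sets are kept under control: that of `W` bounds the stack, the
number of nodes plus that of `2 W - 2` bounds the addresses, and that of `U` pays for the time,
since a round on a set of size `k` lowers it by at least `W k`. -/
theorem ert_treeLoop_le {δ : Fin n → Fin n → ℝ} {c₀ p M : ℕ} {ε tl tu w : ℝ} {W U : ℕ → ℝ}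
    {es : List (List (Fin n) × ℕ)} {s : State} {f : State → ℝ≥0∞} {F : ℝ≥0∞}
    (hWU : IsTreePotential δ c₀ ε W U) (hB : 100 * w + 300 ≤ B)
    (hδ : ∀ i j, 0 ≤ δ i j) (htl : 0 < tl) (htu : 0 < tu) (hε : ε ≤ 1 / tl) (hε' : 1 / tu ≤ ε)
    (hp : ∀ l : List (Fin n), l.Nodup → 2 ≤ l.length →
      l.length ^ 3 ≤ p * goodTriples δ c₀ tl tu l)
    (hs : TreeInv δ c₀ ε tl tu es M s) (hw : potSum W es ≤ w)
    (hM : M + potSum (fun k => 2 * W k - 2) es ≤ 2 * w)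
    (hf : ∀ M s', TreeInv δ c₀ ε tl tu [] M s' → f s' ≤ F) :
    ert (oracle δ) B τ treeLoop f s
      ≤ τ * ENNReal.ofReal (2 * (p * 400 + 601) * potSum U es + 1) + F := by
  set K : ℝ := 2 * (p * 400 + 601) with hK
  have hK0 : 0 ≤ K := by positivity
  refine ert_loop_le (fun (g : List (List (Fin n) × ℕ) × ℕ) s => TreeInv δ c₀ ε tl tu g.1 g.2 s ∧
    potSum W g.1 ≤ w ∧ g.2 + potSum (fun k => 2 * W k - 2) g.1 ≤ 2 * w)
    (fun g => τ * ENNReal.ofReal (K * potSum U g.1 + 1) + F) ?_ ?_ (g := (es, M)) ⟨hs, hw, hM⟩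
  · rintro ⟨es, M⟩ s ⟨hs, -, -⟩ ht
    simp only at hs
    have h0 : es = [] := by
      rw [Test.holds, hs.regs.zero, hs.top, not_lt] at ht
      rcases es with _ | ⟨e, es⟩
      · rfl
      · simp [stackList] at ht
    subst h0
    simpa [potSum] using add_le_add_right (hf M s hs) τ
  · rintro ⟨es, M⟩ s ⟨hs, hw, hM⟩ ht I hI
    simp only at hs hw hM
    rcases es with _ | ⟨⟨l, a⟩, es⟩
    · rw [Test.holds, hs.regs.zero, hs.top] at ht
      simp [stackList] at ht
    have hlists := hs.part.lists
    have hl := hlists _ List.mem_cons_self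
    simp only at hl
    have hes : ∀ e ∈ es, 1 ≤ e.1.length := fun e he => (hlists e (List.mem_cons_of_mem _ he)).2
    have hst := stackList_length_le hWU.le_size fun e he => (hlists e he).2
    have hWnn : ∀ k : ℕ, 1 ≤ k → (0 : ℝ) ≤ 2 * W k - 2 := fun k hk => by
      have h1 := hWU.le_size k hk
      have h2 : (1 : ℝ) ≤ k := by exact_mod_cast hk
      linarith
    have hM' : (M : ℝ) ≤ 2 * w := by
      have := potSum_nonneg (W := fun k => 2 * W k - 2) fun e he => hWnn _ (hlists e he).2
      linarith
    have hUnn : ∀ k : ℕ, 1 ≤ k → (0 : ℝ) ≤ U k := fun k hk =>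
      (Nat.cast_nonneg k).trans ((hWU.le_size k hk).trans (hWU.size_le_time k hk))
    have hUes : 0 ≤ potSum U es := potSum_nonneg fun e he => hUnn _ (hes e he)
    have hWU0 := hWU.size_le_time _ hl.2
    have hW1 := hWU.le_size _ hl.2
    have hl1 : (1 : ℝ) ≤ l.length := by exact_mod_cast hl.2
    -- The factor `2` in `K` accounts for `l.length + 1 ≤ 2 l.length`.
    have hcost : (((p * 400 + 600) * (l.length + 1) + 1 : ℕ) : ℝ) ≤ K * W l.length := by
      push_cast
      calc ((p : ℝ) * 400 + 600) * (l.length + 1) + 1 ≤ (p * 400 + 601) * (l.length + l.length) := by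
            nlinarith [show (0 : ℝ) ≤ p from Nat.cast_nonneg _]
        _ = K * l.length := by rw [hK]; ring
        _ ≤ _ := by gcongr
    set U' := potSum U ((l, a) :: es) with hU'
    have hU'e : U' = U l.length + potSum U es := by simp [hU', potSum]
    have eW : potSum W ((l, a) :: es) = W l.length + potSum W es := by simp [potSum]
    rw [potSum_sub, List.length_cons, eW] at hM
    rw [eW] at hw
    push_cast at hM
    -- the potential that remains after this round
    have hround := ert_treeRound_le (B := B) (τ := τ) (p := p) (I := I)
      (F := τ * ENNReal.ofReal (K * U' + 1 - ((p * 400 + 600) * (l.length + 1) + 1 : ℕ)) + F) hs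
      (by
        have : (16 * (stackList ((l, a) :: es)).length + 100 : ℝ) ≤ B := by
          rw [eW] at hst; linarith
        exact_mod_cast this)
      (by
        have : (8 * M + 200 : ℝ) ≤ B := by linarith
        exact_mod_cast this) hδ htl htu hε hε' (hp l hl.1) ?_ ?_
    · calc _ ≤ τ + (τ * (((p * 400 + 600) * (l.length + 1) : ℕ) : ℝ≥0∞)
            + (τ * ENNReal.ofReal (K * U' + 1 - ((p * 400 + 600) * (l.length + 1) + 1 : ℕ)) + F)) := by
            gcongr
        _ = τ * (ENNReal.ofReal (((p * 400 + 600) * (l.length + 1) + 1 : ℕ) : ℝ)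
            + ENNReal.ofReal (K * U' + 1 - ((p * 400 + 600) * (l.length + 1) + 1 : ℕ))) + F := by
            rw [ENNReal.ofReal_natCast, mul_add]; push_cast; ring
        _ = _ := by
            rw [← ENNReal.ofReal_add (Nat.cast_nonneg _)]
            · congr 3; ring
            · have : K * W l.length ≤ K * U' := by gcongr; linarith
              linarith
    · intro h1 s' hs'
      refine (hI (es, M) s' ⟨hs', ?_, ?_⟩).trans (cost_mono (ENNReal.ofReal_le_ofReal ?_) le_rfl)
      · simp only; linarith
      · simp only; rw [potSum_sub]; linarith
      · simp only
        have : K * (W l.length + potSum U es) ≤ K * U' := by gcongr; linarith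
        linarith
    · intro h2 m r₁ r₂ l₁ l₂ s' hsep hsplit hs'
      have hcard : l.toFinset.card = l.length := List.toFinset_card_of_nodup hl.1
      have hsp := hWU.split l.toFinset m r₁ r₂ (by omega) hsep
      rw [← hsplit.inner, ← hsplit.outer, List.toFinset_card_of_nodup hsplit.inner_nodup,
        List.toFinset_card_of_nodup hsplit.outer_nodup, hcard] at hsp
      obtain ⟨hsp1, hsp2⟩ := hsp
      refine (hI ((l₂, 8 * M + 72) :: (l₁, 8 * M + 64) :: es, M + 2) s' ⟨hs', ?_, ?_⟩).trans
        (cost_mono (ENNReal.ofReal_le_ofReal ?_) le_rfl)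
      · simp only [potSum, List.map_cons, List.sum_cons] at hw ⊢; linarith
      · simp only
        rw [potSum_sub]
        simp only [potSum, List.map_cons, List.sum_cons, List.length_cons] at hM ⊢
        push_cast
        linarith
      · simp only
        have e : potSum U ((l₂, 8 * M + 72) :: (l₁, 8 * M + 64) :: es)
            = U l₂.length + (U l₁.length + potSum U es) := by simp [potSum]
        rw [e, hU'e]
        have : K * (W l.length + (U l₂.length + (U l₁.length + potSum U es)))
            ≤ K * (U l.length + potSum U es) :=
          mul_le_mul_of_nonneg_left (by linarith) hK0
        linarith

end RealRAM

/-! ### Parameters, initial stack and the complete program for trees -/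

namespace RealRAM

variable {B n : ℕ} {τ : ℝ≥0∞}

/-- Computes the parameters for the construction of a ring tree. -/
def treeParams (c₀ : ℕ) : Cmd :=
  block [copyN 1 0, copyN 23 0, inc 23, .natConst 22 2,
    .loop (.natLT 22 23) (.seq (.natAdd 22 22 22) (inc 21)),
    .realOfNat 24 21, .natConst 60 2, .realOfNat 25 60, .realDiv 20 25 24, .natConst 60 1,
    .realOfNat 26 60, .realAdd 20 26 20, .realMul 21 25 24, .natConst 60 c₀, .realOfNat 22 60,
    .natConst 17 64, .natConst 19 2]

/-- The natural logarithm is replaced by `⌊log₂ n⌋`, found by doubling; half of it and twice it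
enclose `log n`. -/
theorem wp_treeParams {E : ℕ → ℕ → ℝ} {c₀ : ℕ} (hn : 2 ≤ n) (hB : 20 * n + 200 + c₀ ≤ B) :
    wp E B (treeParams c₀) (fun k s => k ≤ 12 * n + 100 ∧ s.N 1 = n ∧
      TreeRegs c₀ (Nat.log 2 n / 2) (2 * Nat.log 2 n) 0 s ∧ s.N 5 = 0 ∧ s.N 7 = 0 ∧ s.R 5 = 0)
      (initial n 0) := by
  have i0 : ∀ a, (initial n 0).N a = if a = 0 then n else 0 := fun a => by
    simp [initial, Function.update_apply]
  have iR : ∀ a, (initial n 0).R a = 0 := fun a => by simp [initial]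
  generalize initial n 0 = s at i0 iR
  have hlog : Nat.log 2 n ≤ n := Nat.log_le_self 2 n
  rw [treeParams, block, wp_seq]
  refine wp_copyN (by norm_num) (by rw [i0, if_pos rfl]; omega) fun s1 hs1 h1 => ?_
  rw [i0, if_pos rfl] at h1
  rw [block, wp_seq]
  have e0 : s1.N 0 = n := by rw [hs1.1 _ (by norm_num), i0, if_pos rfl]
  refine wp_copyN (by norm_num) (by omega) fun s2 hs2 h2 => ?_
  rw [e0] at h2
  rw [block, wp_seq]
  refine wp_inc (by norm_num) (by omega) fun s3 hs3 h3 => ?_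
  rw [h2] at h3
  rw [block, wp_seq]
  refine ⟨by omega, ?_⟩
  beta_reduce
  rw [block, wp_seq]
  have z3 : ∀ a, a ≠ 0 → a ≠ 1 → a ≠ 23 → a ≠ 60 → s3.N a = 0 := fun a h0 h1 h23 h60 => by
    rw [hs3.1 a (by tauto), hs2.1 a h23, hs1.1 a h1, i0, if_neg h0]
  have n3 : s3.N 1 = n := by rw [hs3.1 _ (by norm_num), hs2.1 _ (by norm_num), h1]
  have R3 : ∀ a, s3.R a = 0 := fun a => by
    rw [hs3.2 _ not_false, hs2.2 _ not_false, hs1.2 _ not_false, iR]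
  -- The power in `N[22]` is one ahead of the counter and is compared with `n + 1`: the loop
  -- continues as long as `2 ^ (i + 1) ≤ n`.
  refine wp_loop (fun i s => s.N 22 = 2 ^ (i + 1) ∧ s.N 21 = i ∧ s.N 23 = n + 1 ∧ s.N 1 = n ∧
    (∀ a, a ≠ 0 → a ≠ 1 → a ≠ 21 → a ≠ 22 → a ≠ 23 → a ≠ 60 → s.N a = 0) ∧ ∀ a, s.R a = 0)
    (Nat.log 2 n) 10 ?_ ?_ ?_
  · refine ⟨by simp, by simp [z3], by simp [h3], by simp [n3], fun a h0 h1 h21 h22 h23 h60 => ?_, R3⟩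
    simp [h22, z3 a h0 h1 h23 h60]
  · rintro i hi s4 ⟨h22, h21, h23, hn1, hz, hR⟩
    have hpow : 2 ^ (i + 1) ≤ n := Nat.pow_le_of_le_log (by omega) hi
    refine ⟨by rw [Test.holds, h22, h23]; omega, ?_⟩
    rw [wp_seq, wp]
    refine ⟨by omega, ?_⟩
    refine wp_inc (by norm_num) (by simp; omega) fun s5 hs5 h5 => ⟨by norm_num, ?_, ?_, ?_, ?_,
      fun a h0 h1 h21 h22 h23 h60 => ?_, fun a => ?_⟩
    · rw [hs5.1 _ (by norm_num)]; simp [h22]; ring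
    · rw [h5]; simp [h21]
    · rw [hs5.1 _ (by norm_num)]; simp [h23]
    · rw [hs5.1 _ (by norm_num)]; simp [hn1]
    · rw [hs5.1 _ (by tauto)]; simp [h22, hz a h0 h1 h21 h22 h23 h60]
    · rw [hs5.2 _ not_false, setN_R, hR]
  rintro s4 ⟨h22, h21, h23, hn1, hz, hR⟩
  have hpow : n < 2 ^ (Nat.log 2 n + 1) := Nat.lt_pow_succ_log_self (by norm_num) n
  have : Nat.log 2 n * (10 + 1) ≤ n * 11 := Nat.mul_le_mul_right _ hlog
  refine ⟨by rw [Test.holds, h22, h23]; omega, fun k hk => ?_⟩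
  simp only [block, wp]
  refine ⟨by omega, by omega, by omega, by omega, by omega, by omega, by simp [hn1],
    ⟨?_, ?_, ?_, ?_, ?_, ?_⟩, ?_, ?_, ?_⟩
  · simp [hz]
  · simp
  · simp
  · simp [h21]
  · simp [h21]
  · simp
  · simp [hz]
  · simp [hz]
  · simp [hR]

/-- Computes the parameters, and pushes the set of all points. -/
def treeSetup (c₀ : ℕ) : Cmd := .seq (treeParams c₀) (.seq fill (pushSel false))

theorem wp_treeSetup {δ : Fin n → Fin n → ℝ} {c₀ : ℕ} {ε : ℝ} (hn : 2 ≤ n)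
    (hδ : ∀ i j, 0 ≤ δ i j) (hB : 20 * n + 200 + c₀ ≤ B) :
    wp (oracle δ) B (treeSetup c₀) (fun k s => k ≤ 300 * (n + 1) ∧
      TreeInv δ c₀ ε (Nat.log 2 n / 2) (2 * Nat.log 2 n) [((List.finRange n).reverse, 64)] 1 s)
      (initial n 0) := by
  have hlen : (List.finRange n).length = n := List.length_finRange
  rw [treeSetup, wp_seq]
  refine wp_mono _ ?_ _ (wp_treeParams hn hB)
  rintro k4 s4 ⟨hk4, h1, hregs, h5, h7, hR⟩
  rw [wp_seq]
  refine wp_fill (n := n) (by omega) h1 fun s5 harr h6 hN hR5 k5 hk5 => ?_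
  have eN : ∀ a, a < 60 → a ≠ 6 → a ≠ 10 → s5.N a = s4.N a := fun a h60 h6 h10 =>
    hN a (by omega) h6 h10 (by omega) (by omega)
  have e17 : s5.N 17 = 64 := by
    rw [eN _ (by norm_num) (by norm_num) (by norm_num), hregs.free]
  -- No distance is less than `0`, so the negated test with radius `0` selects all points.
  refine wp_pushSel (L := []) (List.finRange n) ⟨0, by omega⟩ 0 (fun _ => true)
    (fun q => by simpa using hδ _ q) (by omega) ?_ (by omega) ?_ ?_ harr ?_ ?_ trivial
    fun s6 hs6 h67 h617 hS6 k6 hk6 => ⟨?_, ⟨?_, ?_, ?_, ?_, ?_, ?_⟩,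
      ⟨?_, ?_, ?_, fun s' _ h => ?_⟩, ?_, ?_⟩
  · rw [List.filter_true, hlen]; simp; omega
  · rw [eN _ (by norm_num) (by norm_num) (by norm_num), h5]
  · rw [h6, hlen]
  · rw [hR5, hR]
  · rw [eN _ (by norm_num) (by norm_num) (by norm_num), h7]; rfl
  · rw [hlen] at hk6
    omega
  · rw [hs6.1 _ (by norm_num [EachReg, StkReg]), eN _ (by norm_num) (by norm_num) (by norm_num),
      hregs.zero]
  · rw [hs6.1 _ (by norm_num [EachReg, StkReg]), eN _ (by norm_num) (by norm_num) (by norm_num),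
      hregs.two]
  · rw [h617, e17]
  · rw [hs6.2 _ (by norm_num), hR5, hregs.factor]
  · rw [hs6.2 _ (by norm_num), hR5, hregs.upper]
  · rw [hs6.2 _ (by norm_num), hR5, hregs.balance]
  · simp
  · intro e he
    rw [List.mem_singleton] at he
    exact ⟨0, by norm_num, by rw [he]⟩
  · intro e he
    rw [List.mem_singleton] at he
    rw [he]
    refine ⟨List.nodup_reverse.2 (List.nodup_finRange n), ?_⟩
    rw [List.length_reverse, hlen]; omega
  · obtain ⟨T, hT, hT'⟩ := h _ List.mem_cons_self
    refine ⟨T, hT, ?_⟩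
    have : (List.finRange n).reverse.toFinset = Finset.univ := by ext; simp
    rwa [this] at hT'
  · rw [h67]; simp [stackList]
  · rw [List.filter_true, e17] at hS6
    simp only [stackList, List.length_reverse]
    exact hS6

def treeProgram (c₀ : ℕ) : Cmd := .seq (treeSetup c₀) (.seq treeLoop (.natConst 0 64))

theorem ert_treeProgram_le {δ : Fin n → Fin n → ℝ} {c₀ p : ℕ} {ε w : ℝ} {W U : ℕ → ℝ}
    {f : State → ℝ≥0∞} {F : ℝ≥0∞} (hn : 2 ≤ n) (hWU : IsTreePotential δ c₀ ε W U)
    (hB : 100 * w + 300 + c₀ ≤ B) (hδ : ∀ i j, 0 ≤ δ i j)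
    (hε : ε ≤ 1 / ((Nat.log 2 n : ℝ) / 2)) (hε' : 1 / (2 * (Nat.log 2 n : ℝ)) ≤ ε)
    (hp : ∀ l : List (Fin n), l.Nodup → 2 ≤ l.length →
      l.length ^ 3 ≤ p * goodTriples δ c₀ ((Nat.log 2 n : ℝ) / 2) (2 * (Nat.log 2 n : ℝ)) l)
    (hw : W n ≤ w)
    (hf : ∀ s', (∃ T : RingTree n, Stores s' (s'.N 0) T ∧
      T.IsRingTreeFor δ c₀ ε Finset.univ) → f s' ≤ F) :
    ert (oracle δ) B τ (treeProgram c₀) f (initial n 0)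
      ≤ τ * ENNReal.ofReal ((800 * p + 2000) * U n) + F := by
  have hlen : (List.finRange n).length = n := List.length_finRange
  have hn1 : (2 : ℝ) ≤ n := by exact_mod_cast hn
  have hnW := hWU.le_size n (by omega)
  have hWUn := hWU.size_le_time n (by omega)
  have hlog : (0 : ℝ) < Nat.log 2 n := by
    exact_mod_cast Nat.log_pos (by norm_num) hn
  have hB' : 20 * n + 200 + c₀ ≤ B := by
    have : (20 * n + 200 + c₀ : ℝ) ≤ B := by linarith
    exact_mod_cast this
  have key : ert (oracle δ) B τ (treeSetup c₀) (ert (oracle δ) B τ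
      (.seq treeLoop (.natConst 0 64)) f) (initial n 0)
      ≤ τ * ENNReal.ofReal (300 * (n + 1) + (1 + (2 * (p * 400 + 601) * U n + 1 + 1))) + F := by
    refine ert_le_of_wp (wp_treeSetup (ε := ε) hn hδ hB') ?_
    rintro k s ⟨hk, hs⟩
    have h1 := ert_treeLoop_le (B := B) (τ := τ) (f := ert (oracle δ) B τ (.natConst 0 64) f)
      (F := τ + F) (w := w) hWU (by linarith [show (0 : ℝ) ≤ c₀ from Nat.cast_nonneg _]) hδ
      (by positivity) (by positivity) hε hε' hp hs
      (by simpa [potSum] using hw) (by simp [potSum]; linarith) (by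
        intro M s' hs'
        rw [ert, if_pos (by omega)]
        gcongr
        obtain ⟨T, hT, hT'⟩ := hs'.part.complete (s'.setN 0 64) (fun k _ _ => ⟨fun i _ => by
          simp, fun i _ => rfl⟩) (by simp)
        exact hf _ ⟨T, by simpa using hT, hT'⟩)
    have e : potSum U [((List.finRange n).reverse, 64)] = U n := by simp [potSum]
    rw [e] at h1
    have hkR : (k : ℝ≥0∞) ≤ ENNReal.ofReal (300 * (n + 1)) := by
      rw [← ENNReal.ofReal_natCast]
      apply ENNReal.ofReal_le_ofReal
      exact_mod_cast hk
    have hU0 : 0 ≤ U n := by linarith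
    calc τ * k + ert (oracle δ) B τ (.seq treeLoop (.natConst 0 64)) f s
        ≤ τ * ENNReal.ofReal (300 * (n + 1)) + (τ + (τ *
          ENNReal.ofReal (2 * (p * 400 + 601) * U n + 1) + (τ + F))) := by
          rw [ert]; gcongr
      _ = τ * (ENNReal.ofReal (300 * (n + 1)) + (ENNReal.ofReal 1 + (ENNReal.ofReal
          (2 * (p * 400 + 601) * U n + 1) + ENNReal.ofReal 1))) + F := by
          rw [ENNReal.ofReal_one]; ring
      _ = _ := by
          rw [← ENNReal.ofReal_add (by positivity) (by norm_num),
            ← ENNReal.ofReal_add (by norm_num) (by positivity),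
            ← ENNReal.ofReal_add (by positivity) (by positivity)]
  rw [treeProgram, ert]
  have hU2 : 2 ≤ U n := by linarith
  calc _ ≤ τ + (τ * ENNReal.ofReal (300 * (n + 1) + (1 + (2 * (p * 400 + 601) * U n + 1 + 1))) + F) := by
        gcongr
    _ = τ * (ENNReal.ofReal 1
        + ENNReal.ofReal (300 * (n + 1) + (1 + (2 * (p * 400 + 601) * U n + 1 + 1)))) + F := by
        rw [ENNReal.ofReal_one]; ring
    _ ≤ _ := by
        rw [← ENNReal.ofReal_add (by norm_num) (by positivity)]
        refine cost_mono (ENNReal.ofReal_le_ofReal ?_) le_rfl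
        linarith

end RealRAM

/-! ### Size and depth of ring trees -/

namespace IsRingSeparator

variable {n : ℕ} {δ : Fin n → Fin n → ℝ} {c τ : ℝ} {Q : Finset (Fin n)} {m : Fin n} {r₁ r₂ : ℝ}

theorem card_pos (h : IsRingSeparator δ c τ Q m r₁ r₂) : (0 : ℝ) < Q.card := by
  exact_mod_cast Finset.card_pos.2 ⟨m, h.center_mem⟩

theorem card_inner (h : IsRingSeparator δ c τ Q m r₁ r₂) (hc : 0 < c) :
    (1 : ℝ) ≤ (pointsInBall δ Q m r₂).card ∧
      ((pointsInBall δ Q m r₂).card : ℝ) ≤ (1 - 1 / c) * Q.card := by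
  refine ⟨?_, h.outer_upper.le⟩
  have h1 : (0 : ℝ) < (pointsInBall δ Q m r₂).card :=
    (div_pos h.card_pos hc).trans h.outer_lower
  exact_mod_cast h1

theorem cast_card_outer (Q : Finset (Fin n)) (m : Fin n) (r₁ : ℝ) :
    ((Q \ pointsInBall δ Q m r₁).card : ℝ) = Q.card - (pointsInBall δ Q m r₁).card := by
  have hsub : pointsInBall δ Q m r₁ ⊆ Q := Finset.filter_subset _ _
  rw [Finset.card_sdiff_of_subset hsub, Nat.cast_sub (Finset.card_le_card hsub)]

theorem card_outer (h : IsRingSeparator δ c τ Q m r₁ r₂) (hc : 0 < c) :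
    (1 : ℝ) ≤ (Q \ pointsInBall δ Q m r₁).card ∧
      ((Q \ pointsInBall δ Q m r₁).card : ℝ) ≤ (1 - 1 / c) * Q.card := by
  have e : (1 - 1 / c) * (Q.card : ℝ) = Q.card - Q.card / c := by ring
  have h1 := h.inner_lower
  have h2 := h.inner_upper
  have h3 := div_pos h.card_pos hc
  have h4 : (0 : ℝ) < (Q \ pointsInBall δ Q m r₁).card := by
    rw [cast_card_outer]; linarith
  refine ⟨by exact_mod_cast h4, ?_⟩
  rw [cast_card_outer, e]; linarith

theorem card_add_card (h : IsRingSeparator δ c τ Q m r₁ r₂) :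
    ((pointsInBall δ Q m r₂).card : ℝ) + (Q \ pointsInBall δ Q m r₁).card ≤ (1 + τ) * Q.card := by
  have h1 := h.few_repeated
  have h2 : (pointsInBall δ Q m r₂).card ≤ (pointsInBall δ Q m r₂ \ pointsInBall δ Q m r₁).card
      + (pointsInBall δ Q m r₁).card := Finset.card_le_card_sdiff_add_card
  have h3 : ((pointsInBall δ Q m r₂).card : ℝ)
      ≤ (pointsInBall δ Q m r₂ \ pointsInBall δ Q m r₁).card + (pointsInBall δ Q m r₁).card := by
    exact_mod_cast h2
  rw [cast_card_outer]
  linarith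

end IsRingSeparator

/-- From `log (1 - 1/c) ≤ -1/c`. Multiplied by `c`: the quantity `c log s` drops by at least one
from a set to either child. -/
theorem log_le_of_le_mul {c s x : ℝ} (hs : 0 < s) (hx : 1 ≤ x)
    (h : x ≤ (1 - 1 / c) * s) : Real.log x ≤ Real.log s - 1 / c ∧ 0 < 1 - 1 / c := by
  have h1 : 0 < 1 - 1 / c := pos_of_mul_pos_left (lt_of_lt_of_le (by linarith) h) hs.le
  refine ⟨?_, h1⟩
  have h2 := Real.log_le_log (by linarith) h
  rw [Real.log_mul h1.ne' hs.ne'] at h2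
  linarith [Real.log_le_sub_one_of_pos h1]

/-- A bound for the number of leaves of a ring tree for `s` points. -/
noncomputable def leafBound (c τ : ℝ) (s : ℕ) : ℝ := (s : ℝ) ^ (1 + c * τ)

theorem le_leafBound {c τ : ℝ} (hc : 0 ≤ c) (hτ : 0 ≤ τ) {s : ℕ} (hs : 1 ≤ s) :
    (s : ℝ) ≤ leafBound c τ s := by
  have h1 : (1 : ℝ) ≤ s := by exact_mod_cast hs
  calc (s : ℝ) = (s : ℝ) ^ (1 : ℝ) := (Real.rpow_one _).symm
    _ ≤ _ := Real.rpow_le_rpow_of_exponent_le h1 (by have := mul_nonneg hc hτ; linarith)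

/-- Since `n^(1/log n) = e`, this choice of `τ` costs only a constant factor. -/
theorem leafBound_log (c : ℝ) {n : ℕ} (hn : 2 ≤ n) :
    leafBound c (1 / Real.log n) n = n * Real.exp c := by
  have h1 : (1 : ℝ) < n := by exact_mod_cast hn
  have h2 := Real.log_pos h1
  rw [leafBound, Real.rpow_add (by linarith), Real.rpow_one, Real.rpow_def_of_pos (by linarith)]
  congr 2
  field_simp

/-- A child with `x ≤ (1-1/c) s` points satisfies `x^(1+cτ) ≤ x s^(cτ) e^(-τ)`. The children
together have at most `(1+τ) s` points, and `(1+τ) e^(-τ) ≤ 1`: the loss by repeated points is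
balanced by the shrinking of the sets. -/
theorem leafBound_split {n : ℕ} {δ : Fin n → Fin n → ℝ} {c τ : ℝ} {Q : Finset (Fin n)} {m : Fin n}
    {r₁ r₂ : ℝ} (h : IsRingSeparator δ c τ Q m r₁ r₂) (hc : 0 < c) (hτ : 0 ≤ τ) :
    leafBound c τ (pointsInBall δ Q m r₂).card + leafBound c τ (Q \ pointsInBall δ Q m r₁).card
      ≤ leafBound c τ Q.card := by
  obtain ⟨a1, a2⟩ := h.card_inner hc
  obtain ⟨b1, b2⟩ := h.card_outer hc
  have hs := h.card_pos
  have hq := (log_le_of_le_mul hs a1 a2).2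
  set s : ℝ := (Q.card : ℝ) with hsdef
  set q := 1 - 1 / c with hqdef
  have hcτ : 0 ≤ c * τ := by positivity
  have key : ∀ x : ℝ, 1 ≤ x → x ≤ q * s → x ^ (1 + c * τ) ≤ x * (s ^ (c * τ) * Real.exp (-τ)) := by
    intro x hx hxs
    rw [Real.rpow_add (by linarith), Real.rpow_one]
    gcongr
    calc x ^ (c * τ) ≤ (q * s) ^ (c * τ) := Real.rpow_le_rpow (by linarith) hxs hcτ
      _ = s ^ (c * τ) * q ^ (c * τ) := by rw [Real.mul_rpow hq.le hs.le, mul_comm]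
      _ ≤ _ := by
        gcongr
        rw [Real.rpow_def_of_pos hq]
        apply Real.exp_le_exp.2
        have h1 := Real.log_le_sub_one_of_pos hq
        have h2 : Real.log q ≤ -(1 / c) := by linarith
        calc Real.log q * (c * τ) ≤ -(1 / c) * (c * τ) := by gcongr
          _ = -τ := by field_simp
  have e := h.card_add_card
  rw [← hsdef] at e
  have hexp : (1 + τ) * Real.exp (-τ) ≤ 1 := by
    have h1 := Real.add_one_le_exp τ
    calc (1 + τ) * Real.exp (-τ) ≤ Real.exp τ * Real.exp (-τ) := by gcongr; linarith
      _ = 1 := by rw [← Real.exp_add]; simp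
  have hpow : 0 ≤ s ^ (c * τ) := Real.rpow_nonneg hs.le _
  simp only [leafBound]
  rw [← hsdef]
  calc _ ≤ ((pointsInBall δ Q m r₂).card : ℝ) * (s ^ (c * τ) * Real.exp (-τ))
        + ((Q \ pointsInBall δ Q m r₁).card : ℝ) * (s ^ (c * τ) * Real.exp (-τ)) :=
        add_le_add (key _ a1 a2) (key _ b1 b2)
    _ = (((pointsInBall δ Q m r₂).card : ℝ) + (Q \ pointsInBall δ Q m r₁).card)
        * (s ^ (c * τ) * Real.exp (-τ)) := by ring
    _ ≤ ((1 + τ) * s) * (s ^ (c * τ) * Real.exp (-τ)) := by gcongr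
    _ = (s * s ^ (c * τ)) * ((1 + τ) * Real.exp (-τ)) := by ring
    _ ≤ (s * s ^ (c * τ)) * 1 := by gcongr
    _ = _ := by rw [mul_one, Real.rpow_add hs, Real.rpow_one]

namespace RealRAM

/-- Since `c log x + 1 ≤ c log s` for both children, their time potentials sum to at most `W s · c
log s`, which is the potential of the parent minus `W s`. -/
theorem isTreePotential_leafBound {n : ℕ} (δ : Fin n → Fin n → ℝ) {c₀ : ℕ} {τ : ℝ}
    (hc : 0 < c₀) (hτ : 0 ≤ τ) :
    IsTreePotential δ c₀ τ (leafBound c₀ τ) fun s => leafBound c₀ τ s * (c₀ * Real.log s + 1) := by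
  have hc' : (0 : ℝ) < c₀ := by exact_mod_cast hc
  have hlog : ∀ k : ℕ, 0 ≤ (c₀ : ℝ) * Real.log k := fun k =>
    mul_nonneg hc'.le (Real.log_natCast_nonneg k)
  have hL : ∀ k, 0 ≤ leafBound c₀ τ k := fun k => Real.rpow_nonneg (Nat.cast_nonneg k) _
  refine ⟨fun k hk => le_leafBound hc'.le hτ hk, fun k hk => ?_, fun Q m r₁ r₂ hQ h => ?_⟩
  · exact le_mul_of_one_le_right (hL k) (by linarith [hlog k])
  · have hsplit := leafBound_split h hc' hτ
    refine ⟨hsplit, ?_⟩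
    obtain ⟨a1, a2⟩ := h.card_inner hc'
    obtain ⟨b1, b2⟩ := h.card_outer hc'
    have hs := h.card_pos
    have key : ∀ x : ℕ, (1 : ℝ) ≤ x → (x : ℝ) ≤ (1 - 1 / c₀) * Q.card →
        leafBound c₀ τ x * (c₀ * Real.log x + 1) ≤ leafBound c₀ τ x * (c₀ * Real.log Q.card) := by
      intro x hx hxs
      refine mul_le_mul_of_nonneg_left ?_ (hL x)
      have h1 := mul_le_mul_of_nonneg_left (log_le_of_le_mul hs hx hxs).1 hc'.le
      rw [mul_sub, mul_one_div_cancel hc'.ne'] at h1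
      linarith
    have h1 := key _ a1 a2
    have h2 := key _ b1 b2
    have h3 := mul_le_mul_of_nonneg_right hsplit (hlog Q.card)
    linarith

end RealRAM

namespace RingTree

variable {n : ℕ} {δ : Fin n → Fin n → ℝ} {c c' τ : ℝ}

theorem IsRingTreeFor.mono (hc : 0 < c) (hcc : c ≤ c') {T : RingTree n} {Q : Finset (Fin n)}
    (h : T.IsRingTreeFor δ c τ Q) : T.IsRingTreeFor δ c' τ Q := by
  induction T generalizing Q with
  | leaf j => exact h
  | node m r₁ r₂ l r ihl ihr => exact ⟨h.1.mono hc hcc, ihl h.2.1, ihr h.2.2⟩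

theorem IsRingTreeFor.depth_le (hc : 0 < c) {T : RingTree n} {Q : Finset (Fin n)}
    (h : T.IsRingTreeFor δ c τ Q) : (T.depth : ℝ) ≤ c * Real.log Q.card := by
  induction T generalizing Q with
  | leaf j =>
    simp only [depth, Nat.cast_zero]
    exact mul_nonneg hc.le (Real.log_natCast_nonneg _)
  | node m r₁ r₂ l r ihl ihr =>
    have key : ∀ x : ℝ, 1 ≤ x → x ≤ (1 - 1 / c) * Q.card →
        c * Real.log x + 1 ≤ c * Real.log Q.card := by
      intro x hx hxs
      have h1 := mul_le_mul_of_nonneg_left (log_le_of_le_mul h.1.card_pos hx hxs).1 hc.le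
      rw [mul_sub, mul_one_div_cancel hc.ne'] at h1
      linarith
    have h1 := key _ (h.1.card_inner hc).1 (h.1.card_inner hc).2
    have h2 := key _ (h.1.card_outer hc).1 (h.1.card_outer hc).2
    have h3 := ihl h.2.1
    have h4 := ihr h.2.2
    simp only [depth]
    push_cast
    rcases max_cases (l.depth : ℝ) (r.depth : ℝ) with ⟨h, -⟩ | ⟨h, -⟩ <;> rw [h] <;> linarith

theorem IsRingTreeFor.size_le (hc : 0 < c) (hτ : 0 ≤ τ) {T : RingTree n} {Q : Finset (Fin n)}
    (h : T.IsRingTreeFor δ c τ Q) : (T.size : ℝ) + 1 ≤ 2 * leafBound c τ Q.card := by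
  induction T generalizing Q with
  | leaf j =>
    have hQ : Q = {j} := h
    rw [hQ]
    simp [size, leafBound]
    norm_num
  | node m r₁ r₂ l r ihl ihr =>
    have h1 := leafBound_split h.1 hc hτ
    have h3 := ihl h.2.1
    have h4 := ihr h.2.2
    simp only [size]
    push_cast
    linarith

end RingTree

open RealRAM in
-- The constant depends on the dimension and on the defect only through `N`. The factor `exp (72 N)`
-- comes from the leaf bound `n e^c` with `c = 72 N`, the balance constant that the program uses.
theorem computesRingTrees {d N : ℕ} {μ c C : ℝ} {F : Set (DistanceMeasure d)}
    (hF : ∀ X ∈ F, X.IsPremetric μ ∧ X.IsCovering (9 * (μ + 1)) N) (hN : 0 < N)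
    (hc : 72 * N ≤ c) (hC : 40000000 * (N : ℝ) ^ 2 * Real.exp (72 * N) ≤ C) :
    ComputesRingTrees F c C := by
  refine ⟨treeProgram (72 * N), fun X hXF n p hp hn => ?_⟩
  obtain ⟨hX, hcov⟩ := hF X hXF
  have hn2 : (2 : ℝ) ≤ n := by exact_mod_cast hn
  have hNr : (1 : ℝ) ≤ N := by exact_mod_cast hN
  have hNN : (1 : ℝ) ≤ (N : ℝ) ^ 2 := by nlinarith
  set δ := pairDist X p with hδdef
  have hδ : ∀ i j, 0 ≤ δ i j := fun i j => hX.nonneg (hp.2 i) (hp.2 j)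
  set e := Real.exp (72 * N) with he
  have hexp : 72 * (N : ℝ) + 1 ≤ e := Real.add_one_le_exp _
  have hcast : ((72 * N : ℕ) : ℝ) = 72 * N := by push_cast; ring
  have hlog2 := Real.log_two_gt_d9
  have hlog2' := Real.log_two_lt_d9
  set L : ℝ := (Nat.log 2 n : ℝ) with hL
  have hL1 : 1 ≤ L := by
    rw [hL]
    exact_mod_cast Nat.log_pos (by norm_num) hn
  -- With `2^L ≤ n < 2^(L+1)` and `1/2 < log 2 < 1`, the estimates `L/2` and `2L` are valid. Their
  -- ratio `4` is the one admitted in `le_goodTriples`.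
  have hlogn : L / 2 ≤ Real.log n := by
    have h1 : ((2 ^ Nat.log 2 n : ℕ) : ℝ) ≤ n := by
      exact_mod_cast Nat.pow_log_le_self 2 (by omega)
    push_cast at h1
    have h2 := Real.log_le_log (by positivity) h1
    rw [Real.log_pow] at h2
    nlinarith
  have hlogn' : Real.log n ≤ 2 * L := by
    have h1 : (n : ℝ) ≤ ((2 ^ (Nat.log 2 n + 1) : ℕ) : ℝ) := by
      exact_mod_cast (Nat.lt_pow_succ_log_self (by norm_num) n).le
    push_cast at h1
    have h2 := Real.log_le_log (by linarith) h1
    rw [Real.log_pow] at h2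
    push_cast at h2
    nlinarith
  have hlogn2 : Real.log 2 ≤ Real.log n := Real.log_le_log (by norm_num) hn2
  have hlogpos : 0 < Real.log n := by linarith
  set ε := 1 / Real.log n with hε
  have hε0 : 0 ≤ ε := by positivity
  have hWU := isTreePotential_leafBound δ (c₀ := 72 * N) (τ := ε) (by omega) hε0
  have hWn : leafBound ((72 * N : ℕ) : ℝ) ε n = n * e := by
    rw [hε, leafBound_log _ hn, hcast]
  set B : ℕ := ⌈100 * (n * e) + 300 + 72 * N⌉₊ with hBdef
  have hB : 100 * (n * e) + 300 + ((72 * N : ℕ) : ℝ) ≤ B := by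
    rw [hcast]; exact Nat.le_ceil _
  have hB' : (B : ℝ) ≤ C * n := by
    have h1 : (B : ℝ) < 100 * (n * e) + 300 + 72 * N + 1 := Nat.ceil_lt_add_one (by positivity)
    calc (B : ℝ) ≤ 100 * (n * e) + 300 * e * n := by nlinarith
      _ = 400 * 1 * e * n := by ring
      _ ≤ 40000000 * (N : ℝ) ^ 2 * e * n := by gcongr; norm_num
      _ ≤ C * n := by gcongr
  have hinit : ∀ i, (initial n 0).N i ≤ B := by
    intro i
    simp only [initial, Function.update_apply]
    split_ifs
    · have : (n : ℝ) ≤ B := by nlinarith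
      exact_mod_cast this
    · exact Nat.zero_le _
  have htime := ert_treeProgram_le (B := B) (τ := 1) (F := 0) (p := 20736 * N ^ 2) (w := n * e)
    (f := guarantee fun s => ∃ T : RingTree n, Stores s (s.N 0) T ∧
      T.IsRingTreeFor δ c ε Finset.univ ∧ (T.depth : ℝ) ≤ c * Real.log n ∧ (T.size : ℝ) ≤ C * n)
    hn hWU hB hδ (one_div_le_one_div_of_le (by positivity) hlogn)
    (one_div_le_one_div_of_le hlogpos hlogn')
    (fun l hl hlen => le_goodTriples hX hcov hp hN hl hlen (by linarith) (by linarith)) hWn.le (by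
      rintro s ⟨T, hT, hT'⟩
      have hc0 : (0 : ℝ) < ((72 * N : ℕ) : ℝ) := by rw [hcast]; linarith
      have hcard : ((Finset.univ : Finset (Fin n)).card : ℝ) = n := by simp
      refine guarantee_le ⟨T, hT, hT'.mono hc0 (by rwa [hcast]), ?_, ?_⟩ _
      · have h1 := hT'.depth_le hc0
        rw [hcard, hcast] at h1
        refine h1.trans ?_
        gcongr
      · have h1 := hT'.size_le hc0 hε0
        rw [Finset.card_fin, hWn] at h1
        calc (T.size : ℝ) ≤ 40000000 * 1 * e * n := by nlinarith [show 0 ≤ n * e by positivity]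
          _ ≤ 40000000 * (N : ℝ) ^ 2 * e * n := by gcongr
          _ ≤ C * n := by gcongr)
  rw [one_mul, add_zero] at htime
  have hne := ne_top_of_le_ne_top ENNReal.ofReal_ne_top htime
  refine ⟨(expectedTime_le hinit _).trans (htime.trans (ENNReal.ofReal_le_ofReal ?_)),
    memoryBounded_of_ert hinit hne hB', haltsOnlyWith_of_ert hinit hne⟩
  rw [hWn, hcast]
  push_cast
  have h1 : 72 * (N : ℝ) * Real.log n + 1 ≤ 2 * (c * Real.log n) := by
    have h2 : 72 * (N : ℝ) * Real.log n ≤ c * Real.log n := by gcongr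
    have h3 : 72 * 1 * Real.log n ≤ 72 * N * Real.log n := by gcongr
    linarith
  calc (800 * (20736 * (N : ℝ) ^ 2) + 2000) * (n * e * (72 * N * Real.log n + 1))
      ≤ (800 * (20736 * (N : ℝ) ^ 2) + 2000 * N ^ 2) * (n * e * (2 * (c * Real.log n))) := by
        gcongr; nlinarith
    _ = 33181600 * (N : ℝ) ^ 2 * e * (c * n * Real.log n) := by ring
    _ ≤ 40000000 * (N : ℝ) ^ 2 * e * (c * n * Real.log n) := by
        have : 0 ≤ c := by linarith
        gcongr; norm_num
    _ ≤ C * (c * n * Real.log n) := by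
        have : 0 ≤ c := by linarith
        gcongr

/-! ### Covering numbers -/

section

variable {d : ℕ} {X : DistanceMeasure d}

/-- The cell of `y` in a decomposition of the domain around `m`. -/
noncomputable def cellIndex (w : Fin d → ℝ → ℝ → ℝ) (ℓ : ℝ) (m y : Fin d → ℝ) (i : Fin d) :
    Bool × ℕ :=
  (decide (m i ≤ y i), ⌊w i (m i) (y i) / ℓ⌋₊)

open Classical in
/-- A reverse triangle inequality yields coverings. -/
theorem exists_cover_of_cellIndex {w : Fin d → ℝ → ℝ → ℝ} {m : Fin d → ℝ} {A r ℓ : ℝ}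
    (hw : ∀ i, ∀ u ∈ X.dom i, ∀ v ∈ X.dom i, 0 ≤ w i u v)
    (hrev : ∀ i, ∀ u ∈ X.dom i, ∀ v ∈ X.dom i, ∀ z ∈ X.dom i, (u ≤ v ∧ v ≤ z) ∨ (z ≤ v ∧ v ≤ u) →
      w i u v + w i v z ≤ w i u z)
    (hℓ : 0 < ℓ)
    (hdist : ∀ x ∈ X.carrier, ∀ y ∈ X.carrier, (∀ i, w i (x i) (y i) < ℓ) → X.dist x y < r)
    (hm : m ∈ X.carrier) (P : Finset (Fin d → ℝ)) (hP : ∀ y ∈ P, y ∈ X.carrier)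
    (I : Finset (Fin d → Bool × ℕ))
    (hI : ∀ y ∈ X.carrier, X.dist m y < A * r → cellIndex w ℓ m y ∈ I) :
    ∃ T : Finset (Fin d → ℝ), T.card ≤ I.card ∧ (∀ x ∈ T, x ∈ X.carrier) ∧
      ∀ y ∈ P, X.dist m y < A * r → ∃ x ∈ T, X.dist x y < r := by
  set C : (Fin d → Bool × ℕ) → Finset (Fin d → ℝ) := fun κ =>
    P.filter fun y => cellIndex w ℓ m y = κ with hC
  -- The corner takes from each coordinate the value nearest to `m` that occurs in the cell. It need
  -- not be an input point, but it lies in the domain, which is a product. Minima exist because only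
  -- finitely many points are covered.
  have hcorner : ∀ κ, (C κ).Nonempty → ∃ x ∈ X.carrier, ∀ y ∈ C κ, X.dist x y < r := by
    intro κ hκ
    have hmin : ∀ i, ∃ b ∈ C κ, ∀ y ∈ C κ, |b i - m i| ≤ |y i - m i| := fun i =>
      Finset.exists_min_image (C κ) (fun y => |y i - m i|) hκ
    choose b hb hb' using hmin
    have hCP : ∀ y ∈ C κ, y ∈ X.carrier ∧ cellIndex w ℓ m y = κ := fun y hy =>
      ⟨hP y (Finset.mem_filter.1 hy).1, (Finset.mem_filter.1 hy).2⟩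
    refine ⟨fun i => b i i, fun i => (hCP _ (hb i)).1 i, fun y hy =>
      hdist _ (fun i => (hCP _ (hb i)).1 i) y (hCP y hy).1 fun i => ?_⟩
    have e1 : cellIndex w ℓ m (b i) i = cellIndex w ℓ m y i := by
      rw [(hCP _ (hb i)).2, (hCP y hy).2]
    simp only [cellIndex, Prod.mk.injEq, decide_eq_decide] at e1
    have hle := hb' i y hy
    have hord : (m i ≤ b i i ∧ b i i ≤ y i) ∨ (y i ≤ b i i ∧ b i i ≤ m i) := by
      by_cases h : m i ≤ y i
      · have h' := e1.1.2 h
        rw [abs_of_nonneg (by linarith), abs_of_nonneg (by linarith)] at hle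
        exact Or.inl ⟨h', by linarith⟩
      · have h' : ¬ m i ≤ b i i := fun h' => h (e1.1.1 h')
        rw [not_le] at h h'
        rw [abs_of_neg (by linarith), abs_of_neg (by linarith)] at hle
        exact Or.inr ⟨by linarith, by linarith⟩
    have hbi := (hCP _ (hb i)).1 i
    have hyi := (hCP y hy).1 i
    -- The corner lies between `m` and `y`, so `w(b,y) ≤ w(m,y) - w(m,b)`, and this difference is
    -- below `ℓ` as both terms have the same floor.
    have h1 := hrev i (m i) (hm i) (b i i) hbi (y i) hyi hord
    have h2 : w i (m i) (y i) / ℓ < ⌊w i (m i) (y i) / ℓ⌋₊ + 1 := Nat.lt_floor_add_one _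
    have h3 : (⌊w i (m i) (b i i) / ℓ⌋₊ : ℝ) ≤ w i (m i) (b i i) / ℓ :=
      Nat.floor_le (div_nonneg (hw i _ (hm i) _ hbi) hℓ.le)
    rw [e1.2] at h3
    have h4 : w i (m i) (y i) / ℓ - w i (m i) (b i i) / ℓ < 1 := by linarith
    rw [← sub_div, div_lt_one hℓ] at h4
    linarith
  choose! x hx hx' using hcorner
  refine ⟨(I.filter fun κ => (C κ).Nonempty).image x,
    Finset.card_image_le.trans (Finset.card_filter_le _ _), ?_, ?_⟩
  · intro z hz
    obtain ⟨κ, hκ, rfl⟩ := Finset.mem_image.1 hz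
    exact hx κ (Finset.mem_filter.1 hκ).2
  · intro y hy hyr
    have hyC : y ∈ C (cellIndex w ℓ m y) := Finset.mem_filter.2 ⟨hy, rfl⟩
    exact ⟨_, Finset.mem_image_of_mem x (Finset.mem_filter.2 ⟨hI y (hP y hy) hyr, ⟨y, hyC⟩⟩),
      hx' _ ⟨y, hyC⟩ y hyC⟩

/-- The cells whose indices have a sum of at most `d A`. -/
noncomputable def simplexCells (d : ℕ) (A : ℝ) : Finset (Fin d → Bool × ℕ) :=
  (Fintype.piFinset fun _ => Finset.univ ×ˢ Finset.range (⌊d * A⌋₊ + 1)).filter fun κ =>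
    ((∑ i, (κ i).2 : ℕ) : ℝ) ≤ d * A

theorem mem_simplexCells {A : ℝ} {κ : Fin d → Bool × ℕ} :
    κ ∈ simplexCells d A ↔ ((∑ i, (κ i).2 : ℕ) : ℝ) ≤ d * A := by
  rw [simplexCells, Finset.mem_filter, and_iff_right_iff_imp]
  intro h
  rw [Fintype.mem_piFinset]
  intro i
  rw [Finset.mem_product]
  refine ⟨Finset.mem_univ _, Finset.mem_range.2 (Nat.lt_succ_iff.2 ?_)⟩
  refine (Finset.single_le_sum (f := fun i => (κ i).2) (fun _ _ => Nat.zero_le _)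
    (Finset.mem_univ i)).trans ?_
  exact Nat.le_floor h

theorem sum_piFinset_prod_pow (S : Finset (Bool × ℕ)) (x : ℝ) :
    ∑ κ ∈ Fintype.piFinset fun _ : Fin d => S, ∏ i, x ^ (κ i).2 = (∑ z ∈ S, x ^ z.2) ^ d := by
  rw [← Finset.prod_univ_sum (fun _ : Fin d => S) (fun _ z => x ^ z.2), Finset.prod_const,
    Finset.card_univ, Fintype.card_fin]

/-- Generating function: weight a cell by `x` to the sum of its indices, with `x = A/(A+1)`. Each
cell has weight at least `x^(dA) ≥ e^(-d)`, while the total weight is at most `(2/(1-x))^d =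
(2(A+1))^d`. A box around the simplex would cost an additional factor of order `d^d`. -/
theorem card_simplexCells_le {A : ℝ} (hA : 0 < A) :
    ((simplexCells d A).card : ℝ) ≤ (2 * Real.exp 1 * (A + 1)) ^ d := by
  set x : ℝ := A / (A + 1) with hx
  have hx0 : 0 < x := by positivity
  have hx1 : x < 1 := by rw [hx, div_lt_one (by linarith)]; linarith
  have hinv : 1 - x = 1 / (A + 1) := by rw [hx]; field_simp; ring
  have hexp : Real.exp (-(1 / A)) ≤ x := by
    rw [Real.exp_neg, inv_le_comm₀ (Real.exp_pos _) hx0]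
    have h1 := Real.add_one_le_exp (1 / A)
    have h2 : x⁻¹ = 1 / A + 1 := by rw [hx]; field_simp; ring
    rw [h2]
    exact h1
  have hlow : ∀ κ ∈ simplexCells d A, Real.exp (-1) ^ d ≤ ∏ i, x ^ (κ i).2 := by
    intro κ hκ
    rw [mem_simplexCells] at hκ
    rw [Finset.prod_pow_eq_pow_sum]
    calc Real.exp (-1) ^ d = Real.exp (-d) := by rw [← Real.exp_nat_mul]; ring_nf
      _ ≤ Real.exp (((∑ i, (κ i).2 : ℕ) : ℝ) * (-(1 / A))) := by
        apply Real.exp_le_exp.2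
        rw [mul_neg, neg_le_neg_iff, mul_one_div, div_le_iff₀ hA]
        exact hκ
      _ = Real.exp (-(1 / A)) ^ (∑ i, (κ i).2) := by rw [Real.exp_nat_mul]
      _ ≤ _ := by gcongr
  have hgeom : ∀ N : ℕ, ∑ k ∈ Finset.range N, x ^ k ≤ A + 1 := by
    intro N
    have h1 := geom_sum_mul_neg x N
    rw [hinv] at h1
    have h2 : ∑ k ∈ Finset.range N, x ^ k = (1 - x ^ N) * (A + 1) := by
      rw [← h1]; field_simp
    rw [h2]
    have : 0 < x ^ N := by positivity
    nlinarith
  have hsum : ((simplexCells d A).card : ℝ) * Real.exp (-1) ^ d ≤ (2 * (A + 1)) ^ d := by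
    rw [← nsmul_eq_mul]
    calc (simplexCells d A).card • Real.exp (-1) ^ d
        ≤ ∑ κ ∈ simplexCells d A, ∏ i, x ^ (κ i).2 := Finset.card_nsmul_le_sum _ _ _ hlow
      _ ≤ ∑ κ ∈ Fintype.piFinset fun _ : Fin d =>
          (Finset.univ : Finset Bool) ×ˢ Finset.range (⌊d * A⌋₊ + 1), ∏ i, x ^ (κ i).2 :=
          Finset.sum_le_sum_of_subset_of_nonneg (Finset.filter_subset _ _) fun κ _ _ =>
            Finset.prod_nonneg fun i _ => by positivity
      _ = (∑ z ∈ (Finset.univ : Finset Bool) ×ˢ Finset.range (⌊d * A⌋₊ + 1), x ^ z.2) ^ d :=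
          sum_piFinset_prod_pow _ _
      _ ≤ (2 * (A + 1)) ^ d := by
          refine pow_le_pow_left₀ (Finset.sum_nonneg fun z _ => by positivity) ?_ d
          rw [Finset.sum_product]
          simp only [Finset.sum_const, Finset.card_univ, Fintype.card_bool, nsmul_eq_mul]
          push_cast
          linarith [hgeom (⌊d * A⌋₊ + 1)]
  calc ((simplexCells d A).card : ℝ)
      = (simplexCells d A).card * Real.exp (-1) ^ d * Real.exp 1 ^ d := by
        rw [mul_assoc, ← mul_pow, ← Real.exp_add]; simp
    _ ≤ (2 * (A + 1)) ^ d * Real.exp 1 ^ d := by gcongr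
    _ = _ := by rw [← mul_pow]; ring

/-- The cells with bounded indices. -/
def boxCells (d q : ℕ) : Finset (Fin d → Bool × ℕ) :=
  Fintype.piFinset fun _ => Finset.univ ×ˢ Finset.range (q + 1)

theorem card_boxCells (d q : ℕ) : (boxCells d q).card = (2 * (q + 1)) ^ d := by
  rw [boxCells, Fintype.card_piFinset]
  simp

end

/-! ### General symmetric distance measures -/

section

variable {d : ℕ} {X : DistanceMeasure d} {Δ μ : ℝ}

theorem DistanceMeasure.update_mem_carrier {x : Fin d → ℝ} (hx : x ∈ X.carrier) {i : Fin d} {u : ℝ}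
    (hu : u ∈ X.dom i) : Function.update x i u ∈ X.carrier := by
  intro j
  by_cases h : j = i
  · subst h; simpa using hu
  · simpa [h] using hx j

theorem DistanceMeasure.line_mem_eq {x y : Fin d → ℝ} {i : Fin d} :
    X.line x i (x i) (y i) = X.dist x (Function.update x i (y i)) := by
  rw [DistanceMeasure.line, Function.update_eq_self]

/-- Nonnegativity comes from decomposability: `D(x,y) = g(∑ f) ≥ g(0) = D(x,x) = 0`. -/
theorem GeneralSymmetric.isPremetric (hX : X ∈ GeneralSymmetric d Δ μ) : X.IsPremetric μ := by
  obtain ⟨hrefl, -, -, -, ⟨g, f, hg, hf0, hf, hgf⟩, -, hdef⟩ := hX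
  have hself : ∀ x ∈ X.carrier, X.dist x x = 0 := fun x hx => (hrefl x hx x hx).2 rfl
  refine ⟨hself, fun x hx y hy hxy => ?_, hdef⟩
  refine lt_of_le_of_ne ?_ fun h => hxy ((hrefl x hx y hy).1 h.symm)
  have h1 := hself x hx
  rw [hgf x hx x hx] at h1
  rw [hgf x hx y hy, ← h1]
  refine hg (Set.mem_Ici.2 ?_) (Set.mem_Ici.2 ?_) (Finset.sum_le_sum fun i _ => ?_)
  · exact Finset.sum_nonneg fun i _ => hf i _ (hx i) _ (hx i)
  · exact Finset.sum_nonneg fun i _ => hf i _ (hx i) _ (hy i)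
  · rw [hf0 i _ (hx i)]
    exact hf i _ (hx i) _ (hy i)

/-- A box with a single nondegenerate side has that side as its diagonal. -/
theorem GeneralSymmetric.one_le (hX : X ∈ GeneralSymmetric d Δ μ) {x y : Fin d → ℝ}
    (hx : x ∈ X.carrier) (hy : y ∈ X.carrier) (hxy : x ≠ y) : 1 ≤ Δ := by
  have hP := GeneralSymmetric.isPremetric hX
  obtain ⟨-, -, -, -, -, hbox, -⟩ := hX
  obtain ⟨i, hi⟩ := Function.ne_iff.1 hxy
  have hz := X.update_mem_carrier hx (hy i)
  have hpos : 0 < X.dist x (Function.update x i (y i)) :=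
    hP.pos x hx _ hz fun h => hi (by rw [h]; simp)
  have h1 := hbox x hx _ hz (X.dist x (Function.update x i (y i))) fun j => by
    rw [DistanceMeasure.line_mem_eq]
    by_cases h : j = i
    · subst h; simp
    · rw [Function.update_of_ne h, Function.update_eq_self, hP.self x hx]
      exact hpos.le
  nlinarith

/-- The other coordinates agree and contribute `f j u u = 0`. Lengths along an axis thus do not
depend on the line, and cells can be defined from the lines through `m` alone. -/
theorem DistanceMeasure.IsDecomposable.line_eq (hX : X.IsDecomposable) {x y : Fin d → ℝ}
    (hx : x ∈ X.carrier) (hy : y ∈ X.carrier) {i : Fin d} {u v : ℝ} (hu : u ∈ X.dom i)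
    (hv : v ∈ X.dom i) : X.line x i u v = X.line y i u v := by
  obtain ⟨g, f, -, hf0, -, hgf⟩ := hX
  rw [line, line, hgf _ (update_mem_carrier hx hu) _ (update_mem_carrier hx hv),
    hgf _ (update_mem_carrier hy hu) _ (update_mem_carrier hy hv)]
  congr 1
  refine Finset.sum_congr rfl fun j _ => ?_
  by_cases h : j = i
  · subst h; simp
  · simp only [Function.update_of_ne h]
    rw [hf0 j _ (hx j), hf0 j _ (hy j)]

theorem DistanceMeasure.IsDecomposable.line_le (hX : X.IsDecomposable) {x y : Fin d → ℝ}
    (hx : x ∈ X.carrier) (hy : y ∈ X.carrier) (i : Fin d) :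
    X.line x i (x i) (y i) ≤ X.dist x y := by
  obtain ⟨g, f, hg, hf0, hf, hgf⟩ := hX
  have hz := X.update_mem_carrier hx (hy i)
  rw [line_mem_eq, hgf _ hx _ hz, hgf _ hx _ hy]
  refine hg (Set.mem_Ici.2 ?_) (Set.mem_Ici.2 ?_) (Finset.sum_le_sum fun j _ => ?_)
  · exact Finset.sum_nonneg fun j _ => hf j _ (hx j) _ (hz j)
  · exact Finset.sum_nonneg fun j _ => hf j _ (hx j) _ (hy j)
  · by_cases h : j = i
    · subst h; simp
    · rw [Function.update_of_ne h, hf0 j _ (hx j)]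
      exact hf j _ (hx j) _ (hy j)

/-- Cells of width `r/(2Δ)` have diameter at most `r/2`; the halving makes the final inequality
strict. Sides are no longer than the distance, so the index in each coordinate is at most `2ΔA`. -/
theorem GeneralSymmetric.isCovering (hX : X ∈ GeneralSymmetric d Δ μ) (hΔ : 0 < Δ) {A : ℝ} :
    X.IsCovering A ((2 * (⌊2 * Δ * A⌋₊ + 1)) ^ d) := by
  have hP := GeneralSymmetric.isPremetric hX
  obtain ⟨-, hsymm, -, hrev, hdec, hbox, -⟩ := hX
  intro P hPX m hm r hr
  rw [← card_boxCells]
  have hline : ∀ i, ∀ u ∈ X.dom i, ∀ v ∈ X.dom i, X.line m i u v = X.line m i v u :=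
    fun i u hu v hv => hsymm _ (X.update_mem_carrier hm hu) _ (X.update_mem_carrier hm hv)
  refine exists_cover_of_cellIndex (w := fun i u v => X.line m i u v) (ℓ := r / (2 * Δ))
    (fun i u hu v hv => hP.nonneg (X.update_mem_carrier hm hu) (X.update_mem_carrier hm hv))
    (fun i u hu v hv z hz h => ?_) (by positivity) (fun x hx y hy h => ?_) hm P hPX _
    (fun y hy h => ?_)
  · rcases h with ⟨h1, h2⟩ | ⟨h1, h2⟩
    · exact hrev m hm i u hu v hv z hz h1 h2
    · have := hrev m hm i z hz v hv u hu h1 h2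
      rw [hline i u hu v hv, hline i v hv z hz, hline i u hu z hz]
      linarith
  · have h1 := hbox x hx y hy (r / (2 * Δ)) fun i => by
      rw [hdec.line_eq hx hm (hx i) (hy i)]
      exact (h i).le
    have h2 : Δ * (r / (2 * Δ)) = r / 2 := by field_simp
    linarith
  · rw [boxCells, Fintype.mem_piFinset]
    intro i
    rw [Finset.mem_product]
    refine ⟨Finset.mem_univ _, Finset.mem_range.2 (Nat.lt_succ_iff.2 (Nat.floor_le_floor ?_))⟩
    have h1 := hdec.line_le hm hy i
    rw [div_div_eq_mul_div, div_le_iff₀ hr]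
    nlinarith

end

/-! ### Bregman divergences -/

section

variable {S : Set ℝ} {f : ℝ → ℝ}

/-- The Bregman divergence of a function of one variable. -/
noncomputable def bregmanTerm (S : Set ℝ) (f : ℝ → ℝ) (u v : ℝ) : ℝ :=
  f u - f v - derivWithin f S v * (u - v)

theorem bregmanTerm_self (u : ℝ) : bregmanTerm S f u u = 0 := by
  simp [bregmanTerm]

theorem bregmanTerm_pos (hf : StrictConvexOn ℝ S f) (hf' : DifferentiableOn ℝ f S) {u v : ℝ}
    (hu : u ∈ S) (hv : v ∈ S) (huv : u ≠ v) : 0 < bregmanTerm S f u v := by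
  rw [bregmanTerm]
  rcases lt_or_gt_of_ne huv with h | h
  · have h1 := hf.slope_lt_derivWithin hu hv h (hf' v hv)
    rw [slope_def_field, div_lt_iff₀ (by linarith)] at h1
    linarith
  · have h1 := hf.derivWithin_lt_slope hv hu h (hf' v hv)
    rw [slope_def_field, lt_div_iff₀ (by linarith)] at h1
    linarith

theorem bregmanTerm_nonneg (hf : StrictConvexOn ℝ S f) (hf' : DifferentiableOn ℝ f S) {u v : ℝ}
    (hu : u ∈ S) (hv : v ∈ S) : 0 ≤ bregmanTerm S f u v := by
  by_cases h : u = v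
  · rw [h, bregmanTerm_self]
  · exact (bregmanTerm_pos hf hf' hu hv h).le

/-- The three-point identity: the defect of the inequality is `(f' z - f' v) (v - u)`, which is
nonnegative for `v` between `u` and `z` as `f'` is monotone. -/
theorem bregmanTerm_add_le (hf : StrictConvexOn ℝ S f) (hf' : DifferentiableOn ℝ f S) {u v z : ℝ}
    (hv : v ∈ S) (hz : z ∈ S) (h : (u ≤ v ∧ v ≤ z) ∨ (z ≤ v ∧ v ≤ u)) :
    bregmanTerm S f u v + bregmanTerm S f v z ≤ bregmanTerm S f u z := by
  have hmono := hf.convexOn.monotoneOn_derivWithin hf'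
  have key : 0 ≤ (derivWithin f S z - derivWithin f S v) * (v - u) := by
    rcases h with ⟨h1, h2⟩ | ⟨h1, h2⟩
    · exact mul_nonneg (sub_nonneg.2 (hmono hv hz h2)) (by linarith)
    · exact mul_nonneg_of_nonpos_of_nonpos (sub_nonpos.2 (hmono hz hv h1)) (by linarith)
  simp only [bregmanTerm]
  linarith

/-- The symmetrized Bregman divergence of a function of one variable. -/
noncomputable def symBregmanTerm (S : Set ℝ) (f : ℝ → ℝ) (u v : ℝ) : ℝ :=
  (bregmanTerm S f u v + bregmanTerm S f v u) / 2

theorem symBregmanTerm_eq (u v : ℝ) :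
    symBregmanTerm S f u v = (derivWithin f S v - derivWithin f S u) * (v - u) / 2 := by
  simp only [symBregmanTerm, bregmanTerm]
  ring

/-- The Cauchy–Schwarz inequality for `(√a, √a')` and `(√b, √b')`. -/
theorem sqrt_mul_add_sqrt_mul_le {a b a' b' : ℝ} (ha : 0 ≤ a) (hb : 0 ≤ b) (ha' : 0 ≤ a')
    (hb' : 0 ≤ b') : √(a * b) + √(a' * b') ≤ √((a + a') * (b + b')) := by
  refine Real.le_sqrt_of_sq_le ?_
  rw [add_sq, Real.sq_sqrt (by positivity), Real.sq_sqrt (by positivity), mul_assoc,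
    ← Real.sqrt_mul (by positivity)]
  have h1 : √(a * b * (a' * b')) ≤ (a * b' + a' * b) / 2 := by
    refine Real.sqrt_le_iff.2 ⟨by positivity, ?_⟩
    nlinarith [sq_nonneg (a * b' - a' * b)]
  nlinarith

/-- The symmetrized term is half the product of the increments of `f'` and of the argument. Both are
additive and of equal sign along a monotone triple, so Cauchy–Schwarz applies. -/
theorem sqrt_symBregmanTerm_add_le (hf : StrictConvexOn ℝ S f) (hf' : DifferentiableOn ℝ f S)
    {u v z : ℝ} (hu : u ∈ S) (hv : v ∈ S) (hz : z ∈ S)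
    (h : (u ≤ v ∧ v ≤ z) ∨ (z ≤ v ∧ v ≤ u)) :
    √(symBregmanTerm S f u v) + √(symBregmanTerm S f v z) ≤ √(symBregmanTerm S f u z) := by
  have hmono := hf.convexOn.monotoneOn_derivWithin hf'
  simp only [symBregmanTerm_eq]
  rcases h with ⟨h1, h2⟩ | ⟨h1, h2⟩
  · have h3 := hmono hu hv h1
    have h4 := hmono hv hz h2
    convert sqrt_mul_add_sqrt_mul_le (a := derivWithin f S v - derivWithin f S u)
      (b := (v - u) / 2) (a' := derivWithin f S z - derivWithin f S v) (b' := (z - v) / 2)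
      (by linarith) (by linarith) (by linarith) (by linarith) using 3 <;> ring_nf
  · have h3 := hmono hz hv h1
    have h4 := hmono hv hu h2
    convert sqrt_mul_add_sqrt_mul_le (a := derivWithin f S u - derivWithin f S v)
      (b := (u - v) / 2) (a' := derivWithin f S v - derivWithin f S z) (b' := (v - z) / 2)
      (by linarith) (by linarith) (by linarith) (by linarith) using 3 <;> ring_nf

end

section

variable {d : ℕ} {X : DistanceMeasure d} {μ : ℝ}

theorem bregmanDiv_eq_sum (M : Fin d → Set ℝ) (φ : Fin d → ℝ → ℝ) (x y : Fin d → ℝ) :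
    bregmanDiv M φ x y = ∑ i, bregmanTerm (M i) (φ i) (x i) (y i) := rfl

theorem symBregmanDiv_eq_sum (M : Fin d → Set ℝ) (φ : Fin d → ℝ → ℝ) (x y : Fin d → ℝ) :
    symBregmanDiv M φ x y = ∑ i, symBregmanTerm (M i) (φ i) (x i) (y i) := by
  simp only [symBregmanDiv, bregmanDiv_eq_sum, symBregmanTerm]
  rw [← Finset.sum_add_distrib, Finset.sum_div]

/-- The square root of a sum of positive definite terms, one for each coordinate. -/
theorem DistanceMeasure.isPremetric_sqrt_sum {t : Fin d → ℝ → ℝ → ℝ}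
    (hX : X.dist = fun x y => √(∑ i, t i (x i) (y i))) (hself : ∀ i u, t i u u = 0)
    (hpos : ∀ i, ∀ u ∈ X.dom i, ∀ v ∈ X.dom i, u ≠ v → 0 < t i u v) (hdef : X.IsDefective μ) :
    X.IsPremetric μ := by
  refine ⟨fun x _ => by rw [hX]; simp [hself], fun x hx y hy hxy => ?_, hdef⟩
  rw [hX]
  obtain ⟨i, hi⟩ := Function.ne_iff.1 hxy
  refine Real.sqrt_pos.2 (Finset.sum_pos' (fun j _ => ?_)
    ⟨i, Finset.mem_univ i, hpos i _ (hx i) _ (hy i) hi⟩)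
  by_cases h : x j = y j
  · rw [h, hself]
  · exact (hpos j _ (hx j) _ (hy j) h).le

theorem SqrtSymBregman.isPremetric (hX : X ∈ SqrtSymBregman d μ) : X.IsPremetric μ := by
  obtain ⟨⟨φ, hφ, hdist⟩, hdef⟩ := hX
  simp only [symBregmanDiv_eq_sum] at hdist
  refine X.isPremetric_sqrt_sum hdist (fun i u => by simp [symBregmanTerm, bregmanTerm_self])
    (fun i u hu v hv huv => ?_) hdef
  have h1 := bregmanTerm_pos (hφ i).1 (hφ i).2 hu hv huv
  have h2 := bregmanTerm_pos (hφ i).1 (hφ i).2 hv hu huv.symm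
  rw [symBregmanTerm]
  linarith

theorem SqrtBregman.isPremetric (hX : X ∈ SqrtBregman d μ) : X.IsPremetric μ := by
  obtain ⟨⟨φ, hφ, hdist⟩, hdef⟩ := hX
  simp only [bregmanDiv_eq_sum] at hdist
  exact X.isPremetric_sqrt_sum hdist (fun i u => bregmanTerm_self u)
    (fun i u hu v hv huv => bregmanTerm_pos (hφ i).1 (hφ i).2 hu hv huv) hdef

/-- The reverse triangle inequality is used for the divergence itself rather than its root, so radii
are squared and `A` becomes `A²`. The divergence is a sum over coordinates; with cells of width
`r²/d` this sum limits the indices to a simplex. -/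
theorem SqrtBregman.isCovering (hd : 0 < d) (hX : X ∈ SqrtBregman d μ) {A : ℝ} (hA : 0 < A) :
    X.IsCovering A (simplexCells d (A ^ 2)).card := by
  obtain ⟨⟨φ, hφ, hdist⟩, -⟩ := hX
  simp only [bregmanDiv_eq_sum] at hdist
  intro P hPX m hm r hr
  have hd' : (0 : ℝ) < d := by exact_mod_cast hd
  have : Nonempty (Fin d) := ⟨⟨0, hd⟩⟩
  have hnn : ∀ i, ∀ u ∈ X.dom i, ∀ v ∈ X.dom i, 0 ≤ bregmanTerm (X.dom i) (φ i) u v :=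
    fun i u hu v hv => bregmanTerm_nonneg (hφ i).1 (hφ i).2 hu hv
  refine exists_cover_of_cellIndex (w := fun i => bregmanTerm (X.dom i) (φ i)) (ℓ := r ^ 2 / d)
    hnn (fun i u hu v hv z hz h => bregmanTerm_add_le (hφ i).1 (hφ i).2 hv hz h)
    (by positivity) (fun x hx y hy h => ?_) hm P hPX _ (fun y hy h => ?_)
  · rw [hdist, Real.sqrt_lt' hr]
    calc ∑ i, bregmanTerm (X.dom i) (φ i) (x i) (y i) < ∑ _i : Fin d, r ^ 2 / d :=
          Finset.sum_lt_sum_of_nonempty Finset.univ_nonempty fun i _ => h i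
      _ = r ^ 2 := by
          rw [Finset.sum_const, Finset.card_univ, Fintype.card_fin, nsmul_eq_mul]
          field_simp
  · rw [hdist, Real.sqrt_lt' (by positivity)] at h
    rw [mem_simplexCells]
    push_cast
    calc ∑ i, ((cellIndex (fun i => bregmanTerm (X.dom i) (φ i)) (r ^ 2 / d) m y i).2 : ℝ)
        ≤ ∑ i, bregmanTerm (X.dom i) (φ i) (m i) (y i) / (r ^ 2 / d) :=
          Finset.sum_le_sum fun i _ => Nat.floor_le
            (div_nonneg (hnn i _ (hm i) _ (hy i)) (by positivity))
      _ = (∑ i, bregmanTerm (X.dom i) (φ i) (m i) (y i)) / (r ^ 2 / d) :=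
          (Finset.sum_div _ _ _).symm
      _ ≤ d * A ^ 2 := by
          rw [div_le_iff₀ (by positivity)]
          refine h.le.trans_eq ?_
          field_simp

/-- Here the roots satisfy the reverse triangle inequality. Cells have width `r/√d`, and
Cauchy–Schwarz turns the bound for the sum of squares into the bound `√d A r` for the sum, that is,
`d A` for the indices. -/
theorem SqrtSymBregman.isCovering (hd : 0 < d) (hX : X ∈ SqrtSymBregman d μ) {A : ℝ}
    (hA : 0 < A) : X.IsCovering A (simplexCells d A).card := by
  obtain ⟨⟨φ, hφ, hdist⟩, -⟩ := hX
  simp only [symBregmanDiv_eq_sum] at hdist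
  intro P hPX m hm r hr
  have hd' : (0 : ℝ) < d := by exact_mod_cast hd
  have : Nonempty (Fin d) := ⟨⟨0, hd⟩⟩
  set w : Fin d → ℝ → ℝ → ℝ := fun i u v => √(symBregmanTerm (X.dom i) (φ i) u v) with hw
  have hsq : ∀ x ∈ X.carrier, ∀ y ∈ X.carrier,
      ∑ i, symBregmanTerm (X.dom i) (φ i) (x i) (y i) = ∑ i, w i (x i) (y i) ^ 2 := by
    intro x hx y hy
    refine Finset.sum_congr rfl fun i _ => (Real.sq_sqrt ?_).symm
    have h1 := bregmanTerm_nonneg (hφ i).1 (hφ i).2 (hx i) (hy i)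
    have h2 := bregmanTerm_nonneg (hφ i).1 (hφ i).2 (hy i) (hx i)
    rw [symBregmanTerm]
    linarith
  have hnn : ∀ i u v, 0 ≤ w i u v := fun i u v => Real.sqrt_nonneg _
  refine exists_cover_of_cellIndex (w := w) (ℓ := r / √d)
    (fun i u _ v _ => hnn i u v)
    (fun i u hu v hv z hz h => sqrt_symBregmanTerm_add_le (hφ i).1 (hφ i).2 hu hv hz h)
    (by positivity) (fun x hx y hy h => ?_) hm P hPX _ (fun y hy h => ?_)
  · rw [hdist, Real.sqrt_lt' hr, hsq x hx y hy]
    calc ∑ i, w i (x i) (y i) ^ 2 < ∑ _i : Fin d, (r / √d) ^ 2 :=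
          Finset.sum_lt_sum_of_nonempty Finset.univ_nonempty fun i _ =>
            pow_lt_pow_left₀ (h i) (hnn _ _ _) two_ne_zero
      _ = r ^ 2 := by
          rw [Finset.sum_const, Finset.card_univ, Fintype.card_fin, nsmul_eq_mul, div_pow,
            Real.sq_sqrt hd'.le]
          field_simp
  · rw [hdist, Real.sqrt_lt' (by positivity), hsq m hm y hy] at h
    rw [mem_simplexCells]
    have hcs : ∑ i, w i (m i) (y i) ≤ √d * (A * r) := by
      refine (sq_le_sq₀ (Finset.sum_nonneg fun i _ => hnn _ _ _) (by positivity)).1 ?_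
      rw [mul_pow, Real.sq_sqrt hd'.le]
      have h1 := sq_sum_le_card_mul_sum_sq (s := Finset.univ) (f := fun i => w i (m i) (y i))
      rw [Finset.card_univ, Fintype.card_fin] at h1
      exact h1.trans (mul_le_mul_of_nonneg_left h.le hd'.le)
    push_cast
    calc ∑ i, ((cellIndex w (r / √d) m y i).2 : ℝ)
        ≤ ∑ i, w i (m i) (y i) / (r / √d) :=
          Finset.sum_le_sum fun i _ => Nat.floor_le (div_nonneg (hnn _ _ _) (by positivity))
      _ = (∑ i, w i (m i) (y i)) / (r / √d) := (Finset.sum_div _ _ _).symm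
      _ ≤ d * A := by
          rw [div_le_iff₀ (by positivity)]
          refine hcs.trans_eq ?_
          have h5 : √(d : ℝ) * √d = d := Real.mul_self_sqrt hd'.le
          rw [mul_div_assoc', eq_div_iff (Real.sqrt_pos.2 hd').ne']
          linear_combination A * r * h5

end

/-! ### The three families -/

section

variable {d : ℕ} {F : Set (DistanceMeasure d)} {μ : ℝ}

theorem ComputesApproxBalls.mono {C C' : ℝ} (h : ComputesApproxBalls F μ C) (hC : C ≤ C') :
    ComputesApproxBalls F μ C' := by
  obtain ⟨P, hP⟩ := h
  refine ⟨P, fun X hX n p hp c hc hcn => ?_⟩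
  obtain ⟨h1, h2, h3, h4⟩ := hP X hX n p hp c hc hcn
  refine ⟨h1.trans (ENNReal.ofReal_le_ofReal ?_), fun k κ hκ i => (h2 k κ hκ i).trans ?_, h3, h4⟩
  · exact mul_le_mul_of_nonneg_right hC (by positivity)
  · exact mul_le_mul_of_nonneg_right hC (by positivity)

theorem IsPointSet.nontrivial_carrier {n : ℕ} {X : DistanceMeasure d} {p : Fin n → Fin d → ℝ}
    (hp : IsPointSet X p) (hn : 2 ≤ n) : X.carrier.Nontrivial :=
  ⟨p ⟨0, by omega⟩, hp.2 _, p ⟨1, by omega⟩, hp.2 _, hp.1.ne (by simp)⟩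

/-- If no domain of the family has two points, there are no admissible inputs and any program will
do. Otherwise two distinct points force `0 < d`, `1 ≤ μ` and, for general distances, `1 ≤ Δ`, on
which the estimates of `c` depend. -/
theorem exists_computesRingSeparators_and_computesRingTrees {c : ℝ} {N : ℕ}
    (h : (∃ X ∈ F, X.carrier.Nontrivial) →
      (∀ X ∈ F, X.IsPremetric μ ∧ X.IsCovering (9 * (μ + 1)) N) ∧ 0 < N ∧ 72 * (N : ℝ) ≤ c) :
    ∃ C : ℝ, 0 < C ∧ ComputesRingSeparators F c C ∧ ComputesRingTrees F c C := by
  by_cases hF : ∃ X ∈ F, X.carrier.Nontrivial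
  · obtain ⟨h1, h2, h3⟩ := h hF
    have hN : (0 : ℝ) < N := by exact_mod_cast h2
    refine ⟨40000000 * (N : ℝ) ^ 2 * Real.exp (72 * N), by positivity,
      computesRingSeparators h1 h2 h3 ?_, computesRingTrees h1 h2 h3 le_rfl⟩
    have h4 : 1 ≤ Real.exp (72 * N) := Real.one_le_exp (by positivity)
    have h5 : 0 < (N : ℝ) ^ 2 := by positivity
    nlinarith
  · refine ⟨1, one_pos, ⟨.skip, fun X hX n p hp t ht htn => ?_⟩,
      ⟨.skip, fun X hX n p hp hn => ?_⟩⟩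
    · have hn : 1 < n := by exact_mod_cast ht.trans htn
      exact absurd ⟨X, hX, hp.nontrivial_carrier hn⟩ hF
    · exact absurd ⟨X, hX, hp.nontrivial_carrier hn⟩ hF

theorem DistanceMeasure.dim_pos {X : DistanceMeasure d} (h : X.carrier.Nontrivial) : 0 < d := by
  obtain ⟨x, -, y, -, hxy⟩ := h
  obtain ⟨i, -⟩ := Function.ne_iff.1 hxy
  exact i.pos

theorem card_simplexCells_pos {A : ℝ} (hA : 0 < A) : 0 < (simplexCells d A).card := by
  refine Finset.card_pos.2 ⟨fun _ => (true, 0), mem_simplexCells.2 ?_⟩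
  simp only [Finset.sum_const_zero, Nat.cast_zero]
  positivity

/-- For `d ≥ a²` the power `a^d = (a²)^(d/2)` is at most `d^(d/2)`; the finitely many smaller `d`
are absorbed by `K`. -/
theorem exists_pow_le_mul_rpow {a : ℝ} (ha : 1 ≤ a) :
    ∃ K : ℝ, 1 ≤ K ∧ ∀ d : ℕ, 0 < d → a ^ d ≤ K * (d : ℝ) ^ ((d : ℝ) / 2) := by
  refine ⟨a ^ ⌈a ^ 2⌉₊, one_le_pow₀ ha, fun d hd => ?_⟩
  have hd' : (1 : ℝ) ≤ d := by exact_mod_cast hd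
  have h1 : (1 : ℝ) ≤ (d : ℝ) ^ ((d : ℝ) / 2) := Real.one_le_rpow hd' (by positivity)
  rcases le_total (d : ℝ) (a ^ 2) with h | h
  · have h2 : a ^ d ≤ a ^ ⌈a ^ 2⌉₊ :=
      pow_le_pow_right₀ ha (by exact_mod_cast h.trans (Nat.le_ceil _))
    nlinarith [one_le_pow₀ ha (n := ⌈a ^ 2⌉₊)]
  · have h2 : a ^ d ≤ (d : ℝ) ^ ((d : ℝ) / 2) := by
      calc a ^ d = (a ^ 2) ^ ((d : ℝ) / 2) := by
            rw [← Real.rpow_natCast a 2, ← Real.rpow_mul (by linarith), ← Real.rpow_natCast]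
            congr 1
            push_cast
            ring
        _ ≤ _ := Real.rpow_le_rpow (by positivity) h (by positivity)
    nlinarith [one_le_pow₀ ha (n := ⌈a ^ 2⌉₊)]

theorem GeneralSymmetric.exists_ringAlgorithms (d : ℕ) (Δ μ : ℝ) : ∃ C : ℝ, 0 < C ∧
    ComputesRingSeparators (GeneralSymmetric d Δ μ) ((12000 * Δ * (μ + 1)) ^ d) C ∧
    ComputesRingTrees (GeneralSymmetric d Δ μ) ((12000 * Δ * (μ + 1)) ^ d) C := by
  refine exists_computesRingSeparators_and_computesRingTrees (μ := μ)
    (N := (2 * (⌊2 * Δ * (9 * (μ + 1))⌋₊ + 1)) ^ d) ?_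
  rintro ⟨X, hX, hnt⟩
  have hd := X.dim_pos hnt
  obtain ⟨x, hx, y, hy, hxy⟩ := hnt
  have hΔ : 1 ≤ Δ := GeneralSymmetric.one_le hX hx hy hxy
  have hμ : 1 ≤ μ := (GeneralSymmetric.isPremetric hX).one_le hx hy hxy
  refine ⟨fun Y hY => ⟨GeneralSymmetric.isPremetric hY,
    GeneralSymmetric.isCovering hY (by linarith)⟩, by positivity, ?_⟩
  have h1 : (⌊2 * Δ * (9 * (μ + 1))⌋₊ : ℝ) ≤ 2 * Δ * (9 * (μ + 1)) := Nat.floor_le (by positivity)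
  have h2 : 1 ≤ Δ * (μ + 1) := one_le_mul_of_one_le_of_one_le hΔ (by linarith)
  push_cast
  calc 72 * (2 * ((⌊2 * Δ * (9 * (μ + 1))⌋₊ : ℝ) + 1)) ^ d
      -- The balance constant is a pure `d`-th power here, so the factor `72` is moved under the
      -- exponent, using `0 < d`.
      ≤ 72 ^ d * (2 * ((⌊2 * Δ * (9 * (μ + 1))⌋₊ : ℝ) + 1)) ^ d :=
        mul_le_mul_of_nonneg_right (le_self_pow₀ (by norm_num) hd.ne') (by positivity)
    _ = (72 * (2 * ((⌊2 * Δ * (9 * (μ + 1))⌋₊ : ℝ) + 1))) ^ d := (mul_pow _ _ _).symm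
    _ ≤ _ := pow_le_pow_left₀ (by positivity) (by nlinarith) d

theorem SqrtSymBregman.exists_ringAlgorithms {K : ℝ} (d : ℕ) (μ : ℝ)
    (hK : ∀ d : ℕ, 0 < d → 72 * 60 ^ d ≤ K * (d : ℝ) ^ ((d : ℝ) / 2)) : ∃ C : ℝ, 0 < C ∧
    ComputesRingSeparators (SqrtSymBregman d μ) (K * (d : ℝ) ^ ((d : ℝ) / 2) * (μ + 1) ^ d) C ∧
    ComputesRingTrees (SqrtSymBregman d μ) (K * (d : ℝ) ^ ((d : ℝ) / 2) * (μ + 1) ^ d) C := by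
  refine exists_computesRingSeparators_and_computesRingTrees (μ := μ)
    (N := (simplexCells d (9 * (μ + 1))).card) ?_
  rintro ⟨X, hX, hnt⟩
  have hd := X.dim_pos hnt
  obtain ⟨x, hx, y, hy, hxy⟩ := hnt
  have hμ : 1 ≤ μ := (SqrtSymBregman.isPremetric hX).one_le hx hy hxy
  have hA : 0 < 9 * (μ + 1) := by linarith
  refine ⟨fun Y hY => ⟨SqrtSymBregman.isPremetric hY, SqrtSymBregman.isCovering hd hY hA⟩,
    card_simplexCells_pos hA, ?_⟩
  have he := Real.exp_one_lt_d9
  calc 72 * ((simplexCells d (9 * (μ + 1))).card : ℝ)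
      ≤ 72 * (2 * Real.exp 1 * (9 * (μ + 1) + 1)) ^ d :=
        mul_le_mul_of_nonneg_left (card_simplexCells_le hA) (by norm_num)
    _ ≤ 72 * (60 * (μ + 1)) ^ d := by
        refine mul_le_mul_of_nonneg_left (pow_le_pow_left₀ (by positivity) ?_ d) (by norm_num)
        nlinarith
    _ = 72 * 60 ^ d * (μ + 1) ^ d := by rw [mul_pow, mul_assoc]
    _ ≤ _ := mul_le_mul_of_nonneg_right (hK d hd) (by positivity)

theorem SqrtBregman.exists_ringAlgorithms {K : ℝ} (d : ℕ) (μ : ℝ)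
    (hK : ∀ d : ℕ, 0 < d → 72 * 500 ^ d ≤ K * (d : ℝ) ^ d) : ∃ C : ℝ, 0 < C ∧
    ComputesRingSeparators (SqrtBregman d μ) (K * (d : ℝ) ^ d * (μ + 1) ^ (2 * d)) C ∧
    ComputesRingTrees (SqrtBregman d μ) (K * (d : ℝ) ^ d * (μ + 1) ^ (2 * d)) C := by
  refine exists_computesRingSeparators_and_computesRingTrees (μ := μ)
    (N := (simplexCells d ((9 * (μ + 1)) ^ 2)).card) ?_
  rintro ⟨X, hX, hnt⟩
  have hd := X.dim_pos hnt
  obtain ⟨x, hx, y, hy, hxy⟩ := hnt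
  have hμ : 1 ≤ μ := (SqrtBregman.isPremetric hX).one_le hx hy hxy
  have hA : 0 < 9 * (μ + 1) := by linarith
  refine ⟨fun Y hY => ⟨SqrtBregman.isPremetric hY, SqrtBregman.isCovering hd hY hA⟩,
    card_simplexCells_pos (by positivity), ?_⟩
  have he := Real.exp_one_lt_d9
  calc 72 * ((simplexCells d ((9 * (μ + 1)) ^ 2)).card : ℝ)
      ≤ 72 * (2 * Real.exp 1 * ((9 * (μ + 1)) ^ 2 + 1)) ^ d :=
        mul_le_mul_of_nonneg_left (card_simplexCells_le (by positivity)) (by norm_num)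
    -- `2e (81 + 1) < 500`.
    _ ≤ 72 * (500 * (μ + 1) ^ 2) ^ d := by
        refine mul_le_mul_of_nonneg_left (pow_le_pow_left₀ (by positivity) ?_ d) (by norm_num)
        have h1 : 1 ≤ (μ + 1) ^ 2 := one_le_pow₀ (by linarith)
        nlinarith
    _ = 72 * 500 ^ d * (μ + 1) ^ (2 * d) := by rw [mul_pow, mul_assoc, pow_mul]
    _ ≤ _ := mul_le_mul_of_nonneg_right (hK d hd) (by positivity)

end

theorem mainTheorem8 :
    (∃ K : ℝ, 0 < K ∧ ∀ (d : ℕ) (Δ μ : ℝ),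
      ComputesApproxBalls (GeneralSymmetric d Δ μ) μ K ∧ ∃ C : ℝ, 0 < C ∧
      ComputesRingSeparators (GeneralSymmetric d Δ μ) ((K * Δ * (μ + 1)) ^ d) C ∧
      ComputesRingTrees (GeneralSymmetric d Δ μ) ((K * Δ * (μ + 1)) ^ d) C) ∧
    (∃ K : ℝ, 0 < K ∧ ∀ (d : ℕ) (μ : ℝ),
      ComputesApproxBalls (SqrtSymBregman d μ) μ K ∧ ∃ C : ℝ, 0 < C ∧
      ComputesRingSeparators (SqrtSymBregman d μ)
        (K * (d : ℝ) ^ ((d : ℝ) / 2) * (μ + 1) ^ d) C ∧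
      ComputesRingTrees (SqrtSymBregman d μ)
        (K * (d : ℝ) ^ ((d : ℝ) / 2) * (μ + 1) ^ d) C) ∧
    (∃ K : ℝ, 0 < K ∧ ∀ (d : ℕ) (μ : ℝ),
      ComputesApproxBalls (SqrtBregman d μ) μ K ∧ ∃ C : ℝ, 0 < C ∧
      ComputesRingSeparators (SqrtBregman d μ) (K * (d : ℝ) ^ d * (μ + 1) ^ (2 * d)) C ∧
      ComputesRingTrees (SqrtBregman d μ) (K * (d : ℝ) ^ d * (μ + 1) ^ (2 * d)) C) := by
  -- The value `12000` is dictated by the time of the ball search; the balance constants would allow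
  -- a smaller one.
  refine ⟨⟨12000, by norm_num, fun d Δ μ =>
    ⟨computesApproxBalls fun _ hX => GeneralSymmetric.isPremetric hX,
      GeneralSymmetric.exists_ringAlgorithms d Δ μ⟩⟩, ?_, ?_⟩
  · obtain ⟨K, hK1, hK⟩ := exists_pow_le_mul_rpow (a := 60) (by norm_num)
    refine ⟨12000 * K, by linarith, fun d μ =>
      ⟨(computesApproxBalls fun _ hX => SqrtSymBregman.isPremetric hX).mono (by linarith),
        SqrtSymBregman.exists_ringAlgorithms d μ fun d hd => ?_⟩⟩
    have h1 := hK d hd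
    have h2 : (0 : ℝ) < 60 ^ d := by positivity
    linarith
  · obtain ⟨K, hK1, hK⟩ := exists_pow_le_mul_rpow (a := 500) (by norm_num)
    refine ⟨12000 * K, by linarith, fun d μ =>
      ⟨(computesApproxBalls fun _ hX => SqrtBregman.isPremetric hX).mono (by linarith),
        SqrtBregman.exists_ringAlgorithms d μ fun d hd => ?_⟩⟩
    have h1 := hK d hd
    have h2 : (0 : ℝ) < 500 ^ d := by positivity
    have hd' : (1 : ℝ) ≤ d := by exact_mod_cast hd
    have h3 : (d : ℝ) ^ ((d : ℝ) / 2) ≤ (d : ℝ) ^ d := by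
      rw [← Real.rpow_natCast (d : ℝ) d]
      exact Real.rpow_le_rpow_of_exponent_le hd' (by linarith)
    have h4 : K * (d : ℝ) ^ ((d : ℝ) / 2) ≤ K * (d : ℝ) ^ d :=
      mul_le_mul_of_nonneg_left h3 (by linarith)
    linarith
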